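/- Let $n\ge 2$, $\kappa>0$ and $\gamma\in(-\infty,\infty]$ be fixed, $r=|x|$, and let $B(R)\subset\mathbb R^n$ be the ball of radius $R$ centred at the origin. Consider the eigenvalue problem $$\Big(-\Delta-\frac{\kappa}{r}\Big)\varphi=E\varphi\ \text{ on } B(R),\qquad (\partial_r+\gamma)\varphi=0\ \text{ on }\partial B(R), \tag{1}$$ understood weakly in $H^1(B(R))$; for $\gamma=\infty$ the boundary condition is $\varphi=0$. Let $M(a,b;x)=\sum_{k\ge0}\frac{a^{(k)}}{b^{(k)}}\frac{x^k}{k!}$, with rising factorials $a^{(k)}=a(a+1)\cdots(a+k-1)$, be Kummer's function. Put $m=(n-3)/2$, $a_0(z)=m+1-z$, $b_0=2m+2=n-1$, $\rho_0(z)=\kappa R/z$, and consider the equation $$2\frac{a_0(z)}{b_0}M(a_0(z)+1,b_0+1;\rho_0(z))=\Big(1-\frac{2\gamma z}{\kappa}\Big)M(a_0(z),b_0;\rho_0(z)), \tag{2}$$ which is read as $M(a_0(z),b_0;\rho_0(z))=0$ if $\gamma=\infty$. (i) Let $0<R<\infty$. For $E<0$, a function is a radial eigenfunction of (1) with eigenvalue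 $E$ if and only if $E=-\kappa^2/(4z^2)$ for a positive solution $z$ of (2) and the function is a nonzero real multiple of $$M(a_0(z),b_0;2\sqrt{|E|}\,r)\,e^{-\sqrt{|E|}\,r}.$$ For $E>0$ the same holds with $\sqrt{|E|}$ replaced by $\sqrt{-E}=i\sqrt{|E|}$ and $z$ by $-iz$: a function is a radial eigenfunction of (1) with eigenvalue $E$ if and only if $E=\kappa^2/(4z^2)$ for some $z>0$ such that $-iz$ solves (2), and the function is a nonzero real multiple of the (real-valued) function $M(a_0(-iz),b_0;2i\sqrt{|E|}\,r)\,e^{-i\sqrt{|E|}\,r}$. On the whole space $\mathbb R^n$, a function is a radial eigenfunction of $-\Delta-\kappa/r$ in $H^1(\mathbb R^n)$ with eigenvalue $E\in\mathbb R$ if and only if $$E=-\frac{\kappa^2}{4\,(j+(n-3)/2)^2}\quad\text{for some } j\in\{1,2,\dots\}$$ and the function is a nonzero multiple of $M(a_0(z),b_0;2\sqrt{|E|}\,r)e^{-\sqrt{|E|}\,r}$ with $z=j+(n-3)/2$. For $E<0$ the same characterization holds for the nonzero radial weak solutions of $(-\Delta-\kappa/r)\varphi=E\varphi$ in $H^1_{\mathrm{loc}}(\mathbb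 R^n)$ that tend to $0$ as $r\to\infty$. Furthermore, for these $z$ and $E$, $M(a_0(z),b_0;2\sqrt{|E|}\,r)$ is a polynomial in $r$ of degree $j-1$. (ii) Assume further that $\gamma\in(-\kappa/(n-1),\infty]$. For all sufficiently large $R$, (2) has a smallest positive solution $z(R)$ and (1) has a smallest eigenvalue $E(R)$, and for each $\epsilon>0$, as $R\to\infty$, $$z(R)=\frac{n-1}{2}+O\Big(\exp\Big\{-\frac{2(1-\epsilon)\kappa R}{n-1}\Big\}\Big),\qquad E(R)=-\frac{\kappa^2}{(n-1)^2}+O\Big(\exp\Big\{-(1-\epsilon)\frac{2\kappa}{n-1}R\Big\}\Big).$$ -/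

import Mathlib

open MeasureTheory Filter Topology Asymptotics
open scoped ContDiff

noncomputable section

/-- Euclidean space `ℝⁿ`. -/
abbrev Eucl (n : ℕ) := EuclideanSpace ℝ (Fin n)

/-! ### Kummer's function and the transcendental equation -/

/-- Kummer's confluent hypergeometric function of the first kind,
`M(a, b; x) = ∑ₖ a⁽ᵏ⁾ / b⁽ᵏ⁾ · xᵏ / k!` with rising factorials `a⁽ᵏ⁾ = a (a + 1) ⋯ (a + k - 1)`.
The series converges absolutely for every `x` whenever `b ∉ {0, -1, -2, …}`. -/
def kummerM {𝕂 : Type*} [RCLike 𝕂] (a b x : 𝕂) : 𝕂 :=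
  ∑' k : ℕ, (ascPochhammer 𝕂 k).eval a / (ascPochhammer 𝕂 k).eval b * (x ^ k / (k.factorial : 𝕂))

/-- `a₀(z) = m + 1 - z` with `m = (n - 3) / 2`. -/
def a₀ {𝕂 : Type*} [RCLike 𝕂] (n : ℕ) (z : 𝕂) : 𝕂 := ((n : 𝕂) - 3) / 2 + 1 - z

/-- `b₀ = 2 m + 2` with `m = (n - 3) / 2`. -/
def b₀ (𝕂 : Type*) [RCLike 𝕂] (n : ℕ) : 𝕂 := 2 * (((n : 𝕂) - 3) / 2) + 2

/-- The transcendental equation for `z`, where `ρ₀ = κ R / z`: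
`2 (a₀ / b₀) M(a₀ + 1, b₀ + 1; ρ₀) = (1 - 2 γ z / κ) M(a₀, b₀; ρ₀)` if `γ` is finite, and
`M(a₀, b₀; ρ₀) = 0` if `γ = ∞`. -/
def TransEq {𝕂 : Type*} [RCLike 𝕂] (n : ℕ) (κ : ℝ) (γ : WithTop ℝ) (R : ℝ) (z : 𝕂) : Prop :=
  match γ with
  | ⊤ => kummerM (a₀ n z) (b₀ 𝕂 n) ((κ : 𝕂) * (R : 𝕂) / z) = 0
  | (c : ℝ) =>
      2 * (a₀ n z / b₀ 𝕂 n) * kummerM (a₀ n z + 1) (b₀ 𝕂 n + 1) ((κ : 𝕂) * (R : 𝕂) / z)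
        = (1 - 2 * (c : 𝕂) * z / (κ : 𝕂)) *
            kummerM (a₀ n z) (b₀ 𝕂 n) ((κ : 𝕂) * (R : 𝕂) / z)

/-! ### Sobolev functions, traces -/

/-- `G` is the weak gradient of `u` on the open set `Ω`. -/
def IsWeakGradient {n : ℕ} (Ω : Set (Eucl n)) (u : Eucl n → ℝ) (G : Eucl n → Eucl n) : Prop :=
  ∀ ψ : Eucl n → ℝ, ContDiff ℝ ∞ ψ → HasCompactSupport ψ → tsupport ψ ⊆ Ω →
    ∫ x in Ω, u x • gradient ψ x = - ∫ x in Ω, ψ x • G x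

/-- `u ∈ H¹(Ω)` with weak gradient `G`. -/
def IsH1 {n : ℕ} (Ω : Set (Eucl n)) (u : Eucl n → ℝ) (G : Eucl n → Eucl n) : Prop :=
  MemLp u 2 (volume.restrict Ω) ∧ MemLp G 2 (volume.restrict Ω) ∧ IsWeakGradient Ω u G

/-- `u ∈ H¹_loc(ℝⁿ)` with weak gradient `G`. -/
def IsH1Loc {n : ℕ} (u : Eucl n → ℝ) (G : Eucl n → Eucl n) : Prop :=
  (∀ R : ℝ, MemLp u 2 (volume.restrict (Metric.ball 0 R)) ∧
    MemLp G 2 (volume.restrict (Metric.ball 0 R))) ∧ IsWeakGradient Set.univ u G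

/-- The ball `B(R)` of radius `R` centred at the origin of `ℝⁿ`. -/
abbrev B (n : ℕ) (R : ℝ) : Set (Eucl n) := Metric.ball 0 R

/-- The surface measure on `∂B(R)`, as a measure on `ℝⁿ`: the surface measure of the unit sphere,
transported by `y ↦ R y` and multiplied by `Rⁿ⁻¹`. -/
def surf (n : ℕ) (R : ℝ) : Measure (Eucl n) :=
  ENNReal.ofReal (R ^ (n - 1)) •
    Measure.map (fun y : Metric.sphere (0 : Eucl n) 1 => R • (y : Eucl n))
      (volume : Measure (Eucl n)).toSphere

/-- `g ∈ L²(∂B(R))` is the boundary trace of the function `u ∈ H¹(B(R))` with weak gradient `G`: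
there are functions, smooth up to the boundary, that converge to `u` in `H¹(B(R))` and whose
restrictions to `∂B(R)` converge to `g` in `L²(∂B(R))`. -/
def IsTrace {n : ℕ} (R : ℝ) (u : Eucl n → ℝ) (G : Eucl n → Eucl n) (g : Eucl n → ℝ) : Prop :=
  MemLp g 2 (surf n R) ∧ ∃ f : ℕ → Eucl n → ℝ, (∀ k, ContDiff ℝ ∞ (f k)) ∧
    Tendsto (fun k => eLpNorm (fun x => f k x - u x) 2 (volume.restrict (B n R))) atTop (𝓝 0) ∧
    Tendsto (fun k => eLpNorm (fun x => gradient (f k) x - G x) 2 (volume.restrict (B n R)))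
      atTop (𝓝 0) ∧
    Tendsto (fun k => eLpNorm (fun x => f k x - g x) 2 (surf n R)) atTop (𝓝 0)

/-- `u ∈ H¹(B(R))` with weak gradient `G` and boundary trace `g`. -/
def IsH1Ball {n : ℕ} (R : ℝ) (u : Eucl n → ℝ) (G : Eucl n → Eucl n) (g : Eucl n → ℝ) : Prop :=
  IsH1 (B n R) u G ∧ IsTrace R u G g

/-! ### The eigenvalue problems -/

/-- The bilinear form of `-Δ - κ/r - E` on `Ω`, without boundary term:
`∫_Ω ∇u · ∇ψ - κ ∫_Ω u ψ / r - E ∫_Ω u ψ`, where `G = ∇u` and `H = ∇ψ`. -/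
def schroForm {n : ℕ} (Ω : Set (Eucl n)) (κ E : ℝ)
    (u : Eucl n → ℝ) (G : Eucl n → Eucl n) (ψ : Eucl n → ℝ) (H : Eucl n → Eucl n) : ℝ :=
  (∫ x in Ω, inner ℝ (G x) (H x)) - κ * (∫ x in Ω, u x * ψ x / ‖x‖) - E * ∫ x in Ω, u x * ψ x

/-- `u` is an eigenfunction (in the weak sense in `H¹(B(R))`) with eigenvalue `E` of
`(-Δ - κ/r) u = E u` on `B(R)` with `(∂ᵣ + γ) u = 0` on `∂B(R)`; for `γ = ∞` the boundary condition
is the Dirichlet condition. -/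
def IsEigenfunctionBall {n : ℕ} (κ : ℝ) (γ : WithTop ℝ) (R E : ℝ) (u : Eucl n → ℝ) : Prop :=
  ¬ (u =ᵐ[volume.restrict (B n R)] 0) ∧
  ∃ (G : Eucl n → Eucl n) (g : Eucl n → ℝ), IsH1Ball R u G g ∧
    match γ with
    | ⊤ => g =ᵐ[surf n R] 0 ∧
        ∀ (ψ : Eucl n → ℝ) (H : Eucl n → Eucl n) (h : Eucl n → ℝ), IsH1Ball R ψ H h →
          h =ᵐ[surf n R] 0 → schroForm (B n R) κ E u G ψ H = 0
    | (c : ℝ) =>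
        ∀ (ψ : Eucl n → ℝ) (H : Eucl n → Eucl n) (h : Eucl n → ℝ), IsH1Ball R ψ H h →
          schroForm (B n R) κ E u G ψ H + c * ∫ x, g x * h x ∂(surf n R) = 0

/-- `E` is an eigenvalue of the problem on `B(R)`. -/
def IsEigenvalueBall (n : ℕ) (κ : ℝ) (γ : WithTop ℝ) (R E : ℝ) : Prop :=
  ∃ u : Eucl n → ℝ, IsEigenfunctionBall κ γ R E u

/-- `(-Δ - κ/r) u = E u` weakly on `ℝⁿ`, where `G = ∇u`. -/
def IsWeakSolution {n : ℕ} (κ E : ℝ) (u : Eucl n → ℝ) (G : Eucl n → Eucl n) : Prop :=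
  ∀ ψ : Eucl n → ℝ, ContDiff ℝ ∞ ψ → HasCompactSupport ψ →
    schroForm Set.univ κ E u G ψ (gradient ψ) = 0

/-- `u ∈ H¹(ℝⁿ)` is an eigenfunction of `-Δ - κ/r` on `ℝⁿ` with eigenvalue `E`. -/
def IsEigenfunctionSpace {n : ℕ} (κ E : ℝ) (u : Eucl n → ℝ) : Prop :=
  ¬ (u =ᵐ[volume] 0) ∧ ∃ G : Eucl n → Eucl n, IsH1 Set.univ u G ∧ IsWeakSolution κ E u G

/-- `u ∈ H¹_loc(ℝⁿ)` is a nonzero solution of `(-Δ - κ/r) u = E u` on `ℝⁿ` that tends to `0` at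
infinity. -/
def IsDecayingSolution {n : ℕ} (κ E : ℝ) (u : Eucl n → ℝ) : Prop :=
  ¬ (u =ᵐ[volume] 0) ∧ (∃ G : Eucl n → Eucl n, IsH1Loc u G ∧ IsWeakSolution κ E u G) ∧
  ∀ ε > 0, ∃ ρ : ℝ, ∀ᵐ x ∂(volume : Measure (Eucl n)), ρ < ‖x‖ → |u x| < ε

/-- `u` is radial on `Ω` (almost everywhere a function of `r = ‖x‖`). -/
def IsRadialOn {n : ℕ} (Ω : Set (Eucl n)) (u : Eucl n → ℝ) : Prop :=
  ∃ f : ℝ → ℝ, ∀ᵐ x ∂(volume.restrict Ω), u x = f ‖x‖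

end

/-! ### Exponential generating functions -/

/-! Everything is compared with one function, the solution f = `regSol n κ E` of r f'' + (n-1) f' +
(κ + E r) f = 0 with f(0) = 1, an everywhere convergent power series for every real E. If 2σz = κ
and σ² = -E, then M(a₀(z), b₀; 2σr) e^{-σr} solves the same equation with value 1 at 0, so it equals
f for r ≥ 0 (`kummerM_mul_exp_eq_regSol`). The choice σ = √|E| covers negative E, and σ = i√|E| with
-iz in place of z covers positive E. Evaluating f and f' at R turns the boundary condition into the
transcendental equation (`transEq_iff_bdryCond`).

The analytic core is `exists_eq_regSol_of_weak`: a radial weak solution in a ball is c f(‖x‖). The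
spherical mean U of u has the spherical mean p of the radial derivative as weak derivative, and
radial test functions give a weak equation for the flux r^{n-1} p. Since these test functions need
not vanish at the origin, the flux tends to 0 there, which excludes the singular solution by a
Wronskian argument (`radial_system_unique`). Conversely, Green's formula (`schroForm_profile`)
evaluates the form of a radial solution against any H¹ function as f'(R) times the integral of the
trace. The boundary conditions are read off from this formula and from the average of the trace. The
Coulomb term passes to limits of smooth functions because Hardy's identity bounds L²(dx/‖x‖) by the
H¹ norm and the trace.

On the whole space, a virial identity shows that for E ≥ 0 the functions f and f' are not both
square integrable with weight r^{n-1} (`not_integrableOn_regSol`). For E < 0, either a₀(z) is a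
nonpositive integer and M is a polynomial, or |M| outgrows e^{x/2} and |f| tends to infinity
(`tendsto_abs_kummerM_mul_exp`).

For (ii) write b = n - 1, so a₀(z) = b/2 - z, and let T(z) be the difference of the two sides. All
terms of its series after the zeroth contain the factor a₀/b. What remains after division is at
least e^{qρ} for any fixed q < 1 and large ρ, uniformly in a₀ (`exists_exp_le_of_hasSum`). Hence T
is positive up to an exponentially small distance below b/2. It is nonpositive at b/2, or at an
exponentially small distance above b/2 when γ ≥ κ/b. This locates the first zero
(`exists_isLeast_transEq`). Its energy is the smallest among all eigenvalues, radial or not. Indeed,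
for z' below the first zero, f is positive on [0, R] with f'(R) + γ f(R) ≥ 0 for finite γ, and
Jacobi's inequality (`schroForm_self_ge`) bounds every eigenvalue below by -κ²/(4z'²); then z' tends
to the first zero (`isLeast_eigenvalue`). -/

/-- The exponential generating function `∑ₖ cₖ xᵏ / k!` of the sequence `c`. -/
noncomputable def egf {𝕂 : Type*} [RCLike 𝕂] (c : ℕ → 𝕂) (x : 𝕂) : 𝕂 :=
  ∑' k : ℕ, c k * (x ^ k / (k.factorial : 𝕂))

/-- A sequence that grows at most exponentially. -/
def ExpBounded {𝕂 : Type*} [RCLike 𝕂] (c : ℕ → 𝕂) : Prop :=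
  ∃ C A : ℝ, 0 ≤ C ∧ 0 ≤ A ∧ ∀ k, ‖c k‖ ≤ C * A ^ k

section EGF

variable {𝕂 : Type*} [RCLike 𝕂]

theorem ExpBounded.shift {c : ℕ → 𝕂} (hc : ExpBounded c) : ExpBounded fun k => c (k + 1) := by
  obtain ⟨C, A, hC, hA, h⟩ := hc
  refine ⟨C * A, A, by positivity, hA, fun k => (h (k + 1)).trans_eq ?_⟩
  ring

theorem ExpBounded.natCast_mul {c : ℕ → 𝕂} (hc : ExpBounded c) :
    ExpBounded fun k => (k : 𝕂) * c k := by
  obtain ⟨C, A, hC, hA, h⟩ := hc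
  refine ⟨C, 2 * A, hC, by positivity, fun k => ?_⟩
  rw [norm_mul, RCLike.norm_natCast, mul_pow]
  have h2 : (k : ℝ) ≤ 2 ^ k := by exact_mod_cast Nat.lt_two_pow_self.le
  calc (k : ℝ) * ‖c k‖ ≤ 2 ^ k * (C * A ^ k) := by
        apply mul_le_mul h2 (h k) (norm_nonneg _) (by positivity)
    _ = _ := by ring

theorem norm_egf_term_le {c : ℕ → 𝕂} {C A X : ℝ} (hA : 0 ≤ A) (hC : 0 ≤ C)
    {x : 𝕂} {k : ℕ} (h : ‖c k‖ ≤ C * A ^ k) (hx : ‖x‖ ≤ X) :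
    ‖c k * (x ^ k / (k.factorial : 𝕂))‖ ≤ C * ((A * X) ^ k / k.factorial) := by
  rw [norm_mul, norm_div, norm_pow, RCLike.norm_natCast, mul_pow]
  calc ‖c k‖ * (‖x‖ ^ k / k.factorial) ≤ (C * A ^ k) * (X ^ k / k.factorial) := by
        gcongr
    _ = _ := by ring

theorem summable_egf_majorant (C A X : ℝ) :
    Summable fun k : ℕ => C * ((A * X) ^ k / k.factorial) :=
  (Real.summable_pow_div_factorial (A * X)).mul_left C

theorem ExpBounded.summable {c : ℕ → 𝕂} (hc : ExpBounded c) (x : 𝕂) :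
    Summable fun k : ℕ => c k * (x ^ k / (k.factorial : 𝕂)) := by
  obtain ⟨C, A, hC, hA, h⟩ := hc
  exact Summable.of_norm_bounded (summable_egf_majorant C A ‖x‖)
    fun k => norm_egf_term_le hA hC (h k) le_rfl

theorem ExpBounded.hasSum {c : ℕ → 𝕂} (hc : ExpBounded c) (x : 𝕂) :
    HasSum (fun k : ℕ => c k * (x ^ k / (k.factorial : 𝕂))) (egf c x) :=
  (hc.summable x).hasSum

theorem egf_zero (c : ℕ → 𝕂) : egf c 0 = c 0 := by
  unfold egf
  rw [tsum_eq_single 0]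
  · simp
  · intro k hk
    simp [hk]

/-- The derivative of an exponential generating function is that of the shifted sequence. -/
theorem ExpBounded.hasDerivAt_egf {c : ℕ → 𝕂} (hc : ExpBounded c) (x : 𝕂) :
    HasDerivAt (egf c) (egf (fun k => c (k + 1)) x) x := by
  have hs := hc.shift
  obtain ⟨C, A, hC, hA, h⟩ := hs
  -- The constant term is split off first, so that the series can be indexed from `k + 1` and
  -- differentiated without truncated subtraction.
  have key : HasDerivAt (fun z : 𝕂 => ∑' k : ℕ, c (k + 1) * (z ^ (k + 1) / ((k + 1).factorial : 𝕂)))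
      (∑' k : ℕ, c (k + 1) * (x ^ k / (k.factorial : 𝕂))) x := by
    refine hasDerivAt_tsum_of_isPreconnected (t := Metric.ball (0 : 𝕂) (‖x‖ + 1))
      (g := fun (k : ℕ) (z : 𝕂) => c (k + 1) * (z ^ (k + 1) / ((k + 1).factorial : 𝕂)))
      (g' := fun (k : ℕ) (z : 𝕂) => c (k + 1) * (z ^ k / (k.factorial : 𝕂)))
      (summable_egf_majorant C A (‖x‖ + 1)) Metric.isOpen_ball
      (convex_ball (0 : 𝕂) (‖x‖ + 1)).isPreconnected (fun k y _ => ?_) (fun k y hy => ?_)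
      (mem_ball_zero_iff.2 (lt_add_one ‖x‖)) ?_ (mem_ball_zero_iff.2 (lt_add_one ‖x‖))
    · have h1 := ((hasDerivAt_pow (k + 1) y).div_const ((k + 1).factorial : 𝕂)).const_mul (c (k + 1))
      refine h1.congr_deriv ?_
      have h2 : ((k + 1).factorial : 𝕂) = (k + 1) * k.factorial := by
        rw [Nat.factorial_succ]; push_cast; ring
      have h3 : (k.factorial : 𝕂) ≠ 0 := by exact_mod_cast k.factorial_ne_zero
      have h4 : (k : 𝕂) + 1 ≠ 0 := by exact_mod_cast k.succ_ne_zero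
      rw [h2]
      push_cast
      field_simp
    · exact norm_egf_term_le (c := fun k => c (k + 1)) hA hC (h k) (mem_ball_zero_iff.1 hy).le
    · exact (summable_nat_add_iff (f := fun k : ℕ => c k * (x ^ k / (k.factorial : 𝕂))) 1).2
        (hc.summable x)
  have h5 : egf c = fun z : 𝕂 =>
      c 0 + ∑' k : ℕ, c (k + 1) * (z ^ (k + 1) / ((k + 1).factorial : 𝕂)) := by
    funext z
    unfold egf
    rw [(hc.summable z).tsum_eq_zero_add]
    simp
  rw [h5]
  exact key.const_add (c 0)

/-- The operator x d/dx multiplies the k-th coefficient by k. This is what turns the differential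
equations below into recursions. -/
theorem ExpBounded.mul_egf_shift {c : ℕ → 𝕂} (hc : ExpBounded c) (x : 𝕂) :
    x * egf (fun k => c (k + 1)) x = egf (fun k => (k : 𝕂) * c k) x := by
  unfold egf
  rw [(hc.natCast_mul.summable x).tsum_eq_zero_add, ← tsum_mul_left]
  simp only [Nat.cast_zero, zero_mul, zero_add]
  congr 1
  funext k
  have h2 : ((k + 1).factorial : 𝕂) = (k + 1) * k.factorial := by
    rw [Nat.factorial_succ]; push_cast; ring
  have h3 : (k.factorial : 𝕂) ≠ 0 := by exact_mod_cast k.factorial_ne_zero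
  have h4 : (k : 𝕂) + 1 ≠ 0 := by exact_mod_cast k.succ_ne_zero
  rw [h2]
  push_cast
  field_simp
  ring

theorem ExpBounded.contDiff_egf {c : ℕ → 𝕂} (hc : ExpBounded c) : ContDiff 𝕂 ∞ (egf c) := by
  rw [contDiff_infty]
  intro m
  induction m generalizing c with
  | zero => exact contDiff_zero.2 (continuous_iff_continuousAt.2 fun x => (hc.hasDerivAt_egf x).continuousAt)
  | succ m ih =>
    push_cast
    refine contDiff_succ_iff_deriv.2 ⟨fun x => (hc.hasDerivAt_egf x).differentiableAt, by simp, ?_⟩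
    rw [show deriv (egf c) = egf fun k => c (k + 1) from funext fun x => (hc.hasDerivAt_egf x).deriv]
    exact ih hc.shift

end EGF

/-! ### Kummer's function -/

section Kummer

variable {𝕂 : Type*} [RCLike 𝕂]

/-- The coefficients `a⁽ᵏ⁾ / b⁽ᵏ⁾` of Kummer's function. -/
noncomputable def kummerCoeff (a b : 𝕂) (k : ℕ) : 𝕂 :=
  (ascPochhammer 𝕂 k).eval a / (ascPochhammer 𝕂 k).eval b

theorem kummerM_eq_egf (a b : 𝕂) : kummerM a b = egf (kummerCoeff a b) := rfl

theorem kummerCoeff_zero (a b : 𝕂) : kummerCoeff a b 0 = 1 := by simp [kummerCoeff]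

theorem kummerCoeff_succ (a b : 𝕂) (k : ℕ) :
    kummerCoeff a b (k + 1) = kummerCoeff a b k * ((a + k) / (b + k)) := by
  simp only [kummerCoeff, ascPochhammer_succ_eval]
  rw [mul_div_mul_comm]

/-- Here the factor is taken from the front of the rising factorials. This form yields the
derivative formula, and later it extracts a₀ from every coefficient of positive index. -/
theorem kummerCoeff_succ' (a b : 𝕂) (k : ℕ) :
    kummerCoeff a b (k + 1) = a / b * kummerCoeff (a + 1) (b + 1) k := by
  simp only [kummerCoeff, ascPochhammer_succ_left, Polynomial.eval_mul, Polynomial.eval_X,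
    Polynomial.eval_comp, Polynomial.eval_add, Polynomial.eval_one]
  rw [mul_div_mul_comm]

theorem le_norm_ofReal_add_natCast {b : ℝ} (hb : 1 ≤ b) (k : ℕ) : 1 + k ≤ ‖(b : 𝕂) + k‖ := by
  have : ((b : 𝕂) + k) = ((b + k : ℝ) : 𝕂) := by push_cast; ring
  rw [this, RCLike.norm_ofReal, abs_of_nonneg (by positivity)]
  linarith

theorem ofReal_add_natCast_ne_zero {b : ℝ} (hb : 1 ≤ b) (k : ℕ) : (b : 𝕂) + k ≠ 0 := by
  have := le_norm_ofReal_add_natCast (𝕂 := 𝕂) hb k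
  rw [← norm_pos_iff]
  have h : (0 : ℝ) ≤ k := k.cast_nonneg
  linarith

/-- Consecutive ratios satisfy |a + k| / |b + k| ≤ (A + k) / (1 + k) ≤ 1 + A. Uniformity over ‖a‖ ≤
A is needed for joint continuity in the parameter. -/
theorem norm_kummerCoeff_le {a : 𝕂} {b A : ℝ} (hb : 1 ≤ b) (ha : ‖a‖ ≤ A) (k : ℕ) :
    ‖kummerCoeff a (b : 𝕂) k‖ ≤ 1 * (1 + A) ^ k := by
  induction k with
  | zero => simp [kummerCoeff_zero]
  | succ k ih =>
    have hA : 0 ≤ A := (norm_nonneg a).trans ha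
    rw [kummerCoeff_succ, norm_mul, pow_succ, ← mul_assoc]
    refine mul_le_mul ih ?_ (norm_nonneg _) (by positivity)
    have h1 := le_norm_ofReal_add_natCast (𝕂 := 𝕂) hb k
    have hk : (0 : ℝ) ≤ k := k.cast_nonneg
    rw [norm_div, div_le_iff₀ (by linarith)]
    have h2 : ‖a + k‖ ≤ A + k := (norm_add_le _ _).trans (by rw [RCLike.norm_natCast]; linarith)
    nlinarith

theorem expBounded_kummerCoeff (a : 𝕂) {b : ℝ} (hb : 1 ≤ b) :
    ExpBounded (kummerCoeff a (b : 𝕂)) :=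
  ⟨1, 1 + ‖a‖, by positivity, by positivity, norm_kummerCoeff_le hb le_rfl⟩

theorem kummerM_zero (a b : 𝕂) : kummerM a b 0 = 1 := by
  rw [kummerM_eq_egf, egf_zero, kummerCoeff_zero]

theorem egf_kummerCoeff_shift (a b x : 𝕂) :
    egf (fun k => kummerCoeff a b (k + 1)) x = a / b * kummerM (a + 1) (b + 1) x := by
  simp only [kummerM_eq_egf, egf, kummerCoeff_succ', ← tsum_mul_left]
  congr 1
  funext k
  ring

/-- `M'(a, b; x) = (a / b) M(a + 1, b + 1; x)`. -/
theorem hasDerivAt_kummerM (a : 𝕂) {b : ℝ} (hb : 1 ≤ b) (x : 𝕂) :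
    HasDerivAt (kummerM a (b : 𝕂)) (a / b * kummerM (a + 1) (b + 1) x) x := by
  rw [← egf_kummerCoeff_shift]
  exact (expBounded_kummerCoeff a hb).hasDerivAt_egf x

/-- Kummer's differential equation, with the derivatives written as power series. -/
theorem kummer_ode (a : 𝕂) {b : ℝ} (hb : 1 ≤ b) (x : 𝕂) :
    x * egf (fun k => kummerCoeff a (b : 𝕂) (k + 2)) x
      + (b - x) * egf (fun k => kummerCoeff a (b : 𝕂) (k + 1)) x - a * kummerM a (b : 𝕂) x = 0 := by
  have hc := expBounded_kummerCoeff a hb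
  have e1 := hc.shift.mul_egf_shift x
  have e2 := hc.mul_egf_shift x
  have s0 := (hc.hasSum x).mul_left a
  have s1 := (hc.shift.hasSum x).mul_left (b : 𝕂)
  have s2 := hc.shift.natCast_mul.hasSum x
  have s3 := hc.natCast_mul.hasSum x
  have s := ((s2.add s1).sub s3).sub s0
  rw [← e1, ← e2] at s
  -- Coefficientwise, Kummer's equation is the recursion (b + k) cₖ₊₁ = (a + k) cₖ.
  have hz : ∀ k : ℕ, ((k : 𝕂) * kummerCoeff a (b : 𝕂) (k + 1)) * (x ^ k / (k.factorial : 𝕂))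
      + (b : 𝕂) * (kummerCoeff a (b : 𝕂) (k + 1) * (x ^ k / (k.factorial : 𝕂)))
      - ((k : 𝕂) * kummerCoeff a (b : 𝕂) k) * (x ^ k / (k.factorial : 𝕂))
      - a * (kummerCoeff a (b : 𝕂) k * (x ^ k / (k.factorial : 𝕂))) = 0 := by
    intro k
    have hk := ofReal_add_natCast_ne_zero (𝕂 := 𝕂) hb k
    have : kummerCoeff a (b : 𝕂) (k + 1) * (b + k) = kummerCoeff a (b : 𝕂) k * (a + k) := by
      rw [kummerCoeff_succ]; field_simp
    linear_combination (x ^ k / (k.factorial : 𝕂)) * this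
  simp only [hz] at s
  have := s.unique hasSum_zero
  rw [kummerM_eq_egf]
  linear_combination this

/-- Kummer's function is jointly continuous in the parameter `a` and the variable. -/
theorem continuous_kummerM {b : ℝ} (hb : 1 ≤ b) :
    Continuous fun p : 𝕂 × 𝕂 => kummerM p.1 (b : 𝕂) p.2 := by
  rw [continuous_iff_continuousAt]
  intro p
  have hs : Metric.ball (0 : 𝕂 × 𝕂) (‖p‖ + 1) ∈ 𝓝 p :=
    Metric.isOpen_ball.mem_nhds (by simp)
  refine ContinuousOn.continuousAt ?_ hs
  unfold kummerM
  refine continuousOn_tsum (fun k => Continuous.continuousOn ?_)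
    (summable_egf_majorant 1 (1 + (‖p‖ + 1)) (‖p‖ + 1)) fun k y hy => ?_
  · have h1 : Continuous fun p : 𝕂 × 𝕂 => (ascPochhammer 𝕂 k).eval p.1 :=
      (ascPochhammer 𝕂 k).continuous.comp continuous_fst
    exact (h1.div_const _).mul ((continuous_snd.pow k).div_const _)
  · have hy' : ‖y‖ ≤ ‖p‖ + 1 := by simpa using (mem_ball_zero_iff.1 hy).le
    exact norm_egf_term_le (c := kummerCoeff y.1 (b : 𝕂)) (by positivity) zero_le_one
      (norm_kummerCoeff_le hb ((norm_fst_le y).trans hy') k) ((norm_snd_le y).trans hy')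

end Kummer

/-! ### The regular radial solution -/

/-- The coefficients `cₖ` of the solution `∑ₖ cₖ rᵏ / k!` of
`r f'' + (n - 1) f' + (κ + E r) f = 0` with `f(0) = 1`. -/
noncomputable def regCoeff (n : ℕ) (κ E : ℝ) : ℕ → ℝ
  | 0 => 1
  | 1 => -κ / ((n : ℝ) - 1)
  | k + 2 => (-κ * regCoeff n κ E (k + 1) - E * (k + 1) * regCoeff n κ E k) / ((n : ℝ) + k)

/-- The regular solution of `f'' + (n - 1) / r f' + (κ / r + E) f = 0` with `f(0) = 1`. -/
noncomputable def regSol (n : ℕ) (κ E : ℝ) : ℝ → ℝ := egf (regCoeff n κ E)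

/-- The derivative of the regular solution. -/
noncomputable def regSol' (n : ℕ) (κ E : ℝ) : ℝ → ℝ := egf fun k => regCoeff n κ E (k + 1)

section RegSol

variable {n : ℕ} (hn : 2 ≤ n) (κ E : ℝ)
include hn

/-- The recursion reaches back two steps, so the induction carries two consecutive bounds. The
denominator n + k absorbs the growing factor k + 1 in front of E. -/
theorem expBounded_regCoeff : ExpBounded (regCoeff n κ E) := by
  have hn' : (2 : ℝ) ≤ n := by exact_mod_cast hn
  set A : ℝ := 1 + |κ| + |E| with hA
  have hA1 : 1 ≤ A := by have := abs_nonneg κ; have := abs_nonneg E; linarith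
  refine ⟨1, A, zero_le_one, by linarith, fun k => ?_⟩
  rw [one_mul, Real.norm_eq_abs]
  suffices h : |regCoeff n κ E k| ≤ A ^ k ∧ |regCoeff n κ E (k + 1)| ≤ A ^ (k + 1) from h.1
  induction k with
  | zero =>
    refine ⟨by simp [regCoeff], ?_⟩
    simp only [regCoeff, zero_add, pow_one]
    rw [abs_div, abs_neg, abs_of_pos (by linarith : (0 : ℝ) < n - 1), div_le_iff₀ (by linarith)]
    have := abs_nonneg κ; have := abs_nonneg E
    nlinarith
  | succ k ih =>
    refine ⟨ih.2, ?_⟩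
    have hk : (0 : ℝ) ≤ k := k.cast_nonneg
    simp only [regCoeff]
    rw [abs_div, abs_of_pos (by linarith : (0 : ℝ) < n + k), div_le_iff₀ (by linarith)]
    have h1 : |(-κ * regCoeff n κ E (k + 1) - E * (k + 1) * regCoeff n κ E k)|
        ≤ |κ| * A ^ (k + 1) + |E| * (k + 1) * A ^ k := by
      refine (abs_sub _ _).trans ?_
      rw [abs_mul, abs_neg, abs_mul, abs_mul, abs_of_nonneg (by linarith : (0 : ℝ) ≤ k + 1)]
      have := ih.1
      have := ih.2
      gcongr
    refine h1.trans ?_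
    have h2 : |κ| * A ^ (k + 1) ≤ |κ| * A ^ (k + 1) * (n + k) := by
      apply le_mul_of_one_le_right (by positivity); linarith
    have h3 : |E| * (k + 1) * A ^ k ≤ |E| * A ^ (k + 1) * (n + k) := by
      have h4 : A ^ k ≤ A ^ (k + 1) := pow_le_pow_right₀ hA1 (by omega)
      calc |E| * (k + 1) * A ^ k = |E| * A ^ k * (k + 1) := by ring
        _ ≤ |E| * A ^ (k + 1) * (n + k) :=
          mul_le_mul (by gcongr) (by linarith) (by linarith) (by positivity)
    have h5 : A ^ (k + 1 + 1) * (n + k) = A ^ (k + 1) * (n + k) + |κ| * A ^ (k + 1) * (n + k)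
        + |E| * A ^ (k + 1) * (n + k) := by rw [hA]; ring
    have h6 : 0 ≤ A ^ (k + 1) * (n + k) := by positivity
    linarith

theorem hasDerivAt_regSol (r : ℝ) : HasDerivAt (regSol n κ E) (regSol' n κ E r) r :=
  (expBounded_regCoeff hn κ E).hasDerivAt_egf r

theorem contDiff_regSol : ContDiff ℝ ∞ (regSol n κ E) := (expBounded_regCoeff hn κ E).contDiff_egf

theorem contDiff_regSol' : ContDiff ℝ ∞ (regSol' n κ E) :=
  (expBounded_regCoeff hn κ E).shift.contDiff_egf

theorem continuous_regSol : Continuous (regSol n κ E) := (contDiff_regSol hn κ E).continuous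

theorem continuous_regSol' : Continuous (regSol' n κ E) := (contDiff_regSol' hn κ E).continuous

omit hn in
theorem regSol_zero : regSol n κ E 0 = 1 := by simp [regSol, egf_zero, regCoeff]

/-- The equation of the regular solution, together with the existence of its second derivative. -/
theorem exists_hasDerivAt_regSol' (r : ℝ) : ∃ d : ℝ, HasDerivAt (regSol' n κ E) d r ∧
    r * d + (n - 1) * regSol' n κ E r + (κ + E * r) * regSol n κ E r = 0 := by
  have hn' : (2 : ℝ) ≤ n := by exact_mod_cast hn
  have hc := expBounded_regCoeff hn κ E
  refine ⟨egf (fun k => regCoeff n κ E (k + 2)) r, hc.shift.hasDerivAt_egf r, ?_⟩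
  have e1 := hc.shift.mul_egf_shift r
  have s1 := (hc.shift.hasSum r).mul_left ((n : ℝ) - 1)
  have s2 := hc.shift.natCast_mul.hasSum r
  have s3 := (hc.hasSum r).mul_left κ
  -- Multiplication by r lowers the coefficient index by one. The truncated value of k - 1 at k = 0
  -- is harmless because of the factor k.
  have hE : HasSum (fun k : ℕ => E * ((k : ℝ) * regCoeff n κ E (k - 1)) * (r ^ k / (k.factorial : ℝ)))
      (E * (r * regSol n κ E r)) := by
    have hb : ExpBounded fun k : ℕ => regCoeff n κ E (k - 1) := by
      obtain ⟨C, A, hC, hA, h⟩ := hc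
      refine ⟨C, 1 + A, hC, by linarith, fun k => (h (k - 1)).trans ?_⟩
      gcongr 
      calc A ^ (k - 1) ≤ (1 + A) ^ (k - 1) := by gcongr; linarith
        _ ≤ (1 + A) ^ k := pow_le_pow_right₀ (by linarith) (by omega)
    have := hb.mul_egf_shift r
    simp only [Nat.add_sub_cancel] at this
    have s := (hb.natCast_mul.hasSum r).mul_left E
    rw [← this] at s
    simpa only [mul_assoc, regSol] using s
  have s := ((s2.add s1).add s3).add hE
  rw [← e1] at s
  have hz : ∀ k : ℕ, ((k : ℝ) * regCoeff n κ E (k + 1)) * (r ^ k / (k.factorial : ℝ))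
      + ((n : ℝ) - 1) * (regCoeff n κ E (k + 1) * (r ^ k / (k.factorial : ℝ)))
      + κ * (regCoeff n κ E k * (r ^ k / (k.factorial : ℝ)))
      + E * ((k : ℝ) * regCoeff n κ E (k - 1)) * (r ^ k / (k.factorial : ℝ)) = 0 := by
    intro k
    suffices h : ((k : ℝ) + n - 1) * regCoeff n κ E (k + 1) + κ * regCoeff n κ E k
        + E * (k * regCoeff n κ E (k - 1)) = 0 by
      linear_combination (r ^ k / (k.factorial : ℝ)) * h
    cases k with
    | zero =>
      have : (n : ℝ) - 1 ≠ 0 := by linarith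
      simp only [regCoeff]; push_cast; field_simp; ring
    | succ k =>
      have : (n : ℝ) + k ≠ 0 := by positivity
      simp only [regCoeff, Nat.add_sub_cancel]; push_cast; field_simp; ring
  simp only [hz] at s
  have := s.unique hasSum_zero
  simp only [regSol, regSol'] at *
  linear_combination this

/-- The equation of the regular solution in divergence form. -/
theorem hasDerivAt_pow_mul_regSol' (r : ℝ) :
    HasDerivAt (fun r => r ^ (n - 1) * regSol' n κ E r)
      (-(κ * r ^ (n - 2) + E * r ^ (n - 1)) * regSol n κ E r) r := by
  obtain ⟨d, hd, h⟩ := exists_hasDerivAt_regSol' hn κ E r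
  have := (hasDerivAt_pow (n - 1) r).mul hd
  refine this.congr_deriv ?_
  obtain ⟨m, rfl⟩ := Nat.exists_eq_add_of_le hn
  have e1 : 2 + m - 1 = m + 1 := by omega
  have e2 : 2 + m - 2 = m := by omega
  rw [e1, e2, Nat.add_sub_cancel]
  push_cast at h ⊢
  linear_combination r ^ m * h

end RegSol

/-! ### Uniqueness of the regular solution -/

/-- The radial equation, as a first order system for `(U, rⁿ⁻¹ U')`, has up to multiples only one
solution that is regular at the origin. -/
theorem radial_system_unique {n : ℕ} (hn : 2 ≤ n) (κ E : ℝ) {R : ℝ} (hR : 0 < R) {U q : ℝ → ℝ}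
    (hU : ∀ r ∈ Set.Ioo 0 R, HasDerivAt U (q r / r ^ (n - 1)) r)
    (hq : ∀ r ∈ Set.Ioo 0 R, HasDerivAt q (-(κ * r ^ (n - 2) + E * r ^ (n - 1)) * U r) r)
    (hq0 : Tendsto q (𝓝[>] 0) (𝓝 0))
    (hU0 : ∀ δ > 0, ∃ᶠ r in 𝓝[>] 0, r ^ (n - 1) * |U r| < δ) :
    ∃ c : ℝ, ∀ r ∈ Set.Ioo 0 R,
      U r = c * regSol n κ E r ∧ q r = c * (r ^ (n - 1) * regSol' n κ E r) := by
  set F := regSol n κ E with hF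
  set F' := regSol' n κ E with hF'
  have hFd := hasDerivAt_regSol hn κ E
  have hFd' := hasDerivAt_pow_mul_regSol' hn κ E
  have hFc := continuous_regSol hn κ E
  have hFc' := continuous_regSol' hn κ E
  -- The weighted Wronskian of the given solution and the regular one is constant.
  have hW : ∃ w, ∀ r ∈ Set.Ioo 0 R, q r * F r - r ^ (n - 1) * F' r * U r = w := by
    have hd : ∀ r ∈ Set.Ioo 0 R,
        HasDerivAt (fun r => q r * F r - r ^ (n - 1) * F' r * U r) 0 r := by
      intro r hr
      have := ((hq r hr).mul (hFd r)).sub ((hFd' r).mul (hU r hr))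
      refine this.congr_deriv ?_
      have h0 : r ^ (n - 1) ≠ 0 := pow_ne_zero _ hr.1.ne'
      field_simp
      ring
    exact isOpen_Ioo.exists_is_const_of_deriv_eq_zero isPreconnected_Ioo
      (fun r hr => (hd r hr).differentiableAt.differentiableWithinAt) fun r hr => (hd r hr).deriv
  obtain ⟨w, hw⟩ := hW
  -- Near 0 the first term of the Wronskian is small because q → 0, and the second is small at
  -- points arbitrarily close to 0 by `hU0`. Smallness along such points suffices for a constant.
  have hw0 : w = 0 := by
    by_contra hne
    have hpos : 0 < |w| := abs_pos.2 hne
    have hF0 : Tendsto F (𝓝[>] 0) (𝓝 (F 0)) := hFc.continuousAt.tendsto.mono_left nhdsWithin_le_nhds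
    have hF'0 : Tendsto F' (𝓝[>] 0) (𝓝 (F' 0)) :=
      hFc'.continuousAt.tendsto.mono_left nhdsWithin_le_nhds
    have h1 : Tendsto (fun r => q r * F r) (𝓝[>] 0) (𝓝 0) := by simpa using hq0.mul hF0
    have h1' : ∀ᶠ r in 𝓝[>] (0 : ℝ), |q r * F r| < |w| / 2 := by
      have := h1.abs
      rw [abs_zero] at this
      exact this.eventually (gt_mem_nhds (by positivity))
    have h2' : ∀ᶠ r in 𝓝[>] (0 : ℝ), |F' r| < |F' 0| + 1 :=
      hF'0.abs.eventually (gt_mem_nhds (by linarith))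
    have h3 : ∀ᶠ r in 𝓝[>] (0 : ℝ), r ∈ Set.Ioo 0 R := Ioo_mem_nhdsGT hR
    have h4 : 0 < |F' 0| + 1 := by positivity
    obtain ⟨r, hr, ⟨hr1, hr2⟩, hr3⟩ :=
      ((hU0 (|w| / 2 / (|F' 0| + 1)) (by positivity)).and_eventually ((h1'.and h2').and h3)).exists
    have hwr := hw r hr3
    have hr0 : 0 < r ^ (n - 1) := pow_pos hr3.1 _
    have h5 : |r ^ (n - 1) * F' r * U r| < |w| / 2 := by
      rw [abs_mul, abs_mul, abs_of_pos hr0]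
      rw [lt_div_iff₀ h4] at hr
      have h6 : r ^ (n - 1) * |F' r| * |U r| ≤ r ^ (n - 1) * |U r| * (|F' 0| + 1) := by
        have := mul_le_mul_of_nonneg_left hr2.le (by positivity : 0 ≤ r ^ (n - 1) * |U r|)
        linarith
      linarith
    have := abs_sub (q r * F r) (r ^ (n - 1) * F' r * U r)
    rw [hwr] at this
    linarith
  subst hw0
  -- A vanishing Wronskian gives proportionality only where the regular solution is nonzero. The
  -- Cauchy data are therefore matched at a point r₀ near 0, where it is positive, and ODE
  -- uniqueness carries the identity across later zeros.
  obtain ⟨r₀, hr₀, hF0⟩ : ∃ r₀ ∈ Set.Ioo 0 R, 0 < F r₀ := by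
    have hF0 : Tendsto F (𝓝[>] 0) (𝓝 (F 0)) := hFc.continuousAt.tendsto.mono_left nhdsWithin_le_nhds
    have h1 : ∀ᶠ r in 𝓝[>] (0 : ℝ), 0 < F r :=
      hF0.eventually (lt_mem_nhds (by rw [hF, regSol_zero]; exact one_pos))
    obtain ⟨r, h, h'⟩ := (h1.and (Ioo_mem_nhdsGT hR)).exists
    exact ⟨r, h', h⟩
  refine ⟨U r₀ / F r₀, fun r hr => ?_⟩
  set c := U r₀ / F r₀ with hc
  have hU₀ : U r₀ = c * F r₀ := by rw [hc]; field_simp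
  have hq₀ : q r₀ = c * (r₀ ^ (n - 1) * F' r₀) := by
    have := hw r₀ hr₀
    rw [hU₀] at this
    have h : F r₀ * (q r₀ - c * (r₀ ^ (n - 1) * F' r₀)) = 0 := by linarith
    have := (mul_eq_zero.1 h).resolve_left hF0.ne'
    linarith
  -- The system is singular at 0, so uniqueness is applied on (a, R) with a below both r and r₀;
  -- there the field is Lipschitz.
  obtain ⟨a, ha0, har, har₀⟩ : ∃ a, 0 < a ∧ a < r ∧ a < r₀ :=
    ⟨min r r₀ / 2, by have := lt_min hr.1 hr₀.1; linarith,
      by have := lt_min hr.1 hr₀.1; have := min_le_left r r₀; linarith,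
      by have := lt_min hr.1 hr₀.1; have := min_le_right r r₀; linarith⟩
  set v : ℝ → ℝ × ℝ → ℝ × ℝ := fun t y =>
    (y.2 / t ^ (n - 1), -(κ * t ^ (n - 2) + E * t ^ (n - 1)) * y.1) with hv
  set K : ℝ := max (1 / a ^ (n - 1)) (|κ| * R ^ (n - 2) + |E| * R ^ (n - 1)) with hK
  have hK0 : 0 ≤ K := le_max_of_le_left (by positivity)
  have hlip : ∀ t ∈ Set.Ioo a R, LipschitzOnWith K.toNNReal (v t) Set.univ := by
    intro t ht
    have ht0 : 0 < t := ha0.trans ht.1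
    refine LipschitzOnWith.of_dist_le_mul fun y _ z _ => ?_
    rw [Real.coe_toNNReal _ hK0, Prod.dist_eq, Prod.dist_eq]
    refine max_le ?_ ?_
    · have h1 : dist (v t y).1 (v t z).1 = 1 / t ^ (n - 1) * dist y.2 z.2 := by
        simp only [hv, Real.dist_eq, ← sub_div, abs_div, abs_of_pos (pow_pos ht0 (n - 1))]
        ring
      rw [h1]
      refine mul_le_mul (le_max_of_le_left ?_) (le_max_right _ _) dist_nonneg hK0
      have := pow_le_pow_left₀ ha0.le ht.1.le (n - 1)
      gcongr
    · have h1 : dist (v t y).2 (v t z).2 = |κ * t ^ (n - 2) + E * t ^ (n - 1)| * dist y.1 z.1 := by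
        simp only [hv, Real.dist_eq, ← mul_sub, abs_mul, abs_neg]
      rw [h1]
      refine mul_le_mul (le_max_of_le_right ?_) (le_max_left _ _) dist_nonneg hK0
      refine (abs_add_le _ _).trans ?_
      rw [abs_mul, abs_mul, abs_of_pos (pow_pos ht0 _), abs_of_pos (pow_pos ht0 _)]
      have := ht.2.le
      gcongr
  have hss : Set.Ioo a R ⊆ Set.Ioo 0 R := Set.Ioo_subset_Ioo_left ha0.le
  have key := ODE_solution_unique_of_mem_Ioo (v := v) (s := fun _ => Set.univ)
    (f := fun t => (U t, q t)) (g := fun t => (c * F t, c * (t ^ (n - 1) * F' t)))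
    hlip (t₀ := r₀) ⟨har₀, hr₀.2⟩
    (fun t ht => ⟨(hU t (hss ht)).prodMk (hq t (hss ht)), trivial⟩)
    (fun t ht => ⟨by
      have ht0 : t ^ (n - 1) ≠ 0 := pow_ne_zero _ (ha0.trans ht.1).ne'
      refine (((hFd t).const_mul c).prodMk ((hFd' t).const_mul c)).congr_deriv ?_
      simp only [hv, Prod.mk.injEq]
      constructor
      · field_simp
        rfl
      · ring, trivial⟩)
    (by simp only [Prod.mk.injEq]; exact ⟨hU₀, hq₀⟩)
  have := key ⟨har, hr.2⟩
  simpa only [Prod.mk.injEq] using this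

/-- A twice differentiable solution of the radial equation on `ℝ` is a multiple of the regular
solution on `[0, ∞)`. -/
theorem eq_regSol_of_hasDerivAt {n : ℕ} (hn : 2 ≤ n) (κ E : ℝ) {y y' y'' : ℝ → ℝ}
    (h1 : ∀ r, HasDerivAt y (y' r) r) (h2 : ∀ r, HasDerivAt y' (y'' r) r)
    (h : ∀ r, r * y'' r + (n - 1) * y' r + (κ + E * r) * y r = 0) {r : ℝ} (hr : 0 ≤ r) :
    y r = y 0 * regSol n κ E r ∧ y' r = y 0 * regSol' n κ E r := by
  have hyc : Continuous y := continuous_iff_continuousAt.2 fun r => (h1 r).continuousAt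
  have hyc' : Continuous y' := continuous_iff_continuousAt.2 fun r => (h2 r).continuousAt
  have hn1 : (n : ℝ) - 1 ≠ 0 := by
    have : (2 : ℝ) ≤ n := by exact_mod_cast hn
    linarith
  -- At r = 0 the equation degenerates to (n-1) y'(0) + κ y(0) = 0, which already determines y'(0).
  rcases hr.eq_or_lt with rfl | hr
  · refine ⟨by rw [regSol_zero, mul_one], ?_⟩
    obtain ⟨d, -, hd⟩ := exists_hasDerivAt_regSol' hn κ E 0
    have h0 := h 0
    rw [regSol_zero] at hd
    have : ((n : ℝ) - 1) * (y' 0 - y 0 * regSol' n κ E 0) = 0 := by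
      linear_combination h0 - y 0 * hd
    have := (mul_eq_zero.1 this).resolve_left hn1
    linarith
  have h0 : (0 : ℝ) ^ (n - 1) = 0 := zero_pow (by omega)
  have hlim : ∀ g : ℝ → ℝ, Continuous g → Tendsto (fun r => r ^ (n - 1) * g r) (𝓝[>] 0) (𝓝 0) := by
    intro g hg
    have : Tendsto (fun r => r ^ (n - 1) * g r) (𝓝 0) (𝓝 (0 ^ (n - 1) * g 0)) :=
      ((continuous_pow (n - 1)).mul hg).tendsto 0
    rw [h0, zero_mul] at this
    exact this.mono_left nhdsWithin_le_nhds
  obtain ⟨c, hc⟩ := radial_system_unique hn κ E (R := r + 1) (by linarith) (U := y)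
    (q := fun r => r ^ (n - 1) * y' r)
    (fun r hr => (h1 r).congr_deriv (by
      have : r ^ (n - 1) ≠ 0 := pow_ne_zero _ hr.1.ne'
      field_simp))
    (fun r _ => by
      refine ((hasDerivAt_pow (n - 1) r).mul (h2 r)).congr_deriv ?_
      have := h r
      obtain ⟨m, rfl⟩ := Nat.exists_eq_add_of_le hn
      have e1 : 2 + m - 1 = m + 1 := by omega
      have e2 : 2 + m - 2 = m := by omega
      rw [e1, e2, Nat.add_sub_cancel]
      push_cast at this ⊢
      linear_combination r ^ m * this)
    (hlim y' hyc')
    (fun δ hδ => ((hlim (fun r => |y r|) hyc.abs).eventually (gt_mem_nhds hδ)).frequently)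
  have hc0 : c = y 0 := by
    have t1 : Tendsto y (𝓝[>] 0) (𝓝 (y 0)) := hyc.continuousAt.tendsto.mono_left nhdsWithin_le_nhds
    have t2 : Tendsto (fun r => c * regSol n κ E r) (𝓝[>] 0) (𝓝 (c * regSol n κ E 0)) :=
      ((continuous_regSol hn κ E).const_mul c |>.tendsto 0).mono_left nhdsWithin_le_nhds
    have t3 : y =ᶠ[𝓝[>] 0] fun r => c * regSol n κ E r := by
      filter_upwards [Ioo_mem_nhdsGT (by linarith : (0 : ℝ) < r + 1)] with s hs
      exact (hc s hs).1
    have := tendsto_nhds_unique (t1.congr' t3) t2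
    rw [regSol_zero, mul_one] at this
    exact this.symm
  have := hc r ⟨hr, by linarith⟩
  refine ⟨by rw [this.1, hc0], ?_⟩
  have hp : r ^ (n - 1) ≠ 0 := pow_ne_zero _ hr.ne'
  have h3 : r ^ (n - 1) * (y' r - c * regSol' n κ E r) = 0 := by linear_combination this.2
  have := (mul_eq_zero.1 h3).resolve_left hp
  rw [← hc0]
  linarith

/-! ### The regular solution in terms of Kummer's function -/

section KummerRadial

variable {𝕂 : Type*} [RCLike 𝕂]

theorem b₀_eq (n : ℕ) : b₀ 𝕂 n = (((n : ℝ) - 1 : ℝ) : 𝕂) := by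
  unfold b₀; push_cast; ring

/-- The Kummer expression for the regular solution and its derivative; `ex` is the exponential
function of `𝕂`. -/
theorem kummerM_mul_exp_eq_regSol {n : ℕ} (hn : 2 ≤ n) (κ E : ℝ) {ex : 𝕂 → 𝕂}
    (hex : ∀ x, HasDerivAt ex (ex x) x) (hex0 : ex 0 = 1) {z σ : 𝕂} (hz : 2 * σ * z = κ)
    (hE : σ ^ 2 = -(E : 𝕂)) {r : ℝ} (hr : 0 ≤ r) :
    kummerM (a₀ n z) (b₀ 𝕂 n) (2 * σ * (r : 𝕂)) * ex (-(σ * (r : 𝕂))) = (regSol n κ E r : 𝕂) ∧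
    (2 * σ * (a₀ n z / b₀ 𝕂 n * kummerM (a₀ n z + 1) (b₀ 𝕂 n + 1) (2 * σ * (r : 𝕂)))
      - σ * kummerM (a₀ n z) (b₀ 𝕂 n) (2 * σ * (r : 𝕂))) * ex (-(σ * (r : 𝕂)))
        = (regSol' n κ E r : 𝕂) := by
  have hn' : (2 : ℝ) ≤ n := by exact_mod_cast hn
  have hb : (1 : ℝ) ≤ (n : ℝ) - 1 := by linarith
  rw [b₀_eq]
  set b : ℝ := (n : ℝ) - 1 with hbdef
  set a : 𝕂 := a₀ n z with ha
  have hc := expBounded_kummerCoeff a hb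
  set g0 : 𝕂 → 𝕂 := kummerM a (b : 𝕂) with hg0
  set g1 : 𝕂 → 𝕂 := egf (fun k => kummerCoeff a (b : 𝕂) (k + 1)) with hg1
  set g2 : 𝕂 → 𝕂 := egf (fun k => kummerCoeff a (b : 𝕂) (k + 2)) with hg2
  have d0 : ∀ x, HasDerivAt g0 (g1 x) x := fun x => hc.hasDerivAt_egf x
  have d1 : ∀ x, HasDerivAt g1 (g2 x) x := fun x => hc.shift.hasDerivAt_egf x
  have ode : ∀ x, x * g2 x + (b - x) * g1 x - a * g0 x = 0 := kummer_ode a hb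
  rw [← egf_kummerCoeff_shift]
  have dlin : ∀ (τ : 𝕂) (r : ℝ), HasDerivAt (fun r : ℝ => τ * (r : 𝕂)) τ r := by
    intro τ r
    have := (RCLike.ofRealCLM (K := 𝕂)).hasDerivAt (x := r)
    simpa using this.const_mul τ
  have D : ∀ (g g' : 𝕂 → 𝕂), (∀ x, HasDerivAt g (g' x) x) → ∀ (τ : 𝕂) (r : ℝ),
      HasDerivAt (fun r : ℝ => g (τ * (r : 𝕂))) (τ * g' (τ * (r : 𝕂))) r := by
    intro g g' hg τ r
    exact (hg (τ * (r : 𝕂))).scomp r (dlin τ r)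
  have Dex : ∀ r : ℝ, HasDerivAt (fun r : ℝ => ex (-(σ * (r : 𝕂)))) (-σ * ex (-(σ * (r : 𝕂)))) r := by
    intro r
    have := D ex ex hex (-σ) r
    simpa only [neg_mul] using this
  set X : ℝ → 𝕂 := fun r => ex (-(σ * (r : 𝕂))) with hX
  set y : ℝ → 𝕂 := fun r => g0 (2 * σ * (r : 𝕂)) * X r with hy
  set y' : ℝ → 𝕂 := fun r => (2 * σ * g1 (2 * σ * (r : 𝕂)) - σ * g0 (2 * σ * (r : 𝕂))) * X r with hy'
  set y'' : ℝ → 𝕂 := fun r => (2 * σ * (2 * σ * g2 (2 * σ * (r : 𝕂)))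
    - 2 * σ * (2 * σ * g1 (2 * σ * (r : 𝕂))) + σ * σ * g0 (2 * σ * (r : 𝕂))) * X r with hy''
  have Dy : ∀ r, HasDerivAt y (y' r) r := by
    intro r
    refine ((D g0 g1 d0 (2 * σ) r).mul (Dex r)).congr_deriv ?_
    simp only [hy']
    ring
  have Dy' : ∀ r, HasDerivAt y' (y'' r) r := by
    intro r
    refine (((((D g1 g2 d1 (2 * σ) r).const_mul (2 * σ)).sub
      ((D g0 g1 d0 (2 * σ) r).const_mul σ))).mul (Dex r)).congr_deriv ?_
    simp only [hy'', Pi.sub_apply]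
    ring
  -- With a = b/2 - z, κ = 2σz and σ² = -E, the radial equation is 2σ e^{-σr} times Kummer's
  -- equation at 2σr.
  have ODE : ∀ r : ℝ, (r : 𝕂) * y'' r + (b : 𝕂) * y' r + ((κ : 𝕂) + (E : 𝕂) * (r : 𝕂)) * y r = 0 := by
    intro r
    have h := ode (2 * σ * (r : 𝕂))
    have ha' : a = (b : 𝕂) / 2 - z := by
      rw [ha, hbdef, a₀]; push_cast; ring
    rw [ha'] at h
    simp only [hy'', hy', hy]
    rw [← hz]
    linear_combination (2 * σ * X r) * h + (r : 𝕂) * g0 (2 * σ * (r : 𝕂)) * X r * hE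
  have y0 : y 0 = 1 := by
    simp [hy, hX, hg0, kummerM_zero, hex0]
  have Dre : ∀ {w : ℝ → 𝕂} {w' : 𝕂} {r : ℝ}, HasDerivAt w w' r →
      HasDerivAt (fun r => RCLike.re (w r)) (RCLike.re w') r := by
    intro w w' r h
    exact (RCLike.reCLM (K := 𝕂)).hasFDerivAt.comp_hasDerivAt r h
  have Dim : ∀ {w : ℝ → 𝕂} {w' : 𝕂} {r : ℝ}, HasDerivAt w w' r →
      HasDerivAt (fun r => RCLike.im (w r)) (RCLike.im w') r := by
    intro w w' r h
    exact (RCLike.imCLM (K := 𝕂)).hasFDerivAt.comp_hasDerivAt r h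
  have ODE' : ∀ r e : ℝ, e = κ + E * r →
      (r : 𝕂) * y'' r + (b : 𝕂) * y' r + (e : 𝕂) * y r = 0 := by
    rintro r e rfl
    have := ODE r
    push_cast
    exact this
  -- Since κ, E and r are real, the real and imaginary parts solve the equation separately. The
  -- imaginary part starts at 0 and so vanishes, which is why the complex expression is real-valued.
  have hre := eq_regSol_of_hasDerivAt hn κ E (fun r => Dre (Dy r)) (fun r => Dre (Dy' r))
    (fun r => by
      have := congrArg RCLike.re (ODE' r _ rfl)
      rw [map_add, map_add, RCLike.re_ofReal_mul, RCLike.re_ofReal_mul, RCLike.re_ofReal_mul,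
        map_zero] at this
      exact this) hr
  have him := eq_regSol_of_hasDerivAt hn κ E (fun r => Dim (Dy r)) (fun r => Dim (Dy' r))
    (fun r => by
      have := congrArg RCLike.im (ODE' r _ rfl)
      rw [map_add, map_add, RCLike.im_ofReal_mul, RCLike.im_ofReal_mul, RCLike.im_ofReal_mul,
        map_zero] at this
      exact this) hr
  simp only [y0, RCLike.one_re, one_mul, RCLike.one_im, zero_mul] at hre him
  constructor
  · apply RCLike.ext
    · rw [RCLike.ofReal_re]; exact hre.1
    · rw [RCLike.ofReal_im]; exact him.1
  · apply RCLike.ext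
    · rw [RCLike.ofReal_re]; exact hre.2
    · rw [RCLike.ofReal_im]; exact him.2

/-- The boundary condition `(∂ᵣ + γ) f = 0` at `r = R` for the regular solution `f`. -/
def BdryCond (n : ℕ) (κ : ℝ) (γ : WithTop ℝ) (R E : ℝ) : Prop :=
  match γ with
  | ⊤ => regSol n κ E R = 0
  | (c : ℝ) => regSol' n κ E R + c * regSol n κ E R = 0

/-- For finite γ, the boundary expression at R is σ e^{-σR} times the difference of the two sides of
the transcendental equation, because 2γz/κ = γ/σ. For γ = ∞ the factor is e^{-σR}. Neither factor
vanishes. -/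
theorem transEq_iff_bdryCond {n : ℕ} (hn : 2 ≤ n) {κ : ℝ} (hκ : κ ≠ 0) (γ : WithTop ℝ) (E : ℝ)
    {ex : 𝕂 → 𝕂} (hex : ∀ x, HasDerivAt ex (ex x) x) (hex0 : ex 0 = 1) (hne : ∀ x, ex x ≠ 0)
    {z σ : 𝕂} (hz : 2 * σ * z = κ) (hE : σ ^ 2 = -(E : 𝕂)) {R : ℝ} (hR : 0 ≤ R) :
    TransEq n κ γ R z ↔ BdryCond n κ γ R E := by
  obtain ⟨h1, h2⟩ := kummerM_mul_exp_eq_regSol hn κ E hex hex0 hz hE hR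
  have hκ' : (κ : 𝕂) ≠ 0 := by exact_mod_cast hκ
  have hz0 : z ≠ 0 := by rintro rfl; simp at hz; exact hκ' hz.symm
  have hσ0 : σ ≠ 0 := by rintro rfl; simp at hz; exact hκ' hz.symm
  have hρ : (κ : 𝕂) * (R : 𝕂) / z = 2 * σ * (R : 𝕂) := by
    rw [← hz]; field_simp
  have hX := hne (-(σ * (R : 𝕂)))
  induction γ using WithTop.recTopCoe with
  | top =>
    simp only [TransEq, BdryCond]
    rw [hρ, ← RCLike.ofReal_eq_zero (K := 𝕂), ← h1, mul_eq_zero, or_iff_left hX]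
  | coe c =>
    simp only [TransEq, BdryCond]
    rw [hρ, ← RCLike.ofReal_eq_zero (K := 𝕂), RCLike.ofReal_add, RCLike.ofReal_mul, ← h1, ← h2,
      ← sub_eq_zero, ← hz]
    generalize kummerM (a₀ n z) (b₀ 𝕂 n) (2 * σ * (R : 𝕂)) = M0
    generalize kummerM (a₀ n z + 1) (b₀ 𝕂 n + 1) (2 * σ * (R : 𝕂)) = M1
    generalize a₀ n z / b₀ 𝕂 n = t
    generalize ex (-(σ * (R : 𝕂))) = X at hX
    have : (2 * σ * (t * M1) - σ * M0) * X + (c : 𝕂) * (M0 * X)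
        = σ * X * (2 * t * M1 - (1 - 2 * (c : 𝕂) * z / (2 * σ * z)) * M0) := by
      field_simp
      ring
    rw [this, mul_eq_zero, or_iff_right (mul_ne_zero hσ0 hX)]

end KummerRadial

/-! ### Polar coordinates -/

/-- The surface measure on the unit sphere of `ℝⁿ`. -/
noncomputable abbrev sphMeas (n : ℕ) : Measure (Metric.sphere (0 : Eucl n) 1) :=
  (volume : Measure (Eucl n)).toSphere

/-- The measure `rⁿ⁻¹ dr` on `(0, R)`. -/
noncomputable def radMeas (n : ℕ) (R : ℝ) : Measure ℝ :=
  (volume.restrict (Set.Ioo 0 R)).withDensity fun r => ENNReal.ofReal (r ^ (n - 1))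

instance (n : ℕ) (R : ℝ) : SFinite (radMeas n R) := by unfold radMeas; infer_instance

theorem norm_smul_sphere {n : ℕ} {r : ℝ} (hr : 0 ≤ r) (θ : Metric.sphere (0 : Eucl n) 1) :
    ‖r • (θ : Eucl n)‖ = r := by
  rw [norm_smul, norm_eq_of_mem_sphere, mul_one, Real.norm_of_nonneg hr]

/-- The origin is a null set, and its complement is homeomorphic to sphere × (0, ∞) compatibly with
the measures. The remaining work moves the radial measure from the subtype (0, ∞) to ℝ. -/
theorem polar_measurePreserving_Ioi {n : ℕ} (hn : 2 ≤ n) :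
    MeasurePreserving (fun p : Metric.sphere (0 : Eucl n) 1 × ℝ => p.2 • (p.1 : Eucl n))
      ((sphMeas n).prod ((volume.restrict (Set.Ioi 0)).withDensity
        fun r => ENNReal.ofReal (r ^ (n - 1)))) volume := by
  have : Nontrivial (Eucl n) := by
    have : Nonempty (Fin n) := ⟨⟨0, by omega⟩⟩
    infer_instance
  set e := homeomorphUnitSphereProd (Eucl n)
  have h1 := (volume : Measure (Eucl n)).measurePreserving_homeomorphUnitSphereProd
  have hmeas : Measurable (fun p : Metric.sphere (0 : Eucl n) 1 × ℝ => p.2 • (p.1 : Eucl n)) := by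
    fun_prop
  rw [finrank_euclideanSpace_fin] at h1
  have h2 : MeasurePreserving (Subtype.val : ({0}ᶜ : Set (Eucl n)) → Eucl n)
      ((volume : Measure (Eucl n)).comap (↑)) volume := by
    refine ⟨measurable_subtype_coe, ?_⟩
    rw [map_comap_subtype_coe (measurableSet_singleton _).compl, restrict_compl_singleton]
  have h3 := h2.comp (h1.symm e.toMeasurableEquiv)
  have h4 : Measure.map (Subtype.val : Set.Ioi (0 : ℝ) → ℝ) (Measure.volumeIoiPow (n - 1)) =
      (volume.restrict (Set.Ioi 0)).withDensity fun r => ENNReal.ofReal (r ^ (n - 1)) := by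
    unfold Measure.volumeIoiPow
    have hm : Measurable fun r : ℝ => ENNReal.ofReal (r ^ (n - 1)) := by fun_prop
    have he : MeasurableEmbedding (Subtype.val : Set.Ioi (0 : ℝ) → ℝ) :=
      MeasurableEmbedding.subtype_coe measurableSet_Ioi
    ext s hs
    rw [Measure.map_apply measurable_subtype_coe hs, withDensity_apply _ (he.measurable hs),
      withDensity_apply _ hs, ← map_comap_subtype_coe measurableSet_Ioi (volume : Measure ℝ),
      he.restrict_map, he.lintegral_map]
  refine ⟨hmeas, ?_⟩
  rw [← h4]
  have h5 : (sphMeas n).prod (Measure.map (Subtype.val : Set.Ioi (0 : ℝ) → ℝ)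
      (Measure.volumeIoiPow (n - 1))) =
      Measure.map (Prod.map id (Subtype.val : Set.Ioi (0 : ℝ) → ℝ))
        ((sphMeas n).prod (Measure.volumeIoiPow (n - 1))) := by
    have : SFinite (Measure.map (Subtype.val : Set.Ioi (0 : ℝ) → ℝ)
      (Measure.volumeIoiPow (n - 1))) := by rw [h4]; infer_instance
    rw [← Measure.map_prod_map _ _ measurable_id measurable_subtype_coe, Measure.map_id]
  rw [h5, Measure.map_map hmeas (by fun_prop)]
  have h6 : (fun p : Metric.sphere (0 : Eucl n) 1 × ℝ => p.2 • (p.1 : Eucl n)) ∘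
      Prod.map id (Subtype.val : Set.Ioi (0 : ℝ) → ℝ) = Subtype.val ∘ e.toMeasurableEquiv.symm := by
    funext p
    exact (homeomorphUnitSphereProd_symm_apply_coe (Eucl n) p).symm
  rw [h6]
  exact h3.map_eq

theorem polar_measurePreserving {n : ℕ} (hn : 2 ≤ n) (R : ℝ) :
    MeasurePreserving (fun p : Metric.sphere (0 : Eucl n) 1 × ℝ => p.2 • (p.1 : Eucl n))
      ((sphMeas n).prod (radMeas n R)) (volume.restrict (B n R)) := by
  have h := (polar_measurePreserving_Ioi hn).restrict_preimage
    (Metric.isOpen_ball (x := (0 : Eucl n)) (ε := R)).measurableSet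
  convert h using 1
  have : (fun p : Metric.sphere (0 : Eucl n) 1 × ℝ => p.2 • (p.1 : Eucl n)) ⁻¹' Metric.ball 0 R
      = Set.univ ×ˢ Set.Ioo (-R) R := by
    ext p
    simp [norm_smul, abs_lt]
  rw [this, ← Measure.prod_restrict, Measure.restrict_univ,
    restrict_withDensity measurableSet_Ioo, Measure.restrict_restrict measurableSet_Ioo, radMeas]
  congr 3
  ext r
  simp only [Set.mem_Ioo, Set.mem_inter_iff, Set.mem_Ioi]
  constructor
  · rintro ⟨h1, h2⟩; exact ⟨⟨by linarith, h2⟩, h1⟩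
  · rintro ⟨⟨-, h2⟩, h1⟩; exact ⟨h1, h2⟩

theorem integral_radMeas (n : ℕ) (R : ℝ) (f : ℝ → ℝ) :
    ∫ r, f r ∂(radMeas n R) = ∫ r in Set.Ioo 0 R, r ^ (n - 1) * f r := by
  unfold radMeas
  simp only [ENNReal.ofReal]
  rw [integral_withDensity_eq_integral_smul (by fun_prop)]
  refine setIntegral_congr_fun measurableSet_Ioo fun r hr => ?_
  simp only [NNReal.smul_def, smul_eq_mul]
  rw [Real.coe_toNNReal _ (pow_nonneg hr.1.le _)]

theorem integrable_radMeas_iff (n : ℕ) (R : ℝ) (f : ℝ → ℝ) :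
    Integrable f (radMeas n R) ↔ IntegrableOn (fun r => r ^ (n - 1) * f r) (Set.Ioo 0 R) := by
  unfold radMeas
  simp only [ENNReal.ofReal]
  rw [integrable_withDensity_iff_integrable_smul (by fun_prop)]
  refine integrable_congr ?_
  filter_upwards [ae_restrict_mem measurableSet_Ioo] with r hr
  simp only [NNReal.smul_def, smul_eq_mul]
  rw [Real.coe_toNNReal _ (pow_nonneg hr.1.le _)]

theorem ae_radMeas_iff {n : ℕ} {R : ℝ} {p : ℝ → Prop} :
    (∀ᵐ r ∂(radMeas n R), p r) ↔ ∀ᵐ r ∂(volume.restrict (Set.Ioo 0 R)), p r := by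
  unfold radMeas
  rw [ae_withDensity_iff (by fun_prop)]
  constructor <;> intro h <;> filter_upwards [h, ae_restrict_mem measurableSet_Ioo] with r hr hr'
  · refine hr ?_
    rw [ne_eq, ENNReal.ofReal_eq_zero, not_le]
    exact pow_pos hr'.1 _
  · exact fun _ => hr

section BallPolar

variable {n : ℕ} (hn : 2 ≤ n) {R : ℝ} {f : Eucl n → ℝ} (hf : Integrable f (volume.restrict (B n R)))
include hn hf

theorem integrable_polar :
    Integrable (fun p : Metric.sphere (0 : Eucl n) 1 × ℝ => f (p.2 • (p.1 : Eucl n)))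
      ((sphMeas n).prod (radMeas n R)) :=
  (polar_measurePreserving hn R).integrable_comp_of_integrable hf

theorem integral_ball_eq_sphere :
    ∫ x in B n R, f x = ∫ θ, (∫ r in Set.Ioo 0 R, r ^ (n - 1) * f (r • (θ : Eucl n))) ∂(sphMeas n) := by
  have hmp := polar_measurePreserving hn R
  have hf' : AEStronglyMeasurable f (Measure.map
      (fun p : Metric.sphere (0 : Eucl n) 1 × ℝ => p.2 • (p.1 : Eucl n))
      ((sphMeas n).prod (radMeas n R))) := by rw [hmp.map_eq]; exact hf.1
  rw [← hmp.map_eq, integral_map hmp.measurable.aemeasurable hf',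
    integral_prod _ (integrable_polar hn hf)]
  simp only [integral_radMeas]

theorem integral_ball_eq_radial :
    ∫ x in B n R, f x = ∫ r in Set.Ioo 0 R, r ^ (n - 1) * ∫ θ, f (r • (θ : Eucl n)) ∂(sphMeas n) := by
  have hmp := polar_measurePreserving hn R
  have hf' : AEStronglyMeasurable f (Measure.map
      (fun p : Metric.sphere (0 : Eucl n) 1 × ℝ => p.2 • (p.1 : Eucl n))
      ((sphMeas n).prod (radMeas n R))) := by rw [hmp.map_eq]; exact hf.1
  rw [← hmp.map_eq, integral_map hmp.measurable.aemeasurable hf',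
    integral_prod_symm _ (integrable_polar hn hf), integral_radMeas]

theorem integrable_sphere_average :
    IntegrableOn (fun r => r ^ (n - 1) * ∫ θ, f (r • (θ : Eucl n)) ∂(sphMeas n)) (Set.Ioo 0 R) :=
  (integrable_radMeas_iff n R _).1 (integrable_polar hn hf).integral_prod_right

end BallPolar

/-! ### The surface measure -/

theorem measurable_smul_sphere (n : ℕ) (R : ℝ) :
    Measurable fun y : Metric.sphere (0 : Eucl n) 1 => R • (y : Eucl n) := by fun_prop

instance (n : ℕ) (R : ℝ) : IsFiniteMeasure (surf n R) := by
  unfold surf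
  have : IsFiniteMeasure (Measure.map (fun y : Metric.sphere (0 : Eucl n) 1 => R • (y : Eucl n))
    (volume : Measure (Eucl n)).toSphere) := inferInstance
  exact Measure.smul_finite _ ENNReal.ofReal_ne_top

theorem integral_surf {n : ℕ} {R : ℝ} (hR : 0 ≤ R) {g : Eucl n → ℝ} (hg : Continuous g) :
    ∫ x, g x ∂(surf n R) = R ^ (n - 1) * ∫ θ, g (R • (θ : Eucl n)) ∂(sphMeas n) := by
  unfold surf
  rw [integral_smul_measure, integral_map (measurable_smul_sphere n R).aemeasurable
    hg.aestronglyMeasurable, ENNReal.toReal_ofReal (pow_nonneg hR _), smul_eq_mul]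

theorem ae_surf_norm_eq {n : ℕ} {R : ℝ} (hR : 0 ≤ R) : ∀ᵐ x ∂(surf n R), ‖x‖ = R := by
  unfold surf
  refine Measure.ae_smul_measure ?_ _
  rw [ae_map_iff (measurable_smul_sphere n R).aemeasurable
    (measurableSet_eq_fun continuous_norm.measurable measurable_const)]
  exact Eventually.of_forall fun y => norm_smul_sphere hR y

theorem sphMeas_real_univ_pos {n : ℕ} (hn : 2 ≤ n) : 0 < (sphMeas n).real Set.univ := by
  have : Nonempty (Fin n) := ⟨⟨0, by omega⟩⟩
  have h : sphMeas n ≠ 0 := Measure.toSphere_ne_zero _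
  rw [measureReal_def, ENNReal.toReal_pos_iff]
  exact ⟨Measure.measure_univ_pos.2 h, measure_lt_top _ _⟩

theorem surf_real_univ {n : ℕ} {R : ℝ} (hR : 0 ≤ R) :
    (surf n R).real Set.univ = R ^ (n - 1) * (sphMeas n).real Set.univ := by
  have := integral_surf (n := n) hR (g := fun _ => (1 : ℝ)) continuous_const
  simpa using this

theorem surf_real_univ_pos {n : ℕ} (hn : 2 ≤ n) {R : ℝ} (hR : 0 < R) :
    0 < (surf n R).real Set.univ := by
  rw [surf_real_univ hR.le]
  exact mul_pos (pow_pos hR _) (sphMeas_real_univ_pos hn)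

/-! ### Continuous functions on balls -/

theorem memLp_ball_of_continuous {n : ℕ} {F : Type*} [NormedAddCommGroup F]
    [SecondCountableTopologyEither (Eucl n) F] {f : Eucl n → F} (hf : Continuous f) (R : ℝ) (p : ENNReal) :
    MemLp f p (volume.restrict (B n R)) := by
  obtain ⟨C, hC⟩ := (isCompact_closedBall (0 : Eucl n) R).exists_bound_of_continuousOn hf.continuousOn
  have : IsFiniteMeasure (volume.restrict (B n R)) := ⟨by
    rw [Measure.restrict_apply_univ]; exact measure_ball_lt_top⟩
  refine MemLp.of_bound hf.aestronglyMeasurable C ?_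
  filter_upwards [ae_restrict_mem measurableSet_ball] with x hx
  exact hC x (Metric.ball_subset_closedBall hx)

theorem memLp_surf_of_continuous {n : ℕ} {f : Eucl n → ℝ} (hf : Continuous f) {R : ℝ} (hR : 0 ≤ R)
    (p : ENNReal) : MemLp f p (surf n R) := by
  obtain ⟨C, hC⟩ := (isCompact_closedBall (0 : Eucl n) R).exists_bound_of_continuousOn hf.continuousOn
  refine MemLp.of_bound hf.aestronglyMeasurable C ?_
  filter_upwards [ae_surf_norm_eq hR] with x hx
  exact hC x (by simp [hx])

/-! ### Convergence of `L²` inner products -/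

theorem tendsto_integral_inner_of_eLpNorm {α F : Type*} [MeasurableSpace α] {μ : Measure α}
    [NormedAddCommGroup F] [InnerProductSpace ℝ F] {f g : α → F} {fk gk : ℕ → α → F}
    (hf : MemLp f 2 μ) (hg : MemLp g 2 μ) (hfk : ∀ k, MemLp (fk k) 2 μ) (hgk : ∀ k, MemLp (gk k) 2 μ)
    (h1 : Tendsto (fun k => eLpNorm (fun x => fk k x - f x) 2 μ) atTop (𝓝 0))
    (h2 : Tendsto (fun k => eLpNorm (fun x => gk k x - g x) 2 μ) atTop (𝓝 0)) :
    Tendsto (fun k => ∫ x, inner ℝ (fk k x) (gk k x) ∂μ) atTop (𝓝 (∫ x, inner ℝ (f x) (g x) ∂μ)) := by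
  have key : ∀ {a b : α → F} (ha : MemLp a 2 μ) (hb : MemLp b 2 μ),
      inner ℝ (ha.toLp a) (hb.toLp b) = ∫ x, inner ℝ (a x) (b x) ∂μ := by
    intro a b ha hb
    rw [L2.inner_def]
    refine integral_congr_ae ?_
    filter_upwards [ha.coeFn_toLp, hb.coeFn_toLp] with x hx hy
    rw [hx, hy]
  have t1 : Tendsto (fun k => (hfk k).toLp (fk k)) atTop (𝓝 (hf.toLp f)) :=
    (Lp.tendsto_Lp_iff_tendsto_eLpNorm'' _ hfk _ hf).2 h1
  have t2 : Tendsto (fun k => (hgk k).toLp (gk k)) atTop (𝓝 (hg.toLp g)) :=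
    (Lp.tendsto_Lp_iff_tendsto_eLpNorm'' _ hgk _ hg).2 h2
  simpa only [key] using Filter.Tendsto.inner (𝕜 := ℝ) t1 t2

theorem tendsto_integral_mul_of_eLpNorm {α : Type*} [MeasurableSpace α] {μ : Measure α}
    {f g : α → ℝ} {fk gk : ℕ → α → ℝ}
    (hf : MemLp f 2 μ) (hg : MemLp g 2 μ) (hfk : ∀ k, MemLp (fk k) 2 μ) (hgk : ∀ k, MemLp (gk k) 2 μ)
    (h1 : Tendsto (fun k => eLpNorm (fun x => fk k x - f x) 2 μ) atTop (𝓝 0))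
    (h2 : Tendsto (fun k => eLpNorm (fun x => gk k x - g x) 2 μ) atTop (𝓝 0)) :
    Tendsto (fun k => ∫ x, fk k x * gk k x ∂μ) atTop (𝓝 (∫ x, f x * g x ∂μ)) := by
  have := tendsto_integral_inner_of_eLpNorm hg hf hgk hfk h2 h1
  simpa [mul_comm] using this

theorem MeasureTheory.MemLp.integrable_mul_of_two {α : Type*} [MeasurableSpace α] {μ : Measure α}
    {f g : α → ℝ} (hf : MemLp f 2 μ) (hg : MemLp g 2 μ) : Integrable (fun x => f x * g x) μ :=
  hf.integrable_mul hg

/-! ### Smooth functions -/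

section Smooth

variable {n : ℕ}

theorem continuous_gradient {f : Eucl n → ℝ} (hf : ContDiff ℝ ∞ f) : Continuous (gradient f) :=
  (InnerProductSpace.toDual ℝ (Eucl n)).symm.continuous.comp (hf.continuous_fderiv (by simp))

/-- Paired with a fixed vector, this is integration by parts for a directional derivative. Compact
support of ψ alone provides the integrability. -/
theorem integral_smul_gradient_eq {f ψ : Eucl n → ℝ} (hf : ContDiff ℝ ∞ f) (hψ : ContDiff ℝ ∞ ψ)
    (hs : HasCompactSupport ψ) :
    ∫ x, f x • gradient ψ x = - ∫ x, ψ x • gradient f x := by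
  have hsg : HasCompactSupport (gradient ψ) := by
    refine (hs.fderiv (𝕜 := ℝ)).mono ?_
    intro x hx
    simp only [Function.mem_support, gradient] at hx ⊢
    simpa using hx
  have i1 : Integrable fun x => f x • gradient ψ x :=
    (hf.continuous.smul (continuous_gradient hψ)).integrable_of_hasCompactSupport hsg.smul_left
  have i2 : Integrable fun x => ψ x • gradient f x :=
    (hψ.continuous.smul (continuous_gradient hf)).integrable_of_hasCompactSupport hs.smul_right
  refine ext_inner_right ℝ fun v => ?_
  rw [inner_neg_left, real_inner_comm, ← integral_inner i1, real_inner_comm, ← integral_inner i2]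
  simp only [inner_smul_right, inner_gradient_right, conj_trivial]
  have hf1 : Continuous fun x => fderiv ℝ f x v :=
    (hf.continuous_fderiv (by simp)).clm_apply continuous_const
  have hψ1 : Continuous fun x => fderiv ℝ ψ x v :=
    (hψ.continuous_fderiv (by simp)).clm_apply continuous_const
  have hsv : HasCompactSupport fun x => fderiv ℝ ψ x v := hs.fderiv_apply (𝕜 := ℝ) v
  have := integral_mul_fderiv_eq_neg_fderiv_mul_of_integrable (μ := (volume : Measure (Eucl n)))
    (f := f) (g := ψ) (v := v)
    ((hf1.mul hψ.continuous).integrable_of_hasCompactSupport hs.mul_left)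
    ((hf.continuous.mul hψ1).integrable_of_hasCompactSupport hsv.mul_left)
    ((hf.continuous.mul hψ.continuous).integrable_of_hasCompactSupport hs.mul_left)
    (fun x _ => hf.differentiable (by simp) x) (fun x _ => hψ.differentiable (by simp) x)
  rw [this]
  congr 2
  funext x
  ring

theorem gradient_eq_zero_of_notMem_tsupport {ψ : Eucl n → ℝ} {x : Eucl n} (hx : x ∉ tsupport ψ) :
    gradient ψ x = 0 := by
  have : fderiv ℝ ψ x = 0 := by
    by_contra h
    exact hx (tsupport_fderiv_subset ℝ (subset_tsupport _ h))
  simp [gradient, this]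

theorem setIntegral_smul_gradient {Ω : Set (Eucl n)} {u ψ : Eucl n → ℝ} (hψ : tsupport ψ ⊆ Ω) :
    ∫ x in Ω, u x • gradient ψ x = ∫ x, u x • gradient ψ x := by
  refine setIntegral_eq_integral_of_forall_compl_eq_zero fun x hx => ?_
  rw [gradient_eq_zero_of_notMem_tsupport fun h => hx (hψ h), smul_zero]

theorem setIntegral_smul_of_tsupport {F : Type*} [NormedAddCommGroup F] [NormedSpace ℝ F]
    {Ω : Set (Eucl n)} {ψ : Eucl n → ℝ} {G : Eucl n → F}
    (hψ : tsupport ψ ⊆ Ω) : ∫ x in Ω, ψ x • G x = ∫ x, ψ x • G x := by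
  refine setIntegral_eq_integral_of_forall_compl_eq_zero fun x hx => ?_
  rw [image_eq_zero_of_notMem_tsupport fun h => hx (hψ h), zero_smul]

theorem IsWeakGradient.mono {Ω Ω' : Set (Eucl n)} {u : Eucl n → ℝ} {G : Eucl n → Eucl n}
    (h : IsWeakGradient Ω u G) (hΩ : Ω' ⊆ Ω) : IsWeakGradient Ω' u G := by
  intro ψ h1 h2 h3
  have := h ψ h1 h2 (h3.trans hΩ)
  rw [setIntegral_smul_gradient (h3.trans hΩ), setIntegral_smul_of_tsupport (h3.trans hΩ)] at this
  rw [setIntegral_smul_gradient h3, setIntegral_smul_of_tsupport h3, this]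

theorem isWeakGradient_of_contDiff {f : Eucl n → ℝ} (hf : ContDiff ℝ ∞ f) (Ω : Set (Eucl n)) :
    IsWeakGradient Ω f (gradient f) := by
  refine IsWeakGradient.mono (Ω := Set.univ) ?_ (Set.subset_univ _)
  intro ψ h1 h2 _
  simp only [Measure.restrict_univ]
  exact integral_smul_gradient_eq hf h1 h2

theorem isH1Ball_of_contDiff {f : Eucl n → ℝ} (hf : ContDiff ℝ ∞ f) {R : ℝ} (hR : 0 ≤ R) :
    IsH1Ball R f (gradient f) f :=
  ⟨⟨memLp_ball_of_continuous hf.continuous R 2, memLp_ball_of_continuous (continuous_gradient hf) R 2,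
    isWeakGradient_of_contDiff hf _⟩, memLp_surf_of_continuous hf.continuous hR 2, fun _ => f,
    fun _ => hf, by simp, by simp, by simp⟩

end Smooth

/-! ### The weight `1 / ‖x‖` -/

/-- The measure `dx / ‖x‖` on the ball `B(R)`. -/
noncomputable def invMeas (n : ℕ) (R : ℝ) : Measure (Eucl n) :=
  (volume.restrict (B n R)).withDensity fun x => ENNReal.ofReal ‖x‖⁻¹

theorem invMeas_absolutelyContinuous (n : ℕ) (R : ℝ) :
    invMeas n R ≪ volume.restrict (B n R) := withDensity_absolutelyContinuous _ _

theorem integral_invMeas (n : ℕ) (R : ℝ) (f : Eucl n → ℝ) :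
    ∫ x, f x ∂(invMeas n R) = ∫ x in B n R, f x / ‖x‖ := by
  unfold invMeas
  simp only [ENNReal.ofReal]
  rw [integral_withDensity_eq_integral_smul (by fun_prop)]
  congr 1
  funext x
  simp only [NNReal.smul_def, smul_eq_mul]
  rw [Real.coe_toNNReal _ (by positivity), div_eq_inv_mul]

theorem integrable_invMeas_iff (n : ℕ) (R : ℝ) (f : Eucl n → ℝ) :
    Integrable f (invMeas n R) ↔ Integrable (fun x => f x / ‖x‖) (volume.restrict (B n R)) := by
  unfold invMeas
  simp only [ENNReal.ofReal]
  rw [integrable_withDensity_iff_integrable_smul (by fun_prop)]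
  refine integrable_congr (Eventually.of_forall fun x => ?_)
  simp only [NNReal.smul_def, smul_eq_mul]
  rw [Real.coe_toNNReal _ (by positivity), div_eq_inv_mul]

/-- In polar coordinates the integrand becomes r^{n-2}, which is integrable at 0 because n ≥ 2. -/
theorem integrable_inv_norm_ball {n : ℕ} (hn : 2 ≤ n) (R : ℝ) :
    Integrable (fun x : Eucl n => ‖x‖⁻¹) (volume.restrict (B n R)) := by
  have : Nontrivial (Eucl n) := by
    have : Nonempty (Fin n) := ⟨⟨0, by omega⟩⟩
    infer_instance
  refine (integrableOn_fun_norm_addHaar (volume : Measure (Eucl n)) (f := fun r : ℝ => r⁻¹)).2 ?_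
  rw [finrank_euclideanSpace_fin]
  have h : IntegrableOn (fun r : ℝ => r ^ (n - 2)) (Set.Ioo 0 R) :=
    ((continuous_pow (n - 2)).integrableOn_Icc (a := 0) (b := R)).mono_set Set.Ioo_subset_Icc_self
  refine h.congr_fun (fun r hr => ?_) measurableSet_Ioo
  simp only [smul_eq_mul]
  rw [show n - 1 = n - 2 + 1 by omega, pow_succ, mul_assoc, mul_inv_cancel₀ hr.1.ne', mul_one]

theorem isFiniteMeasure_invMeas {n : ℕ} (hn : 2 ≤ n) (R : ℝ) : IsFiniteMeasure (invMeas n R) := by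
  refine ⟨?_⟩
  have : Integrable (fun _ : Eucl n => (1 : ℝ)) (invMeas n R) := by
    rw [integrable_invMeas_iff]
    simpa using integrable_inv_norm_ball hn R
  have h := (integrable_const_iff (μ := invMeas n R) (c := (1 : ℝ))).1 this
  rcases h with h | h
  · norm_num at h
  · exact h.measure_univ_lt_top

theorem memLp_invMeas_of_continuous {n : ℕ} (hn : 2 ≤ n) {f : Eucl n → ℝ} (hf : Continuous f) (R : ℝ)
    (p : ENNReal) : MemLp f p (invMeas n R) := by
  obtain ⟨C, hC⟩ := (isCompact_closedBall (0 : Eucl n) R).exists_bound_of_continuousOn hf.continuousOn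
  have := isFiniteMeasure_invMeas hn R
  refine MemLp.of_bound hf.aestronglyMeasurable C ?_
  refine (invMeas_absolutelyContinuous n R).ae_le ?_
  filter_upwards [ae_restrict_mem measurableSet_ball] with x hx
  exact hC x (Metric.ball_subset_closedBall hx)

theorem integrable_div_norm {n : ℕ} (hn : 2 ≤ n) {f : Eucl n → ℝ} (hf : Continuous f) (R : ℝ) :
    Integrable (fun x => f x / ‖x‖) (volume.restrict (B n R)) :=
  (integrable_invMeas_iff n R f).1 (memLp_one_iff_integrable.1 (memLp_invMeas_of_continuous hn hf R 1))

theorem integrable_ball_of_continuous {n : ℕ} {f : Eucl n → ℝ} (hf : Continuous f) (R : ℝ) :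
    Integrable f (volume.restrict (B n R)) :=
  memLp_one_iff_integrable.1 (memLp_ball_of_continuous hf R 1)

/-! ### The divergence theorem on balls, in polar coordinates -/

/-- If `rⁿ⁻¹ H(r θ)` is the derivative of `K(θ, ·)`, with `K(θ, 0) = 0` and
`K(θ, R) = Rⁿ⁻¹ k(R θ)`, then `∫_{B(R)} H = ∫_{∂B(R)} k`. -/
theorem integral_ball_of_radial_deriv {n : ℕ} (hn : 2 ≤ n) {R : ℝ} (hR : 0 ≤ R) {H k : Eucl n → ℝ}
    {K K' : Metric.sphere (0 : Eucl n) 1 → ℝ → ℝ}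
    (hH : Integrable H (volume.restrict (B n R))) (hk : Continuous k)
    (hd : ∀ θ, ∀ r ∈ Set.Icc 0 R, HasDerivAt (K θ) (K' θ r) r)
    (hc : ∀ θ, ContinuousOn (K' θ) (Set.Icc 0 R)) (h0 : ∀ θ, K θ 0 = 0)
    (hKR : ∀ θ : Metric.sphere (0 : Eucl n) 1, K θ R = R ^ (n - 1) * k (R • (θ : Eucl n)))
    (hHK : ∀ θ : Metric.sphere (0 : Eucl n) 1, ∀ r ∈ Set.Ioo 0 R, r ^ (n - 1) * H (r • (θ : Eucl n)) = K' θ r) :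
    ∫ x in B n R, H x = ∫ x, k x ∂(surf n R) := by
  rw [integral_ball_eq_sphere hn hH, integral_surf hR hk, ← integral_const_mul]
  congr 1
  funext θ
  rw [setIntegral_congr_fun measurableSet_Ioo (hHK θ), ← integral_Ioc_eq_integral_Ioo,
    ← intervalIntegral.integral_of_le hR, intervalIntegral.integral_eq_sub_of_hasDerivAt (f := K θ),
    h0, sub_zero, hKR]
  · rw [Set.uIcc_of_le hR]; exact hd θ
  · exact ContinuousOn.intervalIntegrable (by rw [Set.uIcc_of_le hR]; exact hc θ)

theorem hasDerivAt_along_ray {n : ℕ} {ψ : Eucl n → ℝ} (hψ : ContDiff ℝ ∞ ψ) (θ : Eucl n) (r : ℝ) :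
    HasDerivAt (fun r : ℝ => ψ (r • θ)) (inner ℝ (gradient ψ (r • θ)) θ) r := by
  rw [inner_gradient_left]
  have h1 : HasFDerivAt ψ (fderiv ℝ ψ (r • θ)) (r • θ) :=
    (hψ.differentiable (by simp) _).hasFDerivAt
  have h2 : HasDerivAt (fun r : ℝ => r • θ) θ r := by
    simpa using (hasDerivAt_id r).smul_const θ
  exact h1.comp_hasDerivAt r h2

theorem continuous_ray_deriv {n : ℕ} {ψ : Eucl n → ℝ} (hψ : ContDiff ℝ ∞ ψ) (θ : Eucl n) :
    Continuous fun r : ℝ => inner ℝ (gradient ψ (r • θ)) θ :=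
  ((continuous_gradient hψ).comp (by fun_prop : Continuous fun r : ℝ => r • θ)).inner continuous_const

theorem continuous_ray {n : ℕ} {ψ : Eucl n → ℝ} (hψ : ContDiff ℝ ∞ ψ) (θ : Eucl n) :
    Continuous fun r : ℝ => ψ (r • θ) :=
  hψ.continuous.comp (by fun_prop)

/-- Hardy's identity with boundary term. -/
theorem hardy_identity {n : ℕ} (hn : 2 ≤ n) {R : ℝ} (hR : 0 ≤ R) {ψ : Eucl n → ℝ}
    (hψ : ContDiff ℝ ∞ ψ) :
    ∫ x in B n R, ((n - 1) * (ψ x ^ 2 / ‖x‖) + 2 * ψ x * (inner ℝ (gradient ψ x) x / ‖x‖))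
      = ∫ x, ψ x ^ 2 ∂(surf n R) := by
  have hg := continuous_gradient hψ
  have hψc := hψ.continuous
  have e1 : ∀ m : ℕ, 2 + m - 1 = m + 1 := fun m => by omega
  obtain ⟨m, rfl⟩ := Nat.exists_eq_add_of_le hn
  -- The underlying vector field is ψ² x/‖x‖, whose divergence is (n-1) ψ²/‖x‖ + 2ψ ∂ᵣψ.
  refine integral_ball_of_radial_deriv hn hR
    (K := fun θ r => r ^ (2 + m - 1) * ψ (r • (θ : Eucl (2 + m))) ^ 2)
    (K' := fun θ r => ((2 + m - 1 : ℕ) : ℝ) * r ^ (2 + m - 1 - 1) * ψ (r • (θ : Eucl (2 + m))) ^ 2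
      + r ^ (2 + m - 1) * (2 * ψ (r • (θ : Eucl (2 + m))) *
        inner ℝ (gradient ψ (r • (θ : Eucl (2 + m)))) (θ : Eucl (2 + m)))) ?_ (by fun_prop) ?_ ?_ ?_ ?_ ?_
  · refine ((integrable_div_norm hn (f := fun x => ψ x ^ 2) (by fun_prop) R).const_mul _).add ?_
    have := integrable_div_norm hn (f := fun x => 2 * ψ x * inner ℝ (gradient ψ x) x) (by fun_prop) R
    simpa only [mul_div_assoc] using this
  · intro θ r _
    refine ((hasDerivAt_pow (2 + m - 1) r).mul ((hasDerivAt_along_ray hψ θ r).pow 2)).congr_deriv ?_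
    simp
  · intro θ
    have h1 := continuous_ray hψ θ
    have h2 := continuous_ray_deriv hψ θ
    exact Continuous.continuousOn (by fun_prop)
  · intro θ
    simp [e1]
  · intro θ
    rfl
  · intro θ r hr
    have hr' : ‖r • (θ : Eucl (2 + m))‖ = r := norm_smul_sphere hr.1.le θ
    have hr0 := hr.1.ne'
    simp only [hr', e1, Nat.add_sub_cancel, inner_smul_right]
    push_cast
    field_simp
    ring

theorem eLpNorm_two_eq {α F : Type*} [MeasurableSpace α] {μ : Measure α} [NormedAddCommGroup F]
    {f : α → F} (hf : MemLp f 2 μ) : eLpNorm f 2 μ = ENNReal.ofReal √(∫ x, ‖f x‖ ^ 2 ∂μ) := by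
  rw [hf.eLpNorm_eq_integral_rpow_norm two_ne_zero ENNReal.ofNat_ne_top]
  simp [Real.sqrt_eq_rpow]

/-- In Hardy's identity the cross term is absorbed by 2ψt ≥ -ψ² - t² with t = ∂ᵣψ, and n - 1 ≥ 1.
The boundary term is kept, so the estimate also holds for n = 2. -/
theorem eLpNorm_invMeas_le {n : ℕ} (hn : 2 ≤ n) {R : ℝ} (hR : 0 ≤ R) {ψ : Eucl n → ℝ}
    (hψ : ContDiff ℝ ∞ ψ) :
    eLpNorm ψ 2 (invMeas n R) ≤ eLpNorm ψ 2 (surf n R) + eLpNorm ψ 2 (volume.restrict (B n R))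
      + eLpNorm (gradient ψ) 2 (volume.restrict (B n R)) := by
  have hn' : (2 : ℝ) ≤ n := by exact_mod_cast hn
  have hg := continuous_gradient hψ
  have hψc := hψ.continuous
  rw [eLpNorm_two_eq (memLp_invMeas_of_continuous hn hψ.continuous R 2),
    eLpNorm_two_eq (memLp_surf_of_continuous hψ.continuous hR 2),
    eLpNorm_two_eq (memLp_ball_of_continuous hψ.continuous R 2),
    eLpNorm_two_eq (memLp_ball_of_continuous (continuous_gradient hψ) R 2),
    ← ENNReal.ofReal_add (by positivity) (by positivity),
    ← ENNReal.ofReal_add (by positivity) (by positivity)]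
  refine ENNReal.ofReal_le_ofReal (Real.sqrt_le_iff.2 ⟨by positivity, ?_⟩)
  have key : ∫ x, ‖ψ x‖ ^ 2 ∂(invMeas n R) ≤ ∫ x, ‖ψ x‖ ^ 2 ∂(surf n R)
      + (∫ x in B n R, ‖ψ x‖ ^ 2) + ∫ x in B n R, ‖gradient ψ x‖ ^ 2 := by
    simp only [Real.norm_eq_abs, sq_abs]
    rw [← hardy_identity hn hR hψ, integral_invMeas,
      ← integral_add ?_ (integrable_ball_of_continuous (by fun_prop) R),
      ← integral_add ?_ (integrable_ball_of_continuous (by fun_prop) R)]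
    · refine integral_mono (integrable_div_norm hn (f := fun x => ψ x ^ 2) (by fun_prop) R) ?_ ?_
      · refine Integrable.add (Integrable.add (Integrable.add ?_ ?_) ?_) ?_
        · exact (integrable_div_norm hn (f := fun x => ψ x ^ 2) (by fun_prop) R).const_mul _
        · have := integrable_div_norm hn (f := fun x => 2 * ψ x * inner ℝ (gradient ψ x) x)
            (by fun_prop) R
          simpa only [mul_div_assoc] using this
        · exact integrable_ball_of_continuous (by fun_prop) R
        · exact integrable_ball_of_continuous (by fun_prop) R
      · intro x
        simp only
        have h1 : 0 ≤ ψ x ^ 2 / ‖x‖ := by positivity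
        have h2 : |inner ℝ (gradient ψ x) x / ‖x‖| ≤ ‖gradient ψ x‖ := by
          rw [abs_div, abs_norm]
          exact div_le_of_le_mul₀ (norm_nonneg _) (norm_nonneg _) (abs_real_inner_le_norm _ _)
        generalize inner ℝ (gradient ψ x) x / ‖x‖ = t at h2
        have h3 : t ^ 2 ≤ ‖gradient ψ x‖ ^ 2 := by
          rw [← sq_abs t]; exact pow_le_pow_left₀ (abs_nonneg _) h2 2
        nlinarith [sq_nonneg (ψ x + t)]
    · refine Integrable.add (Integrable.add ?_ ?_) ?_
      · exact (integrable_div_norm hn (f := fun x => ψ x ^ 2) (by fun_prop) R).const_mul _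
      · have := integrable_div_norm hn (f := fun x => 2 * ψ x * inner ℝ (gradient ψ x) x)
          (by fun_prop) R
        simpa only [mul_div_assoc] using this
      · exact integrable_ball_of_continuous (by fun_prop) R
    · refine Integrable.add ?_ ?_
      · exact (integrable_div_norm hn (f := fun x => ψ x ^ 2) (by fun_prop) R).const_mul _
      · have := integrable_div_norm hn (f := fun x => 2 * ψ x * inner ℝ (gradient ψ x) x)
          (by fun_prop) R
        simpa only [mul_div_assoc] using this
  refine key.trans ?_
  have i1 : 0 ≤ ∫ x, ‖ψ x‖ ^ 2 ∂(surf n R) := integral_nonneg fun x => by positivity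
  have i2 : 0 ≤ ∫ x in B n R, ‖ψ x‖ ^ 2 := integral_nonneg fun x => by positivity
  have i3 : 0 ≤ ∫ x in B n R, ‖gradient ψ x‖ ^ 2 := integral_nonneg fun x => by positivity
  have s1 := Real.sq_sqrt i1
  have s2 := Real.sq_sqrt i2
  have s3 := Real.sq_sqrt i3
  have p1 := Real.sqrt_nonneg (∫ x, ‖ψ x‖ ^ 2 ∂(surf n R))
  have p2 := Real.sqrt_nonneg (∫ x in B n R, ‖ψ x‖ ^ 2)
  have p3 := Real.sqrt_nonneg (∫ x in B n R, ‖gradient ψ x‖ ^ 2)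
  nlinarith [mul_nonneg p1 p2, mul_nonneg p1 p3, mul_nonneg p2 p3]

/-! ### Approximation of `H¹` functions with traces -/

theorem gradient_sub_of_contDiff {n : ℕ} {f g : Eucl n → ℝ} (hf : ContDiff ℝ ∞ f)
    (hg : ContDiff ℝ ∞ g) (x : Eucl n) :
    gradient (fun x => f x - g x) x = gradient f x - gradient g x := by
  have h : fderiv ℝ (fun x => f x - g x) x = fderiv ℝ f x - fderiv ℝ g x :=
    fderiv_fun_sub (hf.differentiable (by simp) x) (hg.differentiable (by simp) x)
  simp only [gradient, h, map_sub]

/-- The approximation of an `H¹` function by smooth functions also converges in `L²(dx / ‖x‖)`. -/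
theorem IsH1Ball.exists_approx {n : ℕ} (hn : 2 ≤ n) {R : ℝ} (hR : 0 ≤ R) {u : Eucl n → ℝ}
    {G : Eucl n → Eucl n} {g : Eucl n → ℝ} (h : IsH1Ball R u G g) :
    MemLp u 2 (invMeas n R) ∧ ∃ f : ℕ → Eucl n → ℝ, (∀ k, ContDiff ℝ ∞ (f k)) ∧
      Tendsto (fun k => eLpNorm (fun x => f k x - u x) 2 (volume.restrict (B n R))) atTop (𝓝 0) ∧
      Tendsto (fun k => eLpNorm (fun x => gradient (f k) x - G x) 2 (volume.restrict (B n R)))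
        atTop (𝓝 0) ∧
      Tendsto (fun k => eLpNorm (fun x => f k x - g x) 2 (surf n R)) atTop (𝓝 0) ∧
      Tendsto (fun k => eLpNorm (fun x => f k x - u x) 2 (invMeas n R)) atTop (𝓝 0) := by
  obtain ⟨⟨hu, hG, -⟩, hg, f, hf, t1, t2, t3⟩ := h
  have hac := invMeas_absolutelyContinuous n R
  set a : ℕ → ENNReal := fun k => eLpNorm (fun x => f k x - g x) 2 (surf n R)
    + eLpNorm (fun x => f k x - u x) 2 (volume.restrict (B n R))
    + eLpNorm (fun x => gradient (f k) x - G x) 2 (volume.restrict (B n R)) with ha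
  have ta : Tendsto a atTop (𝓝 0) := by
    have := (t3.add t1).add t2
    simpa using this
  have tri : ∀ {F : Type} [NormedAddCommGroup F] {μ : Measure (Eucl n)} {v w z : Eucl n → F},
      MemLp v 2 μ → MemLp w 2 μ → MemLp z 2 μ →
      eLpNorm (fun x => v x - w x) 2 μ ≤
        eLpNorm (fun x => v x - z x) 2 μ + eLpNorm (fun x => w x - z x) 2 μ := by
    intro F _ μ v w z hv hw hz
    have : (fun x => v x - w x) = (fun x => v x - z x) - (fun x => w x - z x) := by
      funext x; simp
    rw [this]
    exact eLpNorm_sub_le (hv.sub hz).1 (hw.sub hz).1 (by norm_num)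
  -- By Hardy's estimate the approximating sequence is Cauchy for the weight 1/‖x‖.
  have hkl : ∀ k l, eLpNorm (fun x => f k x - f l x) 2 (invMeas n R) ≤ a k + a l := by
    intro k l
    refine (eLpNorm_invMeas_le hn hR ((hf k).sub (hf l))).trans ?_
    have b1 := tri (memLp_surf_of_continuous (hf k).continuous hR 2)
      (memLp_surf_of_continuous (hf l).continuous hR 2) hg
    have b2 := tri (memLp_ball_of_continuous (hf k).continuous R 2)
      (memLp_ball_of_continuous (hf l).continuous R 2) hu
    have b3 := tri (memLp_ball_of_continuous (continuous_gradient (hf k)) R 2)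
      (memLp_ball_of_continuous (continuous_gradient (hf l)) R 2) hG
    have e : gradient (fun x => f k x - f l x) = fun x => gradient (f k) x - gradient (f l) x :=
      funext fun x => gradient_sub_of_contDiff (hf k) (hf l) x
    rw [e]
    refine (add_le_add (add_le_add b1 b2) b3).trans_eq ?_
    simp only [ha]
    abel
  -- An almost everywhere convergent subsequence identifies the weighted limit with u, and lower
  -- semicontinuity of the norm then passes the Cauchy bound to the limit.
  obtain ⟨ns, hns, hae⟩ := (tendstoInMeasure_of_tendsto_eLpNorm (p := 2) two_ne_zero
    (fun k => (hf k).continuous.aestronglyMeasurable) hu.1 t1).exists_seq_tendsto_ae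
  have hle : ∀ k, eLpNorm (fun x => f k x - u x) 2 (invMeas n R) ≤ a k := by
    intro k
    refine ENNReal.le_of_forall_pos_le_add fun ε hε _ => ?_
    refine Lp.eLpNorm_le_of_ae_tendsto (u := atTop) (f := fun j x => f k x - f (ns j) x) ?_
      (fun j => ((hf k).continuous.sub (hf (ns j)).continuous).aestronglyMeasurable) ?_
    · have : ∀ᶠ j in atTop, a (ns j) < ε :=
        (ta.comp hns.tendsto_atTop).eventually (gt_mem_nhds (by exact_mod_cast hε))
      filter_upwards [this] with j hj
      exact (hkl k (ns j)).trans (by gcongr)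
    · filter_upwards [hac.ae_le hae] with x hx
      exact tendsto_const_nhds.sub hx
  have tν : Tendsto (fun k => eLpNorm (fun x => f k x - u x) 2 (invMeas n R)) atTop (𝓝 0) :=
    tendsto_of_tendsto_of_tendsto_of_le_of_le tendsto_const_nhds ta (fun _ => zero_le) hle
  refine ⟨?_, f, hf, t1, t2, t3, tν⟩
  obtain ⟨k, hk⟩ := (tν.eventually (gt_mem_nhds ENNReal.zero_lt_top)).exists
  have hum : AEStronglyMeasurable u (invMeas n R) := hu.1.mono_ac hac
  have h1 : MemLp (fun x => f k x - u x) 2 (invMeas n R) :=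
    ⟨(hf k).continuous.aestronglyMeasurable.sub hum, hk⟩
  have h2 := (memLp_invMeas_of_continuous hn (hf k).continuous R 2).sub h1
  refine h2.ae_eq (Eventually.of_forall fun x => ?_)
  simp

/-- Writing the Coulomb term as an L² pairing for dx/‖x‖ puts all three terms on the same footing
for passing to limits. -/
theorem schroForm_ball_eq {n : ℕ} (R κ E : ℝ) (u ψ : Eucl n → ℝ) (G H : Eucl n → Eucl n) :
    schroForm (B n R) κ E u G ψ H = (∫ x in B n R, inner ℝ (G x) (H x))
      - κ * (∫ x, u x * ψ x ∂(invMeas n R)) - E * ∫ x in B n R, u x * ψ x := by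
  rw [integral_invMeas]; rfl

section FormLimit

variable {n : ℕ} {R : ℝ} {μ : Measure (Eucl n)}

/-- Continuity of the bilinear form along approximating sequences. -/
theorem tendsto_schroForm (κ E : ℝ)
    {u ψ : Eucl n → ℝ} {G H : Eucl n → Eucl n} {uk ψk : ℕ → Eucl n → ℝ} {Gk Hk : ℕ → Eucl n → Eucl n}
    (hu : MemLp u 2 (volume.restrict (B n R))) (hui : MemLp u 2 (invMeas n R))
    (hG : MemLp G 2 (volume.restrict (B n R)))
    (hψ : MemLp ψ 2 (volume.restrict (B n R))) (hψi : MemLp ψ 2 (invMeas n R))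
    (hH : MemLp H 2 (volume.restrict (B n R)))
    (huk : ∀ k, MemLp (uk k) 2 (volume.restrict (B n R))) (huik : ∀ k, MemLp (uk k) 2 (invMeas n R))
    (hGk : ∀ k, MemLp (Gk k) 2 (volume.restrict (B n R)))
    (hψk : ∀ k, MemLp (ψk k) 2 (volume.restrict (B n R))) (hψik : ∀ k, MemLp (ψk k) 2 (invMeas n R))
    (hHk : ∀ k, MemLp (Hk k) 2 (volume.restrict (B n R)))
    (tu : Tendsto (fun k => eLpNorm (fun x => uk k x - u x) 2 (volume.restrict (B n R))) atTop (𝓝 0))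
    (tui : Tendsto (fun k => eLpNorm (fun x => uk k x - u x) 2 (invMeas n R)) atTop (𝓝 0))
    (tG : Tendsto (fun k => eLpNorm (fun x => Gk k x - G x) 2 (volume.restrict (B n R))) atTop (𝓝 0))
    (tψ : Tendsto (fun k => eLpNorm (fun x => ψk k x - ψ x) 2 (volume.restrict (B n R))) atTop (𝓝 0))
    (tψi : Tendsto (fun k => eLpNorm (fun x => ψk k x - ψ x) 2 (invMeas n R)) atTop (𝓝 0))
    (tH : Tendsto (fun k => eLpNorm (fun x => Hk k x - H x) 2 (volume.restrict (B n R))) atTop (𝓝 0)) :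
    Tendsto (fun k => schroForm (B n R) κ E (uk k) (Gk k) (ψk k) (Hk k)) atTop
      (𝓝 (schroForm (B n R) κ E u G ψ H)) := by
  simp only [schroForm_ball_eq]
  exact ((tendsto_integral_inner_of_eLpNorm hG hH hGk hHk tG tH).sub
    ((tendsto_integral_mul_of_eLpNorm hui hψi huik hψik tui tψi).const_mul κ)).sub
    ((tendsto_integral_mul_of_eLpNorm hu hψ huk hψk tu tψ).const_mul E)

end FormLimit

/-! ### Radial functions with a smooth profile -/

theorem tendsto_eLpNorm_two_of_bounded {α F : Type*} [MeasurableSpace α] {μ : Measure α}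
    [IsFiniteMeasure μ] [NormedAddCommGroup F] {f : ℕ → α → F} (C : ℝ)
    (hf : ∀ k, AEStronglyMeasurable (f k) μ) (hb : ∀ k, ∀ᵐ x ∂μ, ‖f k x‖ ≤ C)
    (ht : ∀ᵐ x ∂μ, Tendsto (fun k => f k x) atTop (𝓝 0)) :
    Tendsto (fun k => eLpNorm (f k) 2 μ) atTop (𝓝 0) := by
  have h : Tendsto (fun k => ∫⁻ x, ‖f k x‖ₑ ^ (2 : ℝ) ∂μ) atTop (𝓝 (∫⁻ _, 0 ∂μ)) := by
    refine tendsto_lintegral_of_dominated_convergence' (fun _ => ENNReal.ofReal C ^ (2 : ℝ))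
      (fun k => (hf k).enorm.pow_const _) (fun k => ?_) ?_ ?_
    · filter_upwards [hb k] with x hx
      gcongr
      rw [← ofReal_norm]
      exact ENNReal.ofReal_le_ofReal hx
    · rw [lintegral_const]
      exact ENNReal.mul_ne_top (by simp) (measure_ne_top _ _)
    · filter_upwards [ht] with x hx
      have h1 : Tendsto (fun k => ‖f k x‖ₑ) atTop (𝓝 0) := by
        have h0 := (continuous_enorm.tendsto (0 : F)).comp hx
        rwa [enorm_zero] at h0
      have h2 := h1.ennrpow_const 2
      simpa using h2
  have h' := h.ennrpow_const (1 / 2)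
  simp only [lintegral_zero] at h'
  rw [ENNReal.zero_rpow_of_pos (by norm_num)] at h'
  refine h'.congr fun k => ?_
  rw [eLpNorm_eq_lintegral_rpow_enorm_toReal two_ne_zero ENNReal.ofNat_ne_top]
  simp

/-- The gradient of `x ↦ F ‖x‖`. -/
noncomputable def radGrad {n : ℕ} (F : ℝ → ℝ) (x : Eucl n) : Eucl n := (deriv F ‖x‖ * ‖x‖⁻¹) • x

/-- The smooth approximation `F √(‖x‖² + δ²)` of `F ‖x‖`. -/
noncomputable def smoothRad {n : ℕ} (F : ℝ → ℝ) (δ : ℝ) (x : Eucl n) : ℝ := F √(‖x‖ ^ 2 + δ ^ 2)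

section Radial

variable {n : ℕ} {F : ℝ → ℝ}

theorem contDiff_smoothRad (hF : ContDiff ℝ ∞ F) {δ : ℝ} (hδ : 0 < δ) :
    ContDiff ℝ ∞ (smoothRad (n := n) F δ) := by
  refine hF.comp (ContDiff.sqrt ((contDiff_norm_sq ℝ).add contDiff_const) fun x => ?_)
  positivity

theorem gradient_smoothRad (hF : ContDiff ℝ ∞ F) {δ : ℝ} (hδ : 0 < δ) (x : Eucl n) :
    gradient (smoothRad F δ) x
      = (deriv F √(‖x‖ ^ 2 + δ ^ 2) * (√(‖x‖ ^ 2 + δ ^ 2))⁻¹) • x := by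
  refine HasGradientAt.gradient ?_
  rw [hasGradientAt_iff_hasFDerivAt]
  have h0 : ‖x‖ ^ 2 + δ ^ 2 ≠ 0 := by positivity
  have h1 : HasFDerivAt (fun x : Eucl n => ‖x‖ ^ 2 + δ ^ 2) (2 • innerSL ℝ x) x :=
    (hasStrictFDerivAt_norm_sq x).hasFDerivAt.add_const _
  have h2 := (Real.hasDerivAt_sqrt h0).comp_hasFDerivAt x h1
  have h3 : HasDerivAt F (deriv F √(‖x‖ ^ 2 + δ ^ 2)) √(‖x‖ ^ 2 + δ ^ 2) :=
    (hF.differentiable (by simp) _).hasDerivAt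
  have h4 := h3.comp_hasFDerivAt x h2
  refine h4.congr_fderiv ?_
  ext v
  simp
  field_simp

theorem aestronglyMeasurable_radGrad (F : ℝ → ℝ) (μ : Measure (Eucl n)) :
    AEStronglyMeasurable (radGrad F) μ := by
  have h : Measurable (deriv F) := measurable_deriv F
  unfold radGrad
  exact Measurable.aestronglyMeasurable (by fun_prop)

theorem continuous_deriv_of_contDiff (hF : ContDiff ℝ ∞ F) : Continuous (deriv F) :=
  hF.continuous_deriv (by simp)

theorem exists_profile_bound (hF : ContDiff ℝ ∞ F) (R : ℝ) :
    ∃ C, ∀ r ∈ Set.Icc 0 R, |F r| ≤ C ∧ |deriv F r| ≤ C := by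
  obtain ⟨C1, h1⟩ := (isCompact_Icc (a := 0) (b := R)).exists_bound_of_continuousOn
    hF.continuous.continuousOn
  obtain ⟨C2, h2⟩ := (isCompact_Icc (a := 0) (b := R)).exists_bound_of_continuousOn
    (continuous_deriv_of_contDiff hF).continuousOn
  exact ⟨max C1 C2, fun r hr => ⟨(h1 r hr).trans (le_max_left _ _), (h2 r hr).trans (le_max_right _ _)⟩⟩

theorem norm_mul_inv_smul_le (t : ℝ) {s : ℝ} {x : Eucl n} (hs : ‖x‖ ≤ s) :
    ‖(t * s⁻¹) • x‖ ≤ |t| := by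
  rw [norm_smul, Real.norm_eq_abs, abs_mul, mul_assoc]
  have hs0 : 0 ≤ s := (norm_nonneg x).trans hs
  refine mul_le_of_le_one_right (abs_nonneg _) ?_
  rw [abs_inv, abs_of_nonneg hs0, inv_mul_eq_div]
  exact div_le_one_of_le₀ hs hs0

theorem norm_radGrad_le (x : Eucl n) : ‖radGrad F x‖ ≤ |deriv F ‖x‖| :=
  norm_mul_inv_smul_le _ le_rfl

theorem inner_radGrad (F : ℝ → ℝ) (x v : Eucl n) :
    inner ℝ (radGrad F x) v = deriv F ‖x‖ * (inner ℝ v x / ‖x‖) := by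
  rw [radGrad, inner_smul_left, real_inner_comm]
  simp only [conj_trivial]
  ring

/-- A sequence of smooth functions that converges in `H¹(B(R))` has a weakly differentiable
limit. -/
theorem isWeakGradient_of_tendsto {R : ℝ} {u : Eucl n → ℝ} {G : Eucl n → Eucl n}
    {f : ℕ → Eucl n → ℝ} (hf : ∀ k, ContDiff ℝ ∞ (f k)) (hu : MemLp u 2 (volume.restrict (B n R)))
    (hG : MemLp G 2 (volume.restrict (B n R)))
    (t1 : Tendsto (fun k => eLpNorm (fun x => f k x - u x) 2 (volume.restrict (B n R))) atTop (𝓝 0))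
    (t2 : Tendsto (fun k => eLpNorm (fun x => gradient (f k) x - G x) 2 (volume.restrict (B n R)))
      atTop (𝓝 0)) : IsWeakGradient (B n R) u G := by
  intro ψ hψ hs hsub
  have hψ1 := memLp_ball_of_continuous hψ.continuous R 2
  have hψ2 := memLp_ball_of_continuous (continuous_gradient hψ) R 2
  have i1 : Integrable (fun x => u x • gradient ψ x) (volume.restrict (B n R)) :=
    memLp_one_iff_integrable.1 (hψ2.smul hu)
  have i2 : Integrable (fun x => ψ x • G x) (volume.restrict (B n R)) :=
    memLp_one_iff_integrable.1 (hG.smul hψ1)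
  refine ext_inner_right ℝ fun v => ?_
  rw [inner_neg_left, real_inner_comm, ← integral_inner i1, real_inner_comm, ← integral_inner i2]
  simp only [inner_smul_right]
  have hψv : MemLp (fun x => inner ℝ v (gradient ψ x)) 2 (volume.restrict (B n R)) :=
    memLp_ball_of_continuous (continuous_const.inner (continuous_gradient hψ)) R 2
  have hψv' : MemLp (fun x => ψ x • v) 2 (volume.restrict (B n R)) :=
    memLp_ball_of_continuous (hψ.continuous.smul continuous_const) R 2
  have T1 := tendsto_integral_mul_of_eLpNorm hu hψv
    (fun k => memLp_ball_of_continuous (hf k).continuous R 2) (fun _ => hψv) t1 (by simp)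
  have T2 := (tendsto_integral_inner_of_eLpNorm hG hψv'
    (fun k => memLp_ball_of_continuous (continuous_gradient (hf k)) R 2) (fun _ => hψv') t2
    (by simp)).neg
  have e : ∀ k, ∫ x in B n R, f k x * inner ℝ v (gradient ψ x)
      = - ∫ x in B n R, inner ℝ (gradient (f k) x) (ψ x • v) := by
    intro k
    have h := isWeakGradient_of_contDiff (hf k) (B n R) ψ hψ hs hsub
    have j1 : Integrable (fun x => f k x • gradient ψ x) (volume.restrict (B n R)) :=
      integrable_ball_of_continuous' ((hf k).continuous.smul (continuous_gradient hψ)) R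
    have j2 : Integrable (fun x => ψ x • gradient (f k) x) (volume.restrict (B n R)) :=
      integrable_ball_of_continuous' (hψ.continuous.smul (continuous_gradient (hf k))) R
    have := congrArg (inner ℝ v) h
    rw [inner_neg_right, ← integral_inner j1, ← integral_inner j2] at this
    simp only [inner_smul_right] at this ⊢
    rw [this]
    simp only [real_inner_comm]
  have := tendsto_nhds_unique T1 (T2.congr fun k => (e k).symm)
  rw [this]
  simp only [inner_smul_right]
  simp only [real_inner_comm]
where
  integrable_ball_of_continuous' {n : ℕ} {F : Type _} [NormedAddCommGroup F]
      [SecondCountableTopologyEither (Eucl n) F] {f : Eucl n → F} (hf : Continuous f) (R : ℝ) :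
      Integrable f (volume.restrict (B n R)) :=
    memLp_one_iff_integrable.1 (memLp_ball_of_continuous hf R 1)

/-- A radial function with smooth profile lies in `H¹(B(R))`, and its trace is constant. -/
theorem isH1Ball_radial (hF : ContDiff ℝ ∞ F) {R : ℝ} (hR : 0 ≤ R) :
    IsH1Ball (n := n) R (fun x => F ‖x‖) (radGrad F) (fun _ => F R) := by
  obtain ⟨C, hC⟩ := exists_profile_bound hF (R + 1)
  have hfin : IsFiniteMeasure (volume.restrict (B n R)) := ⟨by
    rw [Measure.restrict_apply_univ]; exact measure_ball_lt_top⟩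
  have hmem : ∀ x ∈ B n R, ‖x‖ ∈ Set.Icc 0 (R + 1) := fun x hx =>
    ⟨norm_nonneg x, by have := mem_ball_zero_iff.1 hx; linarith⟩
  have hu : MemLp (fun x : Eucl n => F ‖x‖) 2 (volume.restrict (B n R)) :=
    memLp_ball_of_continuous (hF.continuous.comp continuous_norm) R 2
  have hG : MemLp (radGrad F) 2 (volume.restrict (B n R)) := by
    refine MemLp.of_bound (aestronglyMeasurable_radGrad F _) C ?_
    filter_upwards [ae_restrict_mem measurableSet_ball] with x hx
    exact (norm_radGrad_le x).trans (hC _ (hmem x hx)).2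
  -- The function F ‖x‖ need not be smooth at the origin, since F'(0) may be nonzero; ‖x‖ is
  -- therefore replaced by √(‖x‖² + δ²). For δ ≤ 1 this stays in [0, R + 1], where the profile and
  -- its derivative are bounded.
  set δ : ℕ → ℝ := fun k => 1 / ((k : ℝ) + 1) with hδdef
  have hδ : ∀ k, 0 < δ k := fun k => by positivity
  have hδ1 : ∀ k, δ k ≤ 1 := fun k => by
    rw [hδdef]; exact div_le_one_of_le₀ (by have : (0 : ℝ) ≤ k := k.cast_nonneg; linarith) (by positivity)
  have hδ0 : Tendsto δ atTop (𝓝 0) := tendsto_one_div_add_atTop_nhds_zero_nat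
  have hle : ∀ (x : Eucl n) k, ‖x‖ ≤ √(‖x‖ ^ 2 + δ k ^ 2) := fun x k =>
    Real.le_sqrt_of_sq_le (by nlinarith [sq_nonneg (δ k)])
  have hs : ∀ (x : Eucl n) k, ‖x‖ ≤ R → √(‖x‖ ^ 2 + δ k ^ 2) ∈ Set.Icc 0 (R + 1) := by
    intro x k hx
    refine ⟨Real.sqrt_nonneg _, Real.sqrt_le_iff.2 ⟨by linarith, ?_⟩⟩
    have h1 : ‖x‖ ^ 2 ≤ R ^ 2 := pow_le_pow_left₀ (norm_nonneg x) hx 2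
    have h2 : δ k ^ 2 ≤ 1 := pow_le_one₀ (hδ k).le (hδ1 k)
    nlinarith
  have hlim : ∀ x : Eucl n, Tendsto (fun k => √(‖x‖ ^ 2 + δ k ^ 2)) atTop (𝓝 ‖x‖) := by
    intro x
    have : Tendsto (fun k => √(‖x‖ ^ 2 + δ k ^ 2)) atTop (𝓝 √(‖x‖ ^ 2 + 0 ^ 2)) :=
      (Real.continuous_sqrt.tendsto _).comp ((hδ0.pow 2).const_add _)
    simpa using this
  have hFs : ∀ k, ContDiff ℝ ∞ (smoothRad (n := n) F (δ k)) := fun k => contDiff_smoothRad hF (hδ k)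
  have t1 : Tendsto (fun k => eLpNorm (fun x => smoothRad F (δ k) x - F ‖x‖) 2
      (volume.restrict (B n R))) atTop (𝓝 0) := by
    refine tendsto_eLpNorm_two_of_bounded (C + C)
      (fun k => ((hFs k).continuous.sub (hF.continuous.comp continuous_norm)).aestronglyMeasurable)
      (fun k => ?_) ?_
    · filter_upwards [ae_restrict_mem measurableSet_ball] with x hx
      exact (norm_sub_le _ _).trans
        (add_le_add (hC _ (hs x k (mem_ball_zero_iff.1 hx).le)).1 (hC _ (hmem x hx)).1)
    · refine Eventually.of_forall fun x => ?_
      have := ((hF.continuous.tendsto _).comp (hlim x)).sub_const (F ‖x‖)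
      simpa [smoothRad] using this
  have t2 : Tendsto (fun k => eLpNorm (fun x => gradient (smoothRad F (δ k)) x - radGrad F x) 2
      (volume.restrict (B n R))) atTop (𝓝 0) := by
    refine tendsto_eLpNorm_two_of_bounded (C + C)
      (fun k => (continuous_gradient (hFs k)).aestronglyMeasurable.sub
        (aestronglyMeasurable_radGrad F _)) (fun k => ?_) ?_
    · filter_upwards [ae_restrict_mem measurableSet_ball] with x hx
      refine (norm_sub_le _ _).trans (add_le_add ?_ ?_)
      · rw [gradient_smoothRad hF (hδ k)]
        exact (norm_mul_inv_smul_le _ (hle x k)).trans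
          (hC _ (hs x k (mem_ball_zero_iff.1 hx).le)).2
      · exact (norm_radGrad_le x).trans (hC _ (hmem x hx)).2
    · refine Eventually.of_forall fun x => ?_
      by_cases hx : x = 0
      · subst hx
        simp [gradient_smoothRad hF (hδ _), radGrad]
      have hx' : ‖x‖ ≠ 0 := norm_ne_zero_iff.2 hx
      have h1 : Tendsto (fun k => (deriv F √(‖x‖ ^ 2 + δ k ^ 2) * (√(‖x‖ ^ 2 + δ k ^ 2))⁻¹) • x)
          atTop (𝓝 (radGrad F x)) :=
        ((((continuous_deriv_of_contDiff hF).tendsto _).comp (hlim x)).mul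
          ((hlim x).inv₀ hx')).smul_const x
      have := h1.sub_const (radGrad F x)
      simpa only [gradient_smoothRad hF (hδ _), sub_self] using this
  refine ⟨⟨hu, hG, isWeakGradient_of_tendsto hFs hu hG t1 t2⟩, memLp_const _, _, hFs, t1, t2, ?_⟩
  refine tendsto_eLpNorm_two_of_bounded (C + C)
    (fun k => ((hFs k).continuous.sub continuous_const).aestronglyMeasurable) (fun k => ?_) ?_
  · filter_upwards [ae_surf_norm_eq hR] with x hx
    exact (norm_sub_le _ _).trans
      (add_le_add (hC _ (hs x k hx.le)).1 (hC R ⟨hR, by linarith⟩).1)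
  · filter_upwards [ae_surf_norm_eq hR] with x hx
    have := ((hF.continuous.tendsto _).comp (hlim x)).sub_const (F ‖x‖)
    simpa [hx, smoothRad] using this

theorem isWeakGradient_radial_univ (hF : ContDiff ℝ ∞ F) :
    IsWeakGradient (n := n) Set.univ (fun x => F ‖x‖) (radGrad F) := by
  intro ψ h1 h2 _
  obtain ⟨R, hR, hsub⟩ := h2.isCompact.isBounded.subset_ball_lt 0 (0 : Eucl n)
  have h := (isH1Ball_radial hF hR.le).1.2.2 ψ h1 h2 hsub
  rw [setIntegral_smul_gradient hsub, setIntegral_smul_of_tsupport hsub] at h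
  simpa only [Measure.restrict_univ] using h

end Radial

/-! ### Congruence and traces -/

section Congr

variable {n : ℕ}

theorem IsWeakGradient.congr {Ω : Set (Eucl n)} {u u' : Eucl n → ℝ} {G G' : Eucl n → Eucl n}
    (h : IsWeakGradient Ω u G) (hu : u =ᵐ[volume.restrict Ω] u') (hG : G =ᵐ[volume.restrict Ω] G') :
    IsWeakGradient Ω u' G' := by
  intro ψ h1 h2 h3
  have e1 : ∫ x in Ω, u' x • gradient ψ x = ∫ x in Ω, u x • gradient ψ x :=
    integral_congr_ae (by filter_upwards [hu] with x hx; rw [hx])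
  have e2 : ∫ x in Ω, ψ x • G' x = ∫ x in Ω, ψ x • G x :=
    integral_congr_ae (by filter_upwards [hG] with x hx; rw [hx])
  rw [e1, e2]
  exact h ψ h1 h2 h3

theorem IsH1.congr {Ω : Set (Eucl n)} {u u' : Eucl n → ℝ} {G G' : Eucl n → Eucl n}
    (h : IsH1 Ω u G) (hu : u =ᵐ[volume.restrict Ω] u') (hG : G =ᵐ[volume.restrict Ω] G') :
    IsH1 Ω u' G' :=
  ⟨h.1.ae_eq hu, h.2.1.ae_eq hG, h.2.2.congr hu hG⟩

theorem IsH1Ball.congr {R : ℝ} {u u' : Eucl n → ℝ} {G G' : Eucl n → Eucl n} {g : Eucl n → ℝ}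
    (h : IsH1Ball R u G g) (hu : u =ᵐ[volume.restrict (B n R)] u')
    (hG : G =ᵐ[volume.restrict (B n R)] G') : IsH1Ball R u' G' g := by
  obtain ⟨h1, hg, f, hf, t1, t2, t3⟩ := h
  refine ⟨h1.congr hu hG, hg, f, hf, t1.congr fun k => ?_, t2.congr fun k => ?_, t3⟩
  · exact eLpNorm_congr_ae (by filter_upwards [hu] with x hx; rw [hx])
  · exact eLpNorm_congr_ae (by filter_upwards [hG] with x hx; rw [hx])

theorem schroForm_congr {Ω : Set (Eucl n)} {κ E : ℝ} {u u' : Eucl n → ℝ} {G G' : Eucl n → Eucl n}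
    (hu : u =ᵐ[volume.restrict Ω] u') (hG : G =ᵐ[volume.restrict Ω] G') (ψ : Eucl n → ℝ)
    (H : Eucl n → Eucl n) : schroForm Ω κ E u G ψ H = schroForm Ω κ E u' G' ψ H := by
  have e1 : ∫ x in Ω, inner ℝ (G x) (H x) = ∫ x in Ω, inner ℝ (G' x) (H x) :=
    integral_congr_ae (by filter_upwards [hG] with x hx; rw [hx])
  have e2 : ∫ x in Ω, u x * ψ x / ‖x‖ = ∫ x in Ω, u' x * ψ x / ‖x‖ :=
    integral_congr_ae (by filter_upwards [hu] with x hx; rw [hx])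
  have e3 : ∫ x in Ω, u x * ψ x = ∫ x in Ω, u' x * ψ x :=
    integral_congr_ae (by filter_upwards [hu] with x hx; rw [hx])
  rw [schroForm, e1, e2, e3, schroForm]

/-- Weak gradients are unique. -/
theorem IsWeakGradient.unique {Ω : Set (Eucl n)} (hΩ : IsOpen Ω) {u : Eucl n → ℝ}
    {G G' : Eucl n → Eucl n} (h : IsWeakGradient Ω u G) (h' : IsWeakGradient Ω u G')
    (hG : LocallyIntegrableOn G Ω) (hG' : LocallyIntegrableOn G' Ω) :
    G =ᵐ[volume.restrict Ω] G' := by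
  have hloc : LocallyIntegrableOn (fun x => G x - G' x) Ω := hG.sub hG'
  have := hΩ.ae_eq_zero_of_integral_contDiff_smul_eq_zero hloc fun ψ h1 h2 h3 => by
    have e1 := h ψ h1 h2 h3
    have e2 := h' ψ h1 h2 h3
    rw [e1, neg_inj, setIntegral_smul_of_tsupport h3, setIntegral_smul_of_tsupport h3] at e2
    have I : ∀ K : Eucl n → Eucl n, LocallyIntegrableOn K Ω → Integrable fun x => ψ x • K x := by
      intro K hK
      have hKs : IntegrableOn K (tsupport ψ) := hK.integrableOn_compact_subset h3 h2
      have : IntegrableOn (fun x => ψ x • K x) (tsupport ψ) :=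
        hKs.continuousOn_smul h1.continuous.continuousOn h2
      rw [← integrableOn_univ]
      refine (integrableOn_iff_integrable_of_support_subset ?_).1 this |>.integrableOn
      intro x hx
      simp only [Function.mem_support] at hx
      exact subset_tsupport _ fun h0 => hx (by rw [h0, zero_smul])
    simp only [smul_sub]
    rw [integral_sub (I G hG) (I G' hG'), e2, sub_self]
  rw [EventuallyEq, ae_restrict_iff' hΩ.measurableSet]
  filter_upwards [this] with x hx hxΩ
  exact sub_eq_zero.1 (hx hxΩ)

theorem locallyIntegrableOn_of_memLp {F : Type*} [NormedAddCommGroup F] {R : ℝ} {G : Eucl n → F}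
    (h : MemLp G 2 (volume.restrict (B n R))) : LocallyIntegrableOn G (B n R) := by
  have hfin : IsFiniteMeasure (volume.restrict (B n R)) := ⟨by
    rw [Measure.restrict_apply_univ]; exact measure_ball_lt_top⟩
  exact IntegrableOn.locallyIntegrableOn (h.integrable (by norm_num))

/-- The average of the trace, from the divergence theorem for the field `u x`. -/
theorem trace_identity (hn : 2 ≤ n) {R : ℝ} (hR : 0 ≤ R) {u : Eucl n → ℝ}
    {G : Eucl n → Eucl n} {g : Eucl n → ℝ} (h : IsH1Ball R u G g) :
    n * (∫ x in B n R, u x * 1) + (∫ x in B n R, inner ℝ (G x) x) = R * ∫ x, g x * 1 ∂(surf n R) := by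
  obtain ⟨⟨hu, hG, -⟩, hg, f, hf, t1, t2, t3⟩ := h
  have c1 : MemLp (fun _ : Eucl n => (1 : ℝ)) 2 (volume.restrict (B n R)) :=
    memLp_ball_of_continuous continuous_const R 2
  have c2 : MemLp (fun x : Eucl n => x) 2 (volume.restrict (B n R)) :=
    memLp_ball_of_continuous continuous_id R 2
  have c3 : MemLp (fun _ : Eucl n => (1 : ℝ)) 2 (surf n R) := memLp_const _
  have T1 := tendsto_integral_mul_of_eLpNorm hu c1
    (fun k => memLp_ball_of_continuous (hf k).continuous R 2) (fun _ => c1) t1 (by simp)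
  have T2 := tendsto_integral_inner_of_eLpNorm hG c2
    (fun k => memLp_ball_of_continuous (continuous_gradient (hf k)) R 2) (fun _ => c2) t2 (by simp)
  have T3 := tendsto_integral_mul_of_eLpNorm hg c3
    (fun k => memLp_surf_of_continuous (hf k).continuous hR 2) (fun _ => c3) t3 (by simp)
  refine tendsto_nhds_unique ((T1.const_mul (n : ℝ)).add T2) ((T3.const_mul R).congr fun k => ?_)
  have hg := continuous_gradient (hf k)
  have hfc := (hf k).continuous
  simp only [mul_one]
  rw [← integral_const_mul, ← integral_const_mul, ← integral_add
    (integrable_ball_of_continuous (by fun_prop) R) (integrable_ball_of_continuous (by fun_prop) R)]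
  symm
  refine integral_ball_of_radial_deriv hn hR
    (K := fun θ r => r ^ n * f k (r • (θ : Eucl n)))
    (K' := fun θ r => n * r ^ (n - 1) * f k (r • (θ : Eucl n)) + r ^ n *
        inner ℝ (gradient (f k) (r • (θ : Eucl n))) (θ : Eucl n))
    (integrable_ball_of_continuous (by fun_prop) R) (by fun_prop) ?_ ?_ ?_ ?_ ?_
  · intro θ r _
    exact (hasDerivAt_pow n r).mul (hasDerivAt_along_ray (hf k) θ r)
  · intro θ
    have h1 := continuous_ray (hf k) θ
    have h2 := continuous_ray_deriv (hf k) θ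
    exact Continuous.continuousOn (by fun_prop)
  · intro θ
    simp [show n ≠ 0 by omega]
  · intro θ
    obtain ⟨m, rfl⟩ := Nat.exists_eq_add_of_le hn
    rw [show 2 + m - 1 = m + 1 by omega]
    ring
  · intro θ r hr
    obtain ⟨m, rfl⟩ := Nat.exists_eq_add_of_le hn
    rw [show 2 + m - 1 = m + 1 by omega, inner_smul_right]
    ring

/-- The trace identity expresses the average through u and G alone. For radial solutions the
boundary condition is read off from this average, so uniqueness of the trace itself is not needed.
-/
theorem trace_average_unique (hn : 2 ≤ n) {R : ℝ} (hR : 0 < R) {u : Eucl n → ℝ}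
    {G : Eucl n → Eucl n} {g g' : Eucl n → ℝ} (h : IsH1Ball R u G g) (h' : IsH1Ball R u G g') :
    ∫ x, g x ∂(surf n R) = ∫ x, g' x ∂(surf n R) := by
  have e1 := trace_identity hn hR.le h
  have e2 := trace_identity hn hR.le h'
  rw [e1] at e2
  simpa using mul_left_cancel₀ hR.ne' e2

end Congr

/-! ### Radial solutions and the bilinear form -/

/-- `F` is a smooth profile of a radial solution of `(-Δ - κ / r) u = E u`. -/
structure IsProfile (n : ℕ) (κ E : ℝ) (F : ℝ → ℝ) : Prop where
  contDiff : ContDiff ℝ ∞ F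
  hasDerivAt : ∀ r, HasDerivAt (fun r => r ^ (n - 1) * deriv F r)
    (-(κ * r ^ (n - 2) + E * r ^ (n - 1)) * F r) r

theorem isProfile_regSol {n : ℕ} (hn : 2 ≤ n) (κ E c : ℝ) :
    IsProfile n κ E fun r => c * regSol n κ E r where
  contDiff := contDiff_const.mul (contDiff_regSol hn κ E)
  hasDerivAt r := by
    have e : ∀ r, deriv (fun r => c * regSol n κ E r) r = c * regSol' n κ E r := fun r =>
      ((hasDerivAt_regSol hn κ E r).const_mul c).deriv
    simp only [e]
    have := (hasDerivAt_pow_mul_regSol' hn κ E r).const_mul c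
    refine (this.congr_deriv ?_).congr_of_eventuallyEq (Eventually.of_forall fun s => ?_)
    · ring
    · simp only; ring

/-- This is the divergence theorem for ψ F'(‖x‖) x/‖x‖: the profile equation cancels the Coulomb and
energy terms, leaving the boundary term. No support condition is put on ψ, so boundary values remain
visible. -/
theorem schroForm_profile_smooth {n : ℕ} (hn : 2 ≤ n) {κ E : ℝ} {F : ℝ → ℝ} (hF : IsProfile n κ E F)
    {R : ℝ} (hR : 0 ≤ R) {ψ : Eucl n → ℝ} (hψ : ContDiff ℝ ∞ ψ) :
    schroForm (B n R) κ E (fun x => F ‖x‖) (radGrad F) ψ (gradient ψ)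
      = deriv F R * ∫ x, ψ x ∂(surf n R) := by
  have hg := continuous_gradient hψ
  have hψc := hψ.continuous
  have hFc := hF.contDiff.continuous
  have hFc' := continuous_deriv_of_contDiff hF.contDiff
  have i1 : Integrable (fun x => deriv F ‖x‖ * (inner ℝ (gradient ψ x) x / ‖x‖))
      (volume.restrict (B n R)) := by
    have := integrable_div_norm hn (f := fun x => deriv F ‖x‖ * inner ℝ (gradient ψ x) x)
      (by fun_prop) R
    simpa only [mul_div_assoc] using this
  have i2 : Integrable (fun x => F ‖x‖ * ψ x / ‖x‖) (volume.restrict (B n R)) :=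
    integrable_div_norm hn (f := fun x => F ‖x‖ * ψ x) (by fun_prop) R
  have i3 : Integrable (fun x => F ‖x‖ * ψ x) (volume.restrict (B n R)) :=
    integrable_ball_of_continuous (by fun_prop) R
  have i12 : Integrable (fun x => deriv F ‖x‖ * (inner ℝ (gradient ψ x) x / ‖x‖)
      - κ * (F ‖x‖ * ψ x / ‖x‖)) (volume.restrict (B n R)) := i1.sub (i2.const_mul κ)
  unfold schroForm
  simp only [inner_radGrad]
  rw [← integral_const_mul, ← integral_const_mul, ← integral_const_mul,
    ← integral_sub i1 (i2.const_mul κ), ← integral_sub i12 (i3.const_mul E)]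
  refine integral_ball_of_radial_deriv hn hR
    (K := fun θ r => r ^ (n - 1) * deriv F r * ψ (r • (θ : Eucl n)))
    (K' := fun θ r => -(κ * r ^ (n - 2) + E * r ^ (n - 1)) * F r * ψ (r • (θ : Eucl n))
      + r ^ (n - 1) * deriv F r * inner ℝ (gradient ψ (r • (θ : Eucl n))) (θ : Eucl n))
    (i12.sub (i3.const_mul E)) (by fun_prop) ?_ ?_ ?_ ?_ ?_
  · intro θ r _
    exact (hF.hasDerivAt r).mul (hasDerivAt_along_ray hψ θ r)
  · intro θ
    have h1 := continuous_ray hψ θ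
    have h2 := continuous_ray_deriv hψ θ
    exact Continuous.continuousOn (by fun_prop)
  · intro θ
    simp [show n - 1 ≠ 0 by omega]
  · intro θ
    ring
  · intro θ r hr
    have hr' : ‖r • (θ : Eucl n)‖ = r := norm_smul_sphere hr.1.le θ
    have hr0 := hr.1.ne'
    obtain ⟨m, rfl⟩ := Nat.exists_eq_add_of_le hn
    rw [hr', inner_smul_right, show 2 + m - 1 = m + 1 by omega, show 2 + m - 2 = m by omega]
    field_simp
    ring

/-- Green's formula for a radial solution and an arbitrary `H¹` function. -/
theorem schroForm_profile {n : ℕ} (hn : 2 ≤ n) {κ E : ℝ} {F : ℝ → ℝ} (hF : IsProfile n κ E F)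
    {R : ℝ} (hR : 0 ≤ R) {ψ : Eucl n → ℝ} {H : Eucl n → Eucl n} {h : Eucl n → ℝ}
    (hψ : IsH1Ball R ψ H h) :
    schroForm (B n R) κ E (fun x => F ‖x‖) (radGrad F) ψ H = deriv F R * ∫ x, h x ∂(surf n R) := by
  obtain ⟨hψi, f, hf, t1, t2, t3, t4⟩ := hψ.exists_approx hn hR
  have hu := isH1Ball_radial (n := n) hF.contDiff hR
  have hFc := hF.contDiff.continuous
  have hui : MemLp (fun x : Eucl n => F ‖x‖) 2 (invMeas n R) :=
    memLp_invMeas_of_continuous hn (by fun_prop) R 2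
  have T := tendsto_schroForm κ E hu.1.1 hui hu.1.2.1 hψ.1.1 hψi hψ.1.2.1 (fun _ => hu.1.1)
    (fun _ => hui) (fun _ => hu.1.2.1) (fun k => memLp_ball_of_continuous (hf k).continuous R 2)
    (fun k => memLp_invMeas_of_continuous hn (hf k).continuous R 2)
    (fun k => memLp_ball_of_continuous (continuous_gradient (hf k)) R 2) (by simp) (by simp) (by simp)
    t1 t4 t2
  have c3 : MemLp (fun _ : Eucl n => (1 : ℝ)) 2 (surf n R) := memLp_const _
  have T3 := tendsto_integral_mul_of_eLpNorm hψ.2.1 c3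
    (fun k => memLp_surf_of_continuous (hf k).continuous hR 2) (fun _ => c3) t3 (by simp)
  simp only [mul_one] at T3
  exact tendsto_nhds_unique T ((T3.const_mul (deriv F R)).congr fun k =>
    (schroForm_profile_smooth hn hF hR (hf k)).symm)

/-! ### Weak derivatives on an interval -/

theorem contDiff_primitive {φ : ℝ → ℝ} (hφ : ContDiff ℝ ∞ φ) (c : ℝ) :
    ContDiff ℝ ∞ (fun t => ∫ s in c..t, φ s) ∧ deriv (fun t => ∫ s in c..t, φ s) = φ := by
  have hd : ∀ t, HasDerivAt (fun t => ∫ s in c..t, φ s) (φ t) t := fun t =>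
    hφ.continuous.integral_hasStrictDerivAt c t |>.hasDerivAt
  have he : deriv (fun t => ∫ s in c..t, φ s) = φ := funext fun t => (hd t).deriv
  refine ⟨contDiff_infty_iff_deriv.2 ⟨fun t => (hd t).differentiableAt, ?_⟩, he⟩
  rw [he]
  exact hφ

theorem IsCompact.exists_subset_Icc_of_subset_Ioo {K : Set ℝ} (hK : IsCompact K) {R : ℝ} (hR : 0 < R)
    (h : K ⊆ Set.Ioo 0 R) : ∃ a b, 0 < a ∧ a < b ∧ b < R ∧ K ⊆ Set.Icc a b := by
  rcases K.eq_empty_or_nonempty with rfl | hne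
  · exact ⟨R / 3, R / 2, by linarith, by linarith, by linarith, Set.empty_subset _⟩
  obtain ⟨a, ha, hal⟩ := hK.exists_isLeast hne
  obtain ⟨b, hb, hbg⟩ := hK.exists_isGreatest hne
  have h1 := (h ha).1
  have h2 := (h hb).2
  have h3 := hal hb
  exact ⟨a / 2, b, by linarith, by linarith, h2, fun x hx => ⟨by linarith [hal hx], hbg hx⟩⟩

/-- Integration by parts against a primitive. -/
theorem integral_primitive_mul_deriv {p h : ℝ → ℝ} {a b c : ℝ} (hp : IntervalIntegrable p volume a b)
    (hc : c ∈ Set.uIcc a b) (hh : ContDiff ℝ ∞ h) :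
    ∫ x in a..b, (∫ s in c..x, p s) * deriv h x
      = (∫ s in c..b, p s) * h b - (∫ s in c..a, p s) * h a - ∫ x in a..b, p x * h x := by
  have h1 := hp.absolutelyContinuousOnInterval_intervalIntegral hc
  have h2 : AbsolutelyContinuousOnInterval h a b :=
    (hh.of_le (by simp)).contDiffOn.absolutelyContinuousOnInterval
  rw [h1.integral_mul_deriv_eq_deriv_mul h2]
  congr 1
  refine intervalIntegral.integral_congr_ae ?_
  filter_upwards [hp.ae_hasDerivAt_integral] with x hx hx'
  rw [(hx (Set.uIoc_subset_uIcc hx') c hc).deriv]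

/-- The argument of du Bois-Reymond: for a bump φ₀ of mass 1, the function φ - (∫φ) φ₀ has mean zero
and so is the derivative of a test function. Hence D integrates against φ exactly as the constant ∫
φ₀ D does. -/
theorem ae_const_of_weak_deriv_zero {R : ℝ} (hR : 0 < R) {D : ℝ → ℝ}
    (hD : LocallyIntegrableOn D (Set.Ioo 0 R))
    (h : ∀ φ : ℝ → ℝ, ContDiff ℝ ∞ φ → HasCompactSupport φ → tsupport φ ⊆ Set.Ioo 0 R →
      ∫ r in Set.Ioo 0 R, D r * deriv φ r = 0) :
    ∃ C, ∀ᵐ r, r ∈ Set.Ioo 0 R → D r = C := by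
  let β : ContDiffBump (R / 2) := ⟨R / 8, R / 4, by positivity, by linarith⟩
  set φ₀ : ℝ → ℝ := β.normed volume with hφ₀
  have b1 : ContDiff ℝ ∞ φ₀ := β.contDiff_normed
  have b2 : tsupport φ₀ ⊆ Set.Icc (R / 4) (3 * R / 4) := by
    rw [hφ₀, β.tsupport_normed_eq, Real.closedBall_eq_Icc]
    exact Set.Icc_subset_Icc (by change R / 4 ≤ R / 2 - R / 4; linarith)
      (by change R / 2 + R / 4 ≤ _; linarith)
  have b3 : ∫ r, φ₀ r = 1 := β.integral_normed
  have b4 : HasCompactSupport φ₀ := β.hasCompactSupport_normed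
  have I : ∀ φ : ℝ → ℝ, Continuous φ → HasCompactSupport φ → tsupport φ ⊆ Set.Ioo 0 R →
      Integrable (fun r => φ r * D r) (volume.restrict (Set.Ioo 0 R)) := by
    intro φ h1 h2 h3
    have hKs : IntegrableOn D (tsupport φ) := hD.integrableOn_compact_subset h3 h2
    have h4 : IntegrableOn (fun x => φ x * D x) (tsupport φ) :=
      hKs.continuousOn_smul h1.continuousOn h2
    refine Integrable.integrableOn ?_
    refine (integrableOn_iff_integrable_of_support_subset ?_).1 h4
    intro x hx
    simp only [Function.mem_support] at hx
    exact subset_tsupport _ fun h0 => hx (by rw [h0, zero_mul])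
  refine ⟨∫ r in Set.Ioo 0 R, φ₀ r * D r, ?_⟩
  set C := ∫ r in Set.Ioo 0 R, φ₀ r * D r with hC
  have hb2' : tsupport φ₀ ⊆ Set.Ioo 0 R := b2.trans fun x hx => ⟨by linarith [hx.1], by linarith [hx.2]⟩
  have key := isOpen_Ioo.ae_eq_zero_of_integral_contDiff_smul_eq_zero
    (hD.sub (locallyIntegrableOn_const C)) fun φ h1 h2 h3 => by
    simp only [smul_eq_mul, Pi.sub_apply]
    obtain ⟨a', b', ha', hab', hb', hsub'⟩ := h2.isCompact.exists_subset_Icc_of_subset_Ioo hR h3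
    set a := min a' (R / 4) / 2 with ha
    set b := max b' (3 * R / 4) with hb
    have ham : 0 < min a' (R / 4) := lt_min ha' (by linarith)
    have ha0 : 0 < a := half_pos ham
    have ha1 : a < a' := (half_lt_self ham).trans_le (min_le_left _ _)
    have ha2 : a < R / 4 := (half_lt_self ham).trans_le (min_le_right _ _)
    have hbR : b < R := max_lt hb' (by linarith)
    have hab : a < b := ha1.trans (hab'.trans_le (le_max_left _ _))
    set t := ∫ r, φ r with ht
    set χ : ℝ → ℝ := fun r => φ r - t * φ₀ r with hχ
    have c1 : ContDiff ℝ ∞ χ := h1.sub (contDiff_const.mul b1)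
    have c2 : ∀ r, r ∉ Set.Ioc a b → χ r = 0 := by
      intro r hr
      have e1 : φ r = 0 := image_eq_zero_of_notMem_tsupport fun hr' =>
        hr ⟨ha1.trans_le (hsub' hr').1, (hsub' hr').2.trans (le_max_left _ _)⟩
      have e2 : φ₀ r = 0 := image_eq_zero_of_notMem_tsupport fun hr' =>
        hr ⟨ha2.trans_le (b2 hr').1, (b2 hr').2.trans (le_max_right _ _)⟩
      simp [hχ, e1, e2]
    have iφ : Integrable φ := h1.continuous.integrable_of_hasCompactSupport h2
    have iφ₀ : Integrable φ₀ := b1.continuous.integrable_of_hasCompactSupport b4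
    have c3 : ∫ r, χ r = 0 := by
      rw [hχ, integral_sub iφ (iφ₀.const_mul t), integral_const_mul, b3]
      simp [ht]
    obtain ⟨d1, d2⟩ := contDiff_primitive c1 a
    set η : ℝ → ℝ := fun r => ∫ s in a..r, χ s with hη
    have hη0 : ∀ r, r ∉ Set.Icc a b → η r = 0 := by
      intro r hr
      rcases lt_or_ge r a with hra | hra
      · rw [hη]
        refine intervalIntegral.integral_zero_ae (Eventually.of_forall fun s hs => c2 s fun hs' => ?_)
        rw [Set.uIoc_of_ge hra.le] at hs
        exact absurd hs'.1 hs.2.not_gt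
      · have hrb : b < r := by
          by_contra hcon
          exact hr ⟨hra, not_lt.1 hcon⟩
        rw [← c3, hη]
        simp only
        rw [intervalIntegral.integral_of_le hra]
        exact setIntegral_eq_integral_of_forall_compl_eq_zero fun s hs =>
          c2 s fun hs' => hs ⟨hs'.1, hs'.2.trans hrb.le⟩
    have d3 : tsupport η ⊆ Set.Icc a b :=
      closure_minimal (fun r hr => by
        by_contra hr'
        exact hr (hη0 r hr')) isClosed_Icc
    have d4 : HasCompactSupport η := isCompact_Icc.of_isClosed_subset (isClosed_tsupport _) d3
    have h0 := h η d1 d4 (d3.trans fun x hx => ⟨by linarith [hx.1], by linarith [hx.2]⟩)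
    rw [d2] at h0
    have e1 : ∫ r in Set.Ioo 0 R, D r * χ r = (∫ r in Set.Ioo 0 R, φ r * D r) - t * C := by
      rw [hC, ← integral_const_mul, ← integral_sub (I φ h1.continuous h2 h3)
        ((I φ₀ b1.continuous b4 hb2').const_mul t)]
      congr 1
      funext r
      simp only [hχ]
      ring
    have e2 : ∫ r in Set.Ioo 0 R, φ r * (D r - C)
        = (∫ r in Set.Ioo 0 R, φ r * D r) - t * C := by
      have e3 : ∫ r in Set.Ioo 0 R, φ r * C = t * C := by
        rw [integral_mul_const, ht]
        congr 1
        exact setIntegral_eq_integral_of_forall_compl_eq_zero fun x hx =>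
          image_eq_zero_of_notMem_tsupport fun hx' => hx (h3 hx')
      rw [← e3, ← integral_sub (I φ h1.continuous h2 h3) (iφ.integrableOn.mul_const C)]
      simp only [mul_sub]
    have e4 : ∫ r, φ r * (D r - C) = ∫ r in Set.Ioo 0 R, φ r * (D r - C) :=
      (setIntegral_eq_integral_of_forall_compl_eq_zero fun x hx => by
        rw [image_eq_zero_of_notMem_tsupport fun hx' => hx (h3 hx'), zero_mul]).symm
    rw [e4, e2, ← e1, h0]
  filter_upwards [key] with r hr hr'
  have := hr hr'
  simp only [Pi.sub_apply] at this
  linarith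

theorem integrableOn_Ioo_of_pow_mul {p : ℝ → ℝ} {R : ℝ} {m : ℕ}
    (hp : IntegrableOn (fun r => r ^ m * p r) (Set.Ioo 0 R)) {δ : ℝ} (hδ : 0 < δ) :
    IntegrableOn p (Set.Ioo δ R) := by
  have hsub : Set.Ioo δ R ⊆ Set.Icc δ R := Set.Ioo_subset_Icc_self
  have hc : ContinuousOn (fun r : ℝ => (r ^ m)⁻¹) (Set.Icc δ R) :=
    ContinuousOn.inv₀ (by fun_prop) fun r hr => pow_ne_zero _ (hδ.trans_le hr.1).ne'
  have h1 : IntegrableOn (fun r => r ^ m * p r) (Set.Ioo δ R) :=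
    hp.mono_set (Set.Ioo_subset_Ioo_left hδ.le)
  have h2 : IntegrableOn (fun r => (r ^ m)⁻¹ * (r ^ m * p r)) (Set.Icc δ R) :=
    ((integrableOn_Icc_iff_integrableOn_Ioo).2 h1).continuousOn_smul hc isCompact_Icc
  refine (h2.mono_set hsub).congr_fun (fun r hr => ?_) measurableSet_Ioo
  have : r ^ m ≠ 0 := pow_ne_zero _ (hδ.trans hr.1).ne'
  simp only
  field_simp

theorem locallyIntegrableOn_of_pow_mul {p : ℝ → ℝ} {R : ℝ} {m : ℕ}
    (hp : IntegrableOn (fun r => r ^ m * p r) (Set.Ioo 0 R)) :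
    LocallyIntegrableOn p (Set.Ioo 0 R) := by
  intro r hr
  refine ⟨Set.Ioo (r / 2) R, ?_, integrableOn_Ioo_of_pow_mul hp (half_pos hr.1)⟩
  exact mem_nhdsWithin_of_mem_nhds (Ioo_mem_nhds (half_lt_self hr.1) hr.2)

section Weak1D

variable {R : ℝ} {p : ℝ → ℝ} {m : ℕ}

theorem intervalIntegrable_of_pow_mul (hp : IntegrableOn (fun r => r ^ m * p r) (Set.Ioo 0 R))
    {a b : ℝ} (ha : a ∈ Set.Ioc 0 R) (hb : b ∈ Set.Ioc 0 R) : IntervalIntegrable p volume a b := by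
  have h : ∀ {a b : ℝ}, a ∈ Set.Ioc 0 R → b ∈ Set.Ioc 0 R → a ≤ b → IntervalIntegrable p volume a b := by
    intro a b ha hb hab
    rw [intervalIntegrable_iff_integrableOn_Ioo_of_le hab]
    exact (integrableOn_Ioo_of_pow_mul hp ha.1).mono_set (Set.Ioo_subset_Ioo_right hb.2)
  rcases le_total a b with hab | hab
  · exact h ha hb hab
  · exact (h hb ha hab).symm

/-- The function p need not be integrable up to 0, so primitives are based at R/2. Continuity at r
is checked on an interval that stays away from 0. -/
theorem continuousOn_primitive_Ioo (hR : 0 < R)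
    (hp : IntegrableOn (fun r => r ^ m * p r) (Set.Ioo 0 R)) :
    ContinuousOn (fun r => ∫ s in (R / 2)..r, p s) (Set.Ioo 0 R) := by
  intro r hr
  have ha : min r (R / 2) / 2 ∈ Set.Ioc 0 R := by
    have h1 : 0 < min r (R / 2) := lt_min hr.1 (by linarith)
    have h2 := min_le_right r (R / 2)
    exact ⟨by linarith, by linarith⟩
  have h := intervalIntegrable_of_pow_mul hp ha ⟨hR, le_rfl⟩
  have hlt : min r (R / 2) / 2 < r := by
    have h1 : 0 < min r (R / 2) := lt_min hr.1 (by linarith)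
    have h2 := min_le_left r (R / 2)
    linarith
  have hmem : R / 2 ∈ Set.uIcc (min r (R / 2) / 2) R := by
    rw [Set.uIcc_of_le ha.2]
    have h1 : 0 < min r (R / 2) := lt_min hr.1 (by linarith)
    have h2 := min_le_right r (R / 2)
    exact ⟨by linarith, by linarith⟩
  have hc := (h.absolutelyContinuousOnInterval_intervalIntegral hmem).continuousOn
  rw [Set.uIcc_of_le ha.2] at hc
  exact (hc.continuousAt (Icc_mem_nhds hlt hr.2)).continuousWithinAt

/-- A function with an integrable weak derivative is almost everywhere a primitive. -/
theorem ae_eq_primitive_of_weak_deriv (hR : 0 < R) {U : ℝ → ℝ}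
    (hU : LocallyIntegrableOn U (Set.Ioo 0 R))
    (hp : IntegrableOn (fun r => r ^ m * p r) (Set.Ioo 0 R))
    (h : ∀ φ : ℝ → ℝ, ContDiff ℝ ∞ φ → HasCompactSupport φ → tsupport φ ⊆ Set.Ioo 0 R →
      ∫ r in Set.Ioo 0 R, U r * deriv φ r = - ∫ r in Set.Ioo 0 R, p r * φ r) :
    ∃ C, ∀ᵐ r, r ∈ Set.Ioo 0 R → U r = C + ∫ s in (R / 2)..r, p s := by
  have hV := continuousOn_primitive_Ioo hR hp
  have hVl : LocallyIntegrableOn (fun r => ∫ s in (R / 2)..r, p s) (Set.Ioo 0 R) :=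
    hV.locallyIntegrableOn measurableSet_Ioo
  obtain ⟨C, hC⟩ := ae_const_of_weak_deriv_zero hR (hU.sub hVl) fun φ h1 h2 h3 => by
    obtain ⟨a', b', ha', hab', hbR', hs'⟩ := h2.isCompact.exists_subset_Icc_of_subset_Ioo hR h3
    set a := min a' (R / 2) / 2 with ha
    set b := (max b' (R / 2) + R) / 2 with hb
    have hm1 : 0 < min a' (R / 2) := lt_min ha' (by linarith)
    have hm2 : max b' (R / 2) < R := max_lt hbR' (by linarith)
    have hm3 := min_le_left a' (R / 2)
    have hm4 := min_le_right a' (R / 2)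
    have hm5 := le_max_left b' (R / 2)
    have hm6 := le_max_right b' (R / 2)
    have ha0 : 0 < a := by linarith
    have hbR : b < R := by linarith
    have hab : a ≤ b := by linarith
    have hsub : tsupport φ ⊆ Set.Ioo a b := fun x hx =>
      ⟨by linarith [(hs' hx).1], by linarith [(hs' hx).2]⟩
    have hφ0 : ∀ r, r ∉ Set.Ioo a b → φ r = 0 := fun r hr =>
      image_eq_zero_of_notMem_tsupport fun hr' => hr (hsub hr')
    have hφ0' : ∀ r, r ∉ Set.Ioo a b → deriv φ r = 0 := fun r hr => by
      by_contra hne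
      exact hr (hsub (tsupport_deriv_subset (subset_tsupport _ hne)))
    have hI : ∀ f : ℝ → ℝ, (∀ r, r ∉ Set.Ioo a b → f r = 0) →
        ∫ r in Set.Ioo 0 R, f r = ∫ r in a..b, f r := by
      intro f hf
      rw [intervalIntegral.integral_of_le hab, integral_Ioc_eq_integral_Ioo,
        setIntegral_eq_integral_of_forall_compl_eq_zero hf,
        setIntegral_eq_integral_of_forall_compl_eq_zero (s := Set.Ioo 0 R) fun x hx =>
          hf x fun hx' => hx ⟨ha0.trans hx'.1, hx'.2.trans hbR⟩]
    have hpi := intervalIntegrable_of_pow_mul hp (a := a) (b := b) ⟨ha0, by linarith⟩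
      ⟨by linarith, hbR.le⟩
    have e1 := integral_primitive_mul_deriv hpi (c := R / 2) (by
      rw [Set.uIcc_of_le hab]; exact ⟨by linarith, by linarith⟩) h1
    rw [hφ0 a (by simp), hφ0 b (by simp), mul_zero, mul_zero, sub_zero, zero_sub,
      ← hI _ fun r hr => by rw [hφ0' r hr, mul_zero],
      ← hI _ fun r hr => by rw [hφ0 r hr, mul_zero], ← h φ h1 h2 h3] at e1
    have hint : ∀ D : ℝ → ℝ, LocallyIntegrableOn D (Set.Ioo 0 R) →
        Integrable (fun r => D r * deriv φ r) (volume.restrict (Set.Ioo 0 R)) := by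
      intro D hD
      have hKs : IntegrableOn D (tsupport φ) := hD.integrableOn_compact_subset h3 h2
      have h4 : IntegrableOn (fun x => deriv φ x * D x) (tsupport φ) :=
        hKs.continuousOn_smul (h1.continuous_deriv (by simp)).continuousOn h2
      have h5 : Integrable (fun x => deriv φ x * D x) := by
        refine (integrableOn_iff_integrable_of_support_subset ?_).1 h4
        intro x hx
        simp only [Function.mem_support] at hx
        exact tsupport_deriv_subset (subset_tsupport (deriv φ) fun h0 => hx (by rw [h0, zero_mul]))
      exact h5.integrableOn.congr (Eventually.of_forall fun x => mul_comm _ _)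
    simp only [Pi.sub_apply, sub_mul]
    rw [integral_sub (hint U hU) (hint _ hVl), e1, sub_self]
  refine ⟨C, ?_⟩
  filter_upwards [hC] with r hr hr'
  have := hr hr'
  simp only [Pi.sub_apply] at this
  linarith

/-- A Hardy inequality in L¹. Let P be the primitive of |p| based at R/2. Integrating by parts on
(ε, R/2), the boundary term at ε has a favourable sign, so (m+1) ∫ r^m |P| ≤ ∫ r^{m+1} |p| uniformly
in ε. -/
theorem integrableOn_pow_mul_primitive (hR : 0 < R)
    (hp : IntegrableOn (fun r => r ^ (m + 1) * p r) (Set.Ioo 0 R)) :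
    IntegrableOn (fun r => r ^ m * ∫ s in (R / 2)..r, p s) (Set.Ioo 0 R) := by
  have hR2 : R / 2 ∈ Set.Ioc 0 R := ⟨by linarith, by linarith⟩
  have hV := continuousOn_primitive_Ioo hR hp
  have hVm : ContinuousOn (fun r => r ^ m * ∫ s in (R / 2)..r, p s) (Set.Ioo 0 R) :=
    (by fun_prop : ContinuousOn (fun r : ℝ => r ^ m) (Set.Ioo 0 R)).mul hV
  have hp' : IntegrableOn (fun r => r ^ (m + 1) * |p r|) (Set.Ioo 0 R) := by
    refine Integrable.congr hp.norm ?_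
    filter_upwards [ae_restrict_mem measurableSet_Ioo] with r hr
    simp only [Real.norm_eq_abs, abs_mul, abs_of_pos (pow_pos hr.1 (m + 1))]
  set P : ℝ → ℝ := fun r => ∫ s in (R / 2)..r, |p s| with hP
  have hPc : ContinuousOn P (Set.Ioo 0 R) := continuousOn_primitive_Ioo hR hp'
  have hVP : ∀ r ∈ Set.Ioo 0 R, |∫ s in (R / 2)..r, p s| ≤ |P r| := fun r _ => by
    have := intervalIntegral.norm_integral_le_abs_integral_norm (f := p) (a := R / 2) (b := r)
      (μ := volume)
    simpa only [hP, Real.norm_eq_abs] using this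
  have hPl : IntegrableOn (fun r => r ^ m * P r) (Set.Ioc 0 (R / 2)) := by
    refine integrableOn_Ioc_of_intervalIntegral_norm_bounded_left (l := atTop)
      (a := fun k : ℕ => R / 2 / ((k : ℝ) + 2)) (I := ∫ r in Set.Ioo 0 R, r ^ (m + 1) * |p r|)
      (fun k => ?_) ?_ (Eventually.of_forall fun k => ?_)
    · have hk : 0 < R / 2 / ((k : ℝ) + 2) := by positivity
      refine (ContinuousOn.integrableOn_Icc ?_).mono_set Set.Ioc_subset_Icc_self
      refine ContinuousOn.mul (by fun_prop) (hPc.mono fun x hx => ?_)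
      exact ⟨hk.trans_le hx.1, by linarith [hx.2]⟩
    · have h1 : Tendsto (fun k : ℕ => (k : ℝ) + 2) atTop atTop :=
        tendsto_atTop_add_const_right _ _ tendsto_natCast_atTop_atTop
      exact h1.const_div_atTop (R / 2)
    · set ε := R / 2 / ((k : ℝ) + 2) with hε
      have hk0 : (0 : ℝ) ≤ k := k.cast_nonneg
      have hε0 : 0 < ε := by positivity
      have hε1 : ε ≤ R / 2 := div_le_self (by linarith) (by linarith)
      have hi := intervalIntegrable_of_pow_mul hp' (a := ε) (b := R / 2) ⟨hε0, by linarith⟩ hR2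
      have e := integral_primitive_mul_deriv hi (c := R / 2) Set.right_mem_uIcc
        (h := fun r => r ^ (m + 1)) (contDiff_id.pow (m + 1))
      have hPneg : ∀ r, r ≤ R / 2 → P r ≤ 0 := by
        intro r hr
        rw [hP]
        simp only
        rw [intervalIntegral.integral_symm]
        have : 0 ≤ ∫ s in r..(R / 2), |p s| :=
          intervalIntegral.integral_nonneg hr fun s _ => abs_nonneg _
        linarith
      have e2 : ∫ x in Set.Ioc ε (R / 2), ‖x ^ m * P x‖ = - ∫ x in ε..(R / 2), x ^ m * P x := by
        rw [intervalIntegral.integral_of_le hε1, ← integral_neg]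
        refine setIntegral_congr_fun measurableSet_Ioc fun x hx => ?_
        simp only [Real.norm_eq_abs]
        rw [abs_of_nonpos]
        exact mul_nonpos_of_nonneg_of_nonpos (pow_nonneg (hε0.trans hx.1).le _) (hPneg x hx.2)
      have e3 : ∫ x in ε..(R / 2), P x * deriv (fun r => r ^ (m + 1)) x
          = ((m : ℝ) + 1) * ∫ x in ε..(R / 2), x ^ m * P x := by
        rw [← intervalIntegral.integral_const_mul]
        congr 1
        funext x
        simp
        ring
      have e4 : ∫ x in ε..(R / 2), |p x| * x ^ (m + 1) ≤ ∫ r in Set.Ioo 0 R, r ^ (m + 1) * |p r| := by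
        rw [intervalIntegral.integral_of_le hε1, integral_Ioc_eq_integral_Ioo]
        simp only [mul_comm (|p _|)]
        refine setIntegral_mono_set hp' ?_ ?_
        · filter_upwards [ae_restrict_mem measurableSet_Ioo] with x hx
          have := pow_nonneg hx.1.le (m + 1)
          simp only [Pi.zero_apply]
          positivity
        · exact (Set.Ioo_subset_Ioo hε0.le (by linarith)).eventuallyLE
      have e5 : ∫ x in ε..(R / 2), P x * deriv (fun r => r ^ (m + 1)) x
          = - (P ε * ε ^ (m + 1)) - ∫ x in ε..(R / 2), |p x| * x ^ (m + 1) := by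
        rw [e]
        simp [hP]
      rw [e2]
      have h6 : P ε * ε ^ (m + 1) ≤ 0 :=
        mul_nonpos_of_nonpos_of_nonneg (hPneg ε hε1) (by positivity)
      have h7 : ∫ x in ε..(R / 2), x ^ m * P x ≤ 0 := by
        have : 0 ≤ ∫ x in Set.Ioc ε (R / 2), ‖x ^ m * P x‖ := integral_nonneg fun _ => norm_nonneg _
        linarith
      have hm0 : (0 : ℝ) ≤ m := m.cast_nonneg
      nlinarith
  have hPr : IntegrableOn (fun r => r ^ m * P r) (Set.Icc (R / 2) R) := by
    have hi := intervalIntegrable_of_pow_mul hp' hR2 ⟨hR, le_rfl⟩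
    have hc := (hi.absolutelyContinuousOnInterval_intervalIntegral Set.left_mem_uIcc).continuousOn
    rw [Set.uIcc_of_le (by linarith)] at hc
    exact ContinuousOn.integrableOn_Icc ((by fun_prop : ContinuousOn (fun r : ℝ => r ^ m) _).mul hc)
  have hPI : IntegrableOn (fun r => r ^ m * P r) (Set.Ioo 0 R) :=
    (hPl.union hPr).mono_set fun x hx => by
      rcases le_total x (R / 2) with h | h
      · exact Or.inl ⟨hx.1, h⟩
      · exact Or.inr ⟨h, hx.2.le⟩
  refine Integrable.mono hPI (hVm.aestronglyMeasurable measurableSet_Ioo) ?_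
  filter_upwards [ae_restrict_mem measurableSet_Ioo] with r hr
  simp only [Real.norm_eq_abs, abs_mul]
  exact mul_le_mul_of_nonneg_left (hVP r hr) (abs_nonneg _)

/-- A radial function with weak derivative, in the weighted sense, is integrable against
`rⁿ⁻² dr`. -/
theorem integrableOn_pow_mul_of_weak_deriv (hR : 0 < R) {U : ℝ → ℝ}
    (hU : LocallyIntegrableOn U (Set.Ioo 0 R))
    (hp : IntegrableOn (fun r => r ^ (m + 1) * p r) (Set.Ioo 0 R))
    (h : ∀ φ : ℝ → ℝ, ContDiff ℝ ∞ φ → HasCompactSupport φ → tsupport φ ⊆ Set.Ioo 0 R →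
      ∫ r in Set.Ioo 0 R, U r * deriv φ r = - ∫ r in Set.Ioo 0 R, p r * φ r) :
    IntegrableOn (fun r => r ^ m * U r) (Set.Ioo 0 R) := by
  obtain ⟨C, hC⟩ := ae_eq_primitive_of_weak_deriv hR hU hp h
  have h1 : IntegrableOn (fun r : ℝ => r ^ m * C) (Set.Ioo 0 R) :=
    (Continuous.integrableOn_Icc (a := 0) (b := R) (by fun_prop)).mono_set Set.Ioo_subset_Icc_self
  refine (h1.add (integrableOn_pow_mul_primitive hR hp)).congr ?_
  filter_upwards [ae_restrict_mem measurableSet_Ioo, ae_restrict_of_ae hC] with r hr hr'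
  simp only [Pi.add_apply]
  rw [hr' hr]
  ring

end Weak1D

/-- Regularity for the weak radial equation. -/
theorem exists_ae_eq_regSol {n : ℕ} (hn : 2 ≤ n) (κ E : ℝ) {R : ℝ} (hR : 0 < R) {U p : ℝ → ℝ}
    (hU : IntegrableOn (fun r => r ^ (n - 1) * U r) (Set.Ioo 0 R))
    (hp : IntegrableOn (fun r => r ^ (n - 1) * p r) (Set.Ioo 0 R))
    (hw : ∀ φ : ℝ → ℝ, ContDiff ℝ ∞ φ → HasCompactSupport φ → tsupport φ ⊆ Set.Ioo 0 R →
      ∫ r in Set.Ioo 0 R, U r * deriv φ r = - ∫ r in Set.Ioo 0 R, p r * φ r)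
    (hs : ∀ h : ℝ → ℝ, ContDiff ℝ ∞ h → ∀ a b : ℝ, 0 < a → a < b → b < R → (∀ r ≤ a, h r = h 0) →
      (∀ r ≥ b, h r = 0) → ∫ r in Set.Ioo 0 R, (r ^ (n - 1) * p r) * deriv h r
        = ∫ r in Set.Ioo 0 R, ((κ * r ^ (n - 2) + E * r ^ (n - 1)) * U r) * h r) :
    ∃ c, ∀ᵐ r, r ∈ Set.Ioo 0 R → U r = c * regSol n κ E r := by
  have hn1 : n - 1 = n - 2 + 1 := by omega
  have hUl := locallyIntegrableOn_of_pow_mul hU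
  -- The Coulomb term contains r^{n-2} U, one power of r short of the assumed integrability. The
  -- weak derivative supplies the missing power.
  have hU2 : IntegrableOn (fun r => r ^ (n - 2) * U r) (Set.Ioo 0 R) :=
    integrableOn_pow_mul_of_weak_deriv hR hUl (hn1 ▸ hp) hw
  obtain ⟨C, hC⟩ := ae_eq_primitive_of_weak_deriv hR hUl hp hw
  set V : ℝ → ℝ := fun r => C + ∫ s in (R / 2)..r, p s with hV
  have hVc : ContinuousOn V (Set.Ioo 0 R) :=
    continuousOn_const.add (continuousOn_primitive_Ioo hR hp)
  set k : ℝ → ℝ := fun r => κ * r ^ (n - 2) + E * r ^ (n - 1) with hk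
  have hkc : Continuous k := by fun_prop
  have hkU : IntegrableOn (fun r => k r * U r) (Set.Ioo 0 R) := by
    refine Integrable.congr ((hU2.const_mul κ).add (hU.const_mul E)) (Eventually.of_forall fun r => ?_)
    simp only [hk, Pi.add_apply]
    ring
  have hkUi : ∀ {a b}, a ∈ Set.Icc 0 R → b ∈ Set.Icc 0 R →
      IntervalIntegrable (fun r => k r * U r) volume a b := by
    have h : ∀ {a b : ℝ}, a ∈ Set.Icc 0 R → b ∈ Set.Icc 0 R → a ≤ b →
        IntervalIntegrable (fun r => k r * U r) volume a b := by
      intro a b ha hb hab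
      rw [intervalIntegrable_iff_integrableOn_Ioo_of_le hab]
      exact hkU.mono_set (Set.Ioo_subset_Ioo ha.1 hb.2)
    intro a b ha hb
    rcases le_total a b with hab | hab
    · exact h ha hb hab
    · exact (h hb ha hab).symm
  have h0R : (0 : ℝ) ∈ Set.Icc 0 R := ⟨le_rfl, hR.le⟩
  have hRR : R ∈ Set.Icc 0 R := ⟨hR.le, le_rfl⟩
  -- The candidate for the flux r^{n-1} p carries no additive constant, because the test functions
  -- in `hs` may be nonzero constants near 0. This is what rules out the singular solution.
  set Q : ℝ → ℝ := fun r => - ∫ s in (0 : ℝ)..r, k s * U s with hQ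
  have hQc : ContinuousOn Q (Set.Icc 0 R) := by
    have := ((hkUi h0R hRR).absolutelyContinuousOnInterval_intervalIntegral
      Set.left_mem_uIcc).continuousOn
    rw [Set.uIcc_of_le hR.le] at this
    exact this.neg
  have hq : ∀ᵐ r, r ∈ Set.Ioo 0 R → r ^ (n - 1) * p r = Q r := by
    have hloc : LocallyIntegrableOn (fun r => r ^ (n - 1) * p r - Q r) (Set.Ioo 0 R) :=
      (IntegrableOn.locallyIntegrableOn hp).sub
        ((hQc.mono Set.Ioo_subset_Icc_self).locallyIntegrableOn measurableSet_Ioo)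
    have key := isOpen_Ioo.ae_eq_zero_of_integral_contDiff_smul_eq_zero hloc fun φ h1 h2 h3 => by
      obtain ⟨a', b, ha', hab', hbR, hsub'⟩ := h2.isCompact.exists_subset_Icc_of_subset_Ioo hR h3
      -- The primitive of φ based at R vanishes near R and is constant near 0, which is exactly the
      -- class allowed in `hs`.
      obtain ⟨d1, d2⟩ := contDiff_primitive h1 R
      set h : ℝ → ℝ := fun t => ∫ s in R..t, φ s with hh
      have hφ0 : ∀ r, r ∉ Set.Icc a' b → φ r = 0 := fun r hr =>
        image_eq_zero_of_notMem_tsupport fun hr' => hr (hsub' hr')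
      have e1 := hs h d1 (a' / 2) ((b + R) / 2) (by linarith) (by linarith) (by linarith)
        (fun r hr => by
          rw [hh]
          simp only
          rw [← sub_eq_zero, intervalIntegral.integral_interval_sub_left
            (h1.continuous.intervalIntegrable _ _) (h1.continuous.intervalIntegrable _ _)]
          refine intervalIntegral.integral_zero_ae (Eventually.of_forall fun s hs => hφ0 s fun hs' => ?_)
          have hs1 : s ≤ max 0 r := (Set.mem_Ioc.1 hs).2
          have : max 0 r ≤ a' / 2 := max_le (by linarith) hr
          linarith [hs'.1])
        (fun r hr => by
          refine intervalIntegral.integral_zero_ae (Eventually.of_forall fun s hs => hφ0 s fun hs' => ?_)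
          have hs1 : min R r < s := (Set.mem_Ioc.1 hs).1
          have : b < min R r := lt_min hbR (by linarith)
          linarith [hs'.2])
      rw [d2] at e1
      have e2 := integral_primitive_mul_deriv (hkUi h0R hRR) (c := 0) Set.left_mem_uIcc d1
      rw [d2, intervalIntegral.integral_same, zero_mul, sub_zero] at e2
      have hR0 : h R = 0 := by simp [hh]
      rw [hR0, mul_zero, zero_sub, intervalIntegral.integral_of_le hR.le,
        intervalIntegral.integral_of_le hR.le, integral_Ioc_eq_integral_Ioo,
        integral_Ioc_eq_integral_Ioo, ← e1] at e2
      have hφR : ∀ x, x ∉ Set.Ioo 0 R → φ x = 0 := fun x hx =>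
        image_eq_zero_of_notMem_tsupport fun hx' => hx (h3 hx')
      have e4 : ∫ r, φ r * (r ^ (n - 1) * p r - Q r)
          = ∫ r in Set.Ioo 0 R, φ r * (r ^ (n - 1) * p r - Q r) :=
        (setIntegral_eq_integral_of_forall_compl_eq_zero fun x hx => by
          rw [hφR x hx, zero_mul]).symm
      simp only [smul_eq_mul]
      rw [e4]
      obtain ⟨B, hB⟩ := h1.continuous.bounded_above_of_compact_support h2
      have i1 : Integrable (fun r => (r ^ (n - 1) * p r) * φ r) (volume.restrict (Set.Ioo 0 R)) :=
        Integrable.mul_bdd (c := B) hp h1.continuous.aestronglyMeasurable (Eventually.of_forall hB)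
      have i2 : Integrable (fun r => Q r * φ r) (volume.restrict (Set.Ioo 0 R)) :=
        Integrable.mul_bdd (c := B) (hQc.integrableOn_Icc.mono_set Set.Ioo_subset_Icc_self)
          h1.continuous.aestronglyMeasurable (Eventually.of_forall hB)
      have e5 : ∀ r, φ r * (r ^ (n - 1) * p r - Q r) = (r ^ (n - 1) * p r) * φ r - Q r * φ r :=
        fun r => by ring
      simp only [e5]
      rw [integral_sub i1 i2]
      have e6 : ∫ r in Set.Ioo 0 R, Q r * φ r
          = - ∫ r in Set.Ioo 0 R, (∫ s in (0 : ℝ)..r, k s * U s) * φ r := by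
        rw [← integral_neg]
        simp only [hQ, neg_mul]
      rw [e6, e2]
      ring
    filter_upwards [key] with r hr hr'
    linarith [hr hr']
  have hVU : ∀ r ∈ Set.Icc 0 R, Q r = - ∫ s in (0 : ℝ)..r, k s * V s := by
    intro r hr
    rw [hQ]
    simp only [neg_inj]
    rw [intervalIntegral.integral_of_le hr.1, intervalIntegral.integral_of_le hr.1,
      integral_Ioc_eq_integral_Ioo, integral_Ioc_eq_integral_Ioo]
    refine setIntegral_congr_ae measurableSet_Ioo ?_
    filter_upwards [hC] with s hs hs'
    rw [hs ⟨hs'.1, hs'.2.trans_le hr.2⟩]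
  -- Bootstrapping: the continuous representatives V and Q are primitives of expressions in each
  -- other, hence both are differentiable.
  have hVd : ∀ r ∈ Set.Ioo 0 R, HasDerivAt V (Q r / r ^ (n - 1)) r := by
    intro r hr
    have hc1 : ContinuousOn (fun r => Q r / r ^ (n - 1)) (Set.Ioo 0 R) :=
      (hQc.mono Set.Ioo_subset_Icc_self).div (by fun_prop) fun r hr => pow_ne_zero _ hr.1.ne'
    have hR2 : R / 2 ∈ Set.Ioo 0 R := ⟨by linarith, by linarith⟩
    have hss : ∀ t ∈ Set.Ioo 0 R, Set.uIcc (R / 2) t ⊆ Set.Ioo 0 R := fun t ht =>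
      Set.ordConnected_Ioo.uIcc_subset hR2 ht
    have heq : ∀ t ∈ Set.Ioo 0 R, V t = C + ∫ s in (R / 2)..t, Q s / s ^ (n - 1) := by
      intro t ht
      rw [hV]
      simp only [add_right_inj]
      refine intervalIntegral.integral_congr_ae ?_
      filter_upwards [hq] with s hs hs'
      have hs2 := hss t ht (Set.uIoc_subset_uIcc hs')
      rw [← hs hs2]
      have := pow_ne_zero (n - 1) hs2.1.ne'
      field_simp
    have hnear : V =ᶠ[𝓝 r] fun t => C + ∫ s in (R / 2)..t, Q s / s ^ (n - 1) := by
      filter_upwards [Ioo_mem_nhds hr.1 hr.2] with t ht using heq t ht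
    refine HasDerivAt.congr_of_eventuallyEq ?_ hnear
    refine HasDerivAt.const_add _ (intervalIntegral.integral_hasDerivAt_right
      ((hc1.mono (hss r hr)).intervalIntegrable) ?_ (hc1.continuousAt (Ioo_mem_nhds hr.1 hr.2)))
    exact hc1.stronglyMeasurableAtFilter isOpen_Ioo r hr
  have hQd : ∀ r ∈ Set.Ioo 0 R, HasDerivAt Q (-(κ * r ^ (n - 2) + E * r ^ (n - 1)) * V r) r := by
    intro r hr
    have hc1 : ContinuousOn (fun r => k r * V r) (Set.Ioo 0 R) := hkc.continuousOn.mul hVc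
    have hnear : Q =ᶠ[𝓝 r] fun t => - ∫ s in (0 : ℝ)..t, k s * V s := by
      filter_upwards [Ioo_mem_nhds hr.1 hr.2] with t ht using hVU t ⟨ht.1.le, ht.2.le⟩
    refine HasDerivAt.congr_of_eventuallyEq ?_ hnear
    have hi : IntervalIntegrable (fun r => k r * V r) volume 0 r := by
      refine (hkUi h0R ⟨hr.1.le, hr.2.le⟩).congr_ae ?_
      rw [Set.uIoc_of_le hr.1.le]
      filter_upwards [ae_restrict_mem measurableSet_Ioc, ae_restrict_of_ae hC] with s hs hs'
      rw [hs' ⟨hs.1, hs.2.trans_lt hr.2⟩]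
    have := (intervalIntegral.integral_hasDerivAt_right hi
      (hc1.stronglyMeasurableAtFilter isOpen_Ioo r hr)
      (hc1.continuousAt (Ioo_mem_nhds hr.1 hr.2))).neg
    refine this.congr_deriv ?_
    simp only [hk]
    ring
  have hQ0 : Tendsto Q (𝓝[>] 0) (𝓝 0) := by
    have h1 : Tendsto Q (𝓝[Set.Icc 0 R] 0) (𝓝 (Q 0)) := hQc 0 h0R
    have h2 : Q 0 = 0 := by simp [hQ]
    rw [h2] at h1
    refine h1.mono_left ?_
    rw [← nhdsWithin_Ioo_eq_nhdsGT hR]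
    exact nhdsWithin_mono _ Set.Ioo_subset_Icc_self
  -- Otherwise r^{n-2} |U| ≥ δ/r near 0, contradicting the integrability in `hU2`.
  have hV0 : ∀ δ > 0, ∃ᶠ r in 𝓝[>] 0, r ^ (n - 1) * |V r| < δ := by
    intro δ hδ hcon
    obtain ⟨η, hη, hη2⟩ := (mem_nhdsGT_iff_exists_Ioo_subset).1 hcon
    set ρ := min η R with hρ
    have hρ0 : 0 < ρ := lt_min hη hR
    have hI : IntegrableOn (fun r => r ^ (n - 2) * U r) (Set.Ioo 0 ρ) :=
      hU2.mono_set (Set.Ioo_subset_Ioo_right (min_le_right _ _))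
    have hbad : IntegrableOn (fun r : ℝ => r⁻¹) (Set.Ioo 0 ρ) := by
      refine Integrable.mono' (hI.norm.const_mul (1 / δ)) (by fun_prop) ?_
      filter_upwards [ae_restrict_mem measurableSet_Ioo, ae_restrict_of_ae hC] with r hr hr'
      have h1 := hη2 ⟨hr.1, hr.2.trans_le (min_le_left _ _)⟩
      have h2 : δ ≤ r ^ (n - 1) * |V r| := not_lt.1 h1
      rw [hr' ⟨hr.1, hr.2.trans_le (min_le_right _ _)⟩, Real.norm_eq_abs, Real.norm_eq_abs, abs_mul,
        abs_of_pos (pow_pos hr.1 _), abs_of_pos (inv_pos.2 hr.1)]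
      change r⁻¹ ≤ 1 / δ * (r ^ (n - 2) * |V r|)
      rw [hn1, pow_succ] at h2
      have hr0 := hr.1
      rw [inv_eq_one_div, div_mul_eq_mul_div, one_mul, div_le_div_iff₀ hr0 hδ]
      linarith
    have h3 : IntervalIntegrable (fun r : ℝ => r⁻¹) volume 0 ρ :=
      (intervalIntegrable_iff_integrableOn_Ioo_of_le hρ0.le).2 hbad
    rw [intervalIntegrable_inv_iff] at h3
    rcases h3 with h3 | h3
    · exact hρ0.ne h3
    · exact h3 Set.left_mem_uIcc
  obtain ⟨c, hc⟩ := radial_system_unique hn κ E hR hVd hQd hQ0 hV0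
  refine ⟨c, ?_⟩
  filter_upwards [hC] with r hr hr'
  rw [hr hr']
  exact (hc r hr').1

/-! ### Radial functions and spherical averages. -/

section RadialAE

variable {n : ℕ} (hn : 2 ≤ n) {R : ℝ}
include hn

/-- The predicate `P` need not be measurable, so the exceptional radii are enlarged to a measurable
null set before the preimage under the norm is taken. -/
theorem ae_ball_of_ae_radial {P : ℝ → Prop} (h : ∀ᵐ r ∂(volume.restrict (Set.Ioo 0 R)), P r) :
    ∀ᵐ x ∂(volume.restrict (B n R)), P ‖x‖ := by
  set T := toMeasurable (volume.restrict (Set.Ioo 0 R)) {r | ¬ P r} with hT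
  have hT0 : volume.restrict (Set.Ioo 0 R) T = 0 := by rw [hT, measure_toMeasurable]; exact h
  have h1 : ∀ᵐ r ∂(volume.restrict (Set.Ioo 0 R)), r ∉ T := measure_eq_zero_iff_ae_notMem.1 hT0
  have h2 : ∀ᵐ r ∂(radMeas n R), r ∉ T ∧ 0 ≤ r := by
    rw [ae_radMeas_iff]
    filter_upwards [h1, ae_restrict_mem measurableSet_Ioo] with r hr hr' using ⟨hr, hr'.1.le⟩
  have h3 : ∀ᵐ p ∂((sphMeas n).prod (radMeas n R)), p.2 ∉ T ∧ 0 ≤ p.2 :=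
    Measure.quasiMeasurePreserving_snd.ae h2
  have hm := polar_measurePreserving hn R
  have h4 : ∀ᵐ x ∂(volume.restrict (B n R)), ‖x‖ ∉ T := by
    have hTm : MeasurableSet {x : Eucl n | ‖x‖ ∉ T} :=
      (measurableSet_toMeasurable _ _).compl.preimage measurable_norm
    rw [← hm.map_eq, ae_map_iff hm.measurable.aemeasurable hTm]
    filter_upwards [h3] with p hp
    rw [norm_smul_sphere hp.2]
    exact hp.1
  filter_upwards [h4] with x hx
  by_contra hP
  exact hx (subset_toMeasurable _ _ hP)

theorem ae_radial_of_ae_ball {Q : Eucl n → Prop} (h : ∀ᵐ x ∂(volume.restrict (B n R)), Q x) :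
    ∀ᵐ r ∂(volume.restrict (Set.Ioo 0 R)), ∀ᵐ θ : Metric.sphere (0 : Eucl n) 1 ∂(sphMeas n),
      Q (r • (θ : Eucl n)) := by
  have h1 := (polar_measurePreserving hn R).quasiMeasurePreserving.ae h
  have h2 := (Measure.measurePreserving_swap (μ := radMeas n R)
    (ν := sphMeas n)).quasiMeasurePreserving.ae h1
  exact ae_radMeas_iff.1 (Measure.ae_ae_of_ae_prod h2)

/-- The profile in `IsRadialOn` is an arbitrary function. The spherical mean replaces it by one
whose measurability and integrability come from Fubini. -/
theorem ae_eq_sphere_average {u : Eucl n → ℝ} (hu : IsRadialOn (B n R) u) :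
    ∀ᵐ x ∂(volume.restrict (B n R)),
      u x = (∫ θ, u (‖x‖ • (θ : Eucl n)) ∂(sphMeas n)) / (sphMeas n).real Set.univ := by
  obtain ⟨f, hf⟩ := hu
  have hpos := sphMeas_real_univ_pos hn
  have h1 : ∀ᵐ r ∂(volume.restrict (Set.Ioo 0 R)),
      f r = (∫ θ, u (r • (θ : Eucl n)) ∂(sphMeas n)) / (sphMeas n).real Set.univ := by
    filter_upwards [ae_radial_of_ae_ball hn hf, ae_restrict_mem measurableSet_Ioo] with r hr hr'
    have : (fun θ : Metric.sphere (0 : Eucl n) 1 => u (r • (θ : Eucl n)))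
        =ᵐ[sphMeas n] fun _ => f r := by
      filter_upwards [hr] with θ hθ
      rw [hθ, norm_smul_sphere hr'.1.le]
    rw [integral_congr_ae this, integral_const, smul_eq_mul]
    field_simp
  filter_upwards [hf, ae_ball_of_ae_radial hn h1] with x hx hx'
  rw [hx, hx']

omit hn in
theorem integrable_mul_radial {f : Eucl n → ℝ} (hf : Integrable f (volume.restrict (B n R)))
    {w : ℝ → ℝ} (hw : Continuous w) :
    Integrable (fun x => f x * w ‖x‖) (volume.restrict (B n R)) := by
  obtain ⟨C, hC⟩ := (isCompact_Icc (a := (0 : ℝ)) (b := R)).exists_bound_of_continuousOn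
    hw.continuousOn
  refine Integrable.mul_bdd (c := C) hf (hw.comp continuous_norm).aestronglyMeasurable ?_
  filter_upwards [ae_restrict_mem measurableSet_ball] with x hx
  exact hC _ ⟨norm_nonneg _, (mem_ball_zero_iff.1 hx).le⟩

theorem integral_ball_mul_radial {f : Eucl n → ℝ} {w : ℝ → ℝ}
    (hf : Integrable (fun x => f x * w ‖x‖) (volume.restrict (B n R))) :
    ∫ x in B n R, f x * w ‖x‖
      = ∫ r in Set.Ioo 0 R, r ^ (n - 1) * ((∫ θ, f (r • (θ : Eucl n)) ∂(sphMeas n)) * w r) := by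
  rw [integral_ball_eq_radial hn hf]
  refine setIntegral_congr_fun measurableSet_Ioo fun r hr => ?_
  simp only [norm_smul_sphere hr.1.le]
  rw [integral_mul_const]

/-- The Coulomb term of the weak equation has to be integrable before it can be written in polar
coordinates. For radial u this reduces to the spherical mean, so no trace is needed. -/
theorem integrable_div_norm_of_radial {u : Eucl n → ℝ}
    (hu : AEStronglyMeasurable u (volume.restrict (B n R))) (hr : IsRadialOn (B n R) u)
    (hi : IntegrableOn (fun r => r ^ (n - 2) * ∫ θ, u (r • (θ : Eucl n)) ∂(sphMeas n))
      (Set.Ioo 0 R)) :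
    Integrable (fun x => u x / ‖x‖) (volume.restrict (B n R)) := by
  set U : ℝ → ℝ := fun r => ∫ θ, u (r • (θ : Eucl n)) ∂(sphMeas n) with hU
  set S := (sphMeas n).real Set.univ with hS
  have h1 : Integrable (fun r => U r / S / r) (radMeas n R) := by
    rw [integrable_radMeas_iff]
    refine Integrable.congr (hi.div_const S) ?_
    filter_upwards [ae_restrict_mem measurableSet_Ioo] with r hr
    have h := hr.1.ne'
    obtain ⟨m, rfl⟩ := Nat.exists_eq_add_of_le hn
    rw [show 2 + m - 1 = m + 1 by omega, show 2 + m - 2 = m by omega]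
    change r ^ m * U r / S = r ^ (m + 1) * (U r / S / r)
    field_simp
    ring
  have hm := polar_measurePreserving hn R
  have hmeas : AEStronglyMeasurable (fun x => u x / ‖x‖) (volume.restrict (B n R)) := by
    have : AEStronglyMeasurable (fun x : Eucl n => ‖x‖⁻¹) (volume.restrict (B n R)) :=
      (measurable_norm.inv).aestronglyMeasurable
    simp only [div_eq_mul_inv]
    exact hu.mul this
  rw [← hm.integrable_comp hmeas]
  have h2 : Integrable (fun p : Metric.sphere (0 : Eucl n) 1 × ℝ => U p.2 / S / p.2)
      ((sphMeas n).prod (radMeas n R)) := h1.comp_snd (sphMeas n)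
  refine h2.congr ?_
  have h3 := hm.quasiMeasurePreserving.ae (ae_eq_sphere_average hn hr)
  have h4 : ∀ᵐ r ∂(radMeas n R), 0 ≤ r := by
    rw [ae_radMeas_iff]
    filter_upwards [ae_restrict_mem measurableSet_Ioo] with r hr' using hr'.1.le
  filter_upwards [h3, Measure.quasiMeasurePreserving_snd.ae h4] with p hp hp'
  simp only [Function.comp_apply]
  rw [hp, norm_smul_sphere hp']

end RadialAE

/-! ### Radial test functions and reduction to the radial equation. -/

section SmoothRadial

variable {n : ℕ} {f : ℝ → ℝ} {a : ℝ}

/-- Constancy near 0 avoids the singularity of the norm at the origin. -/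
theorem contDiff_comp_norm (hf : ContDiff ℝ ∞ f) (ha : 0 < a) (h : ∀ r ≤ a, f r = f 0) :
    ContDiff ℝ ∞ fun x : Eucl n => f ‖x‖ := by
  rw [contDiff_iff_contDiffAt]
  intro x
  by_cases hx : x = 0
  · have : (fun x : Eucl n => f ‖x‖) =ᶠ[𝓝 x] fun _ => f 0 := by
      have : Metric.ball (0 : Eucl n) a ∈ 𝓝 x := by rw [hx]; exact Metric.ball_mem_nhds _ ha
      filter_upwards [this] with y hy using h _ (mem_ball_zero_iff.1 hy).le
    exact contDiffAt_const.congr_of_eventuallyEq this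
  · exact hf.contDiffAt.comp x (contDiffAt_norm ℝ hx)

theorem gradient_comp_norm (hf : ContDiff ℝ ∞ f) (ha : 0 < a) (h : ∀ r ≤ a, f r = f 0) (x : Eucl n) :
    gradient (fun x : Eucl n => f ‖x‖) x = radGrad f x := by
  refine HasGradientAt.gradient ?_
  by_cases hx : x = 0
  · have : (fun x : Eucl n => f ‖x‖) =ᶠ[𝓝 x] fun _ => f 0 := by
      have : Metric.ball (0 : Eucl n) a ∈ 𝓝 x := by rw [hx]; exact Metric.ball_mem_nhds _ ha
      filter_upwards [this] with y hy using h _ (mem_ball_zero_iff.1 hy).le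
    have h0 : radGrad f x = 0 := by simp [radGrad, hx]
    rw [h0]
    exact (hasGradientAt_const x (f 0)).congr_of_eventuallyEq this
  · have h1 : HasFDerivAt (fun y : Eucl n => ‖y‖ ^ 2) (2 • innerSL ℝ x) x :=
      (hasStrictFDerivAt_norm_sq x).hasFDerivAt
    have hn0 : ‖x‖ ≠ 0 := norm_ne_zero_iff.2 hx
    have h2 := (h1.sqrt (pow_ne_zero 2 hn0))
    have h3 : HasDerivAt f (deriv f ‖x‖) √(‖x‖ ^ 2) := by
      rw [Real.sqrt_sq (norm_nonneg _)]
      exact (hf.differentiable (by simp) _).hasDerivAt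
    have h4 := h3.comp_hasFDerivAt x h2
    rw [hasGradientAt_iff_hasFDerivAt]
    refine (h4.congr_of_eventuallyEq (Eventually.of_forall fun y => ?_)).congr_fderiv ?_
    · simp
    · ext v
      simp [radGrad, Real.sqrt_sq (norm_nonneg x)]
      field_simp

theorem tsupport_comp_norm_subset {b : ℝ} (h : ∀ r ≥ b, f r = 0) :
    tsupport (fun x : Eucl n => f ‖x‖) ⊆ Metric.closedBall 0 b := by
  refine closure_minimal (fun x hx => ?_) Metric.isClosed_closedBall
  rw [mem_closedBall_zero_iff]
  by_contra hb
  exact hx (h _ (not_le.1 hb).le)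

theorem hasCompactSupport_comp_norm {b : ℝ} (h : ∀ r ≥ b, f r = 0) :
    HasCompactSupport (fun x : Eucl n => f ‖x‖) :=
  (isCompact_closedBall (0 : Eucl n) b).of_isClosed_subset (isClosed_tsupport _)
    (tsupport_comp_norm_subset h)

end SmoothRadial

theorem gradient_mul_inner {n : ℕ} {χ : Eucl n → ℝ} (hχ : ContDiff ℝ ∞ χ) (e x : Eucl n) :
    gradient (fun x => χ x * inner ℝ x e) x = inner ℝ x e • gradient χ x + χ x • e := by
  refine HasGradientAt.gradient ?_
  rw [hasGradientAt_iff_hasFDerivAt]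
  have h1 : HasFDerivAt χ (fderiv ℝ χ x) x := (hχ.differentiable (by simp) x).hasFDerivAt
  have h2 : HasFDerivAt (fun x : Eucl n => inner ℝ x e) (innerSL ℝ e) x := by
    refine (innerSL ℝ e).hasFDerivAt.congr_of_eventuallyEq (Eventually.of_forall fun y => ?_)
    simp [real_inner_comm]
  refine (h1.mul h2).congr_fderiv ?_
  ext v
  have h3 : inner ℝ (gradient χ x) v = fderiv ℝ χ x v := by
    simp [gradient, InnerProductSpace.toDual_symm_apply]
  simp
  ring

/-- The weak gradient tested with the vector field `χ x`. -/
theorem IsWeakGradient.integral_div_smul_id {n : ℕ} {R : ℝ} {u : Eucl n → ℝ} {G : Eucl n → Eucl n}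
    (hu : MemLp u 2 (volume.restrict (B n R))) (hG : MemLp G 2 (volume.restrict (B n R)))
    (h : IsWeakGradient (B n R) u G) {χ : Eucl n → ℝ} (h1 : ContDiff ℝ ∞ χ)
    (h2 : HasCompactSupport χ) (h3 : tsupport χ ⊆ B n R) :
    ∫ x in B n R, u x * (inner ℝ (gradient χ x) x + n * χ x)
      = - ∫ x in B n R, χ x * inner ℝ (G x) x := by
  set b := EuclideanSpace.basisFun (Fin n) ℝ with hb
  have : IsFiniteMeasure (volume.restrict (B n R)) := ⟨by simp [measure_ball_lt_top]⟩
  have hui : Integrable u (volume.restrict (B n R)) := hu.integrable one_le_two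
  have hGi : Integrable G (volume.restrict (B n R)) := hG.integrable one_le_two
  have hc := h1.continuous
  have hgc := continuous_gradient h1
  have bd : ∀ w : Eucl n → ℝ, Continuous w → Integrable (fun x => u x * w x) (volume.restrict (B n R)) :=
    fun w hw => hu.integrable_mul_of_two (memLp_ball_of_continuous hw R 2)
  -- The weak gradient is tested with χ xᵢ and its i-th component is taken. The sum over i assembles
  -- the divergence of χ x on the left.
  have key : ∀ i, ∫ x in B n R, u x * (inner ℝ x (b i) * inner ℝ (b i) (gradient χ x) + χ x)
      = - ∫ x in B n R, χ x * (inner ℝ (G x) (b i) * inner ℝ (b i) x) := by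
    intro i
    have hψ : ContDiff ℝ ∞ fun x : Eucl n => χ x * inner ℝ x (b i) :=
      h1.mul (contDiff_id.inner ℝ contDiff_const)
    have e := h _ hψ h2.mul_right ((tsupport_mul_subset_left).trans h3)
    have hgψ := continuous_gradient hψ
    have i1 : Integrable (fun x => u x • gradient (fun x : Eucl n => χ x * inner ℝ x (b i)) x)
        (volume.restrict (B n R)) := by
      have hm := memLp_ball_of_continuous hgψ R 2
      exact memLp_one_iff_integrable.1 (hm.smul (p := 2) (q := 2) (r := 1) hu)
    have i2 : Integrable (fun x => (χ x * inner ℝ x (b i)) • G x) (volume.restrict (B n R)) := by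
      have hm : MemLp (fun x => χ x * inner ℝ x (b i)) 2 (volume.restrict (B n R)) :=
        memLp_ball_of_continuous hψ.continuous R 2
      exact memLp_one_iff_integrable.1 (hG.smul (p := 2) (q := 2) (r := 1) hm)
    have e' := congrArg (fun v => inner ℝ (b i) v) e
    simp only [inner_neg_right] at e'
    rw [← integral_inner i1, ← integral_inner i2] at e'
    have e1 : ∀ x, u x * (inner ℝ x (b i) * inner ℝ (b i) (gradient χ x) + χ x)
        = inner ℝ (b i) (u x • gradient (fun x : Eucl n => χ x * inner ℝ x (b i)) x) := by
      intro x
      rw [gradient_mul_inner h1]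
      simp only [inner_smul_right, inner_add_right]
      rw [b.inner_eq_one i]
      ring
    have e2 : ∀ x, χ x * (inner ℝ (G x) (b i) * inner ℝ (b i) x)
        = inner ℝ (b i) ((χ x * inner ℝ x (b i)) • G x) := by
      intro x
      rw [inner_smul_right, real_inner_comm (b i) (G x), real_inner_comm (b i) x]
      ring
    simp only [e1, e2]
    exact e'
  have hsum := Finset.sum_congr (rfl : (Finset.univ : Finset (Fin n)) = Finset.univ)
    fun i _ => key i
  rw [Finset.sum_neg_distrib, ← integral_finsetSum _ fun i _ => bd _ (by fun_prop),
    ← integral_finsetSum] at hsum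
  · have e1 : ∀ x, ∑ i, u x * (inner ℝ x (b i) * inner ℝ (b i) (gradient χ x) + χ x)
        = u x * (inner ℝ (gradient χ x) x + n * χ x) := by
      intro x
      rw [← Finset.mul_sum, Finset.sum_add_distrib, b.sum_inner_mul_inner x (gradient χ x),
        real_inner_comm]
      simp
    have e2 : ∀ x, ∑ i, χ x * (inner ℝ (G x) (b i) * inner ℝ (b i) x) = χ x * inner ℝ (G x) x := by
      intro x
      rw [← Finset.mul_sum, b.sum_inner_mul_inner (G x) x]
    simp only [e1, e2] at hsum
    exact hsum
  · intro i _
    have hm : MemLp (fun x => χ x * inner ℝ (b i) x) 2 (volume.restrict (B n R)) :=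
      memLp_ball_of_continuous (by fun_prop) R 2
    have := (hG.inner_const (b i)).integrable_mul_of_two hm
    refine this.congr (Eventually.of_forall fun x => ?_)
    simp only
    ring

/-- A radial weak solution in a ball is a multiple of the regular solution. -/
theorem exists_eq_regSol_of_weak {n : ℕ} (hn : 2 ≤ n) (κ E : ℝ) {R : ℝ} (hR : 0 < R)
    {u : Eucl n → ℝ} {G : Eucl n → Eucl n} (hu : MemLp u 2 (volume.restrict (B n R)))
    (hG : MemLp G 2 (volume.restrict (B n R))) (hwg : IsWeakGradient (B n R) u G)
    (hrad : IsRadialOn (B n R) u)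
    (hs : ∀ ψ : Eucl n → ℝ, ContDiff ℝ ∞ ψ → HasCompactSupport ψ → tsupport ψ ⊆ B n R →
      schroForm (B n R) κ E u G ψ (gradient ψ) = 0) :
    ∃ c, ∀ᵐ x ∂(volume.restrict (B n R)), u x = c * regSol n κ E ‖x‖ := by
  have hn1 : n - 1 = n - 2 + 1 := by omega
  have : IsFiniteMeasure (volume.restrict (B n R)) := ⟨by simp [measure_ball_lt_top]⟩
  have hui : Integrable u (volume.restrict (B n R)) := hu.integrable one_le_two
  have hGi : Integrable G (volume.restrict (B n R)) := hG.integrable one_le_two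
  -- This is the weak radial derivative of u; p below is its spherical mean and plays the role of
  -- U'.
  set g : Eucl n → ℝ := fun x => inner ℝ (G x) (‖x‖⁻¹ • x) with hg
  have hgi : Integrable g (volume.restrict (B n R)) := by
    refine hGi.mono (hGi.1.inner ((measurable_norm.inv).smul measurable_id).aestronglyMeasurable)
      (Eventually.of_forall fun x => ?_)
    refine (norm_inner_le_norm _ _).trans ?_
    have : ‖‖x‖⁻¹ • x‖ ≤ 1 := by
      rw [norm_smul, norm_inv, norm_norm]
      exact inv_mul_le_one
    exact mul_le_of_le_one_right (norm_nonneg _) this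
  set U : ℝ → ℝ := fun r => ∫ θ, u (r • (θ : Eucl n)) ∂(sphMeas n) with hU
  set p : ℝ → ℝ := fun r => ∫ θ, g (r • (θ : Eucl n)) ∂(sphMeas n) with hp
  have hUi := integrable_sphere_average hn hui
  have hpi := integrable_sphere_average hn hgi
  have hw : ∀ φ : ℝ → ℝ, ContDiff ℝ ∞ φ → HasCompactSupport φ → tsupport φ ⊆ Set.Ioo 0 R →
      ∫ r in Set.Ioo 0 R, U r * deriv φ r = - ∫ r in Set.Ioo 0 R, p r * φ r := by
    intro φ h1 h2 h3
    obtain ⟨a, b, ha, hab, hbR, hsub⟩ := h2.isCompact.exists_subset_Icc_of_subset_Ioo hR h3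
    have hφ0 : ∀ r, r ∉ Set.Icc a b → φ r = 0 := fun r hr =>
      image_eq_zero_of_notMem_tsupport fun hr' => hr (hsub hr')
    -- For the field k(‖x‖) x one has r^{n-1} div = (rⁿ k)' = φ', so the weak gradient of u yields
    -- the weak derivative of U.
    set k : ℝ → ℝ := fun r => φ r * (r ^ n)⁻¹ with hk
    have hk0 : ∀ r, r < a → k r = 0 := fun r hr => by
      rw [hk]; simp only; rw [hφ0 r fun h => absurd h.1 (not_le.2 hr), zero_mul]
    have hkb : ∀ r ≥ (b + R) / 2, k r = 0 := fun r hr => by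
      rw [hk]; simp only
      rw [hφ0 r fun h => by linarith [h.2], zero_mul]
    have hks : ContDiff ℝ ∞ k := by
      rw [contDiff_iff_contDiffAt]
      intro r
      rcases lt_or_ge r a with hr | hr
      · refine contDiffAt_const (c := (0 : ℝ)) |>.congr_of_eventuallyEq ?_
        filter_upwards [Iio_mem_nhds hr] with s hs using hk0 s hs
      · exact h1.contDiffAt.mul (ContDiffAt.inv (by fun_prop) (pow_ne_zero _ (ha.trans_le hr).ne'))
    have hka : ∀ r ≤ a / 2, k r = k 0 := fun r hr => by
      rw [hk0 r (by linarith), hk0 0 ha]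
    have hχ := contDiff_comp_norm (n := n) hks (half_pos ha) hka
    have hdiv := hwg.integral_div_smul_id hu hG hχ (hasCompactSupport_comp_norm hkb)
      ((tsupport_comp_norm_subset hkb).trans (Metric.closedBall_subset_ball (by linarith)))
    have hkd := continuous_deriv_of_contDiff hks
    have hkc := hks.continuous
    have e1 : ∀ x : Eucl n, inner ℝ (gradient (fun x : Eucl n => k ‖x‖) x) x + n * k ‖x‖
        = (fun r => r * deriv k r + n * k r) ‖x‖ := by
      intro x
      rw [gradient_comp_norm hks (half_pos ha) hka, inner_radGrad, real_inner_self_eq_norm_sq]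
      simp only
      by_cases hx : ‖x‖ = 0
      · simp [hx]
      · field_simp
    have e2 : ∀ x : Eucl n, k ‖x‖ * inner ℝ (G x) x = g x * (fun r => r * k r) ‖x‖ := by
      intro x
      simp only [hg, inner_smul_right]
      by_cases hx : ‖x‖ = 0
      · simp [norm_eq_zero.1 hx]
      · field_simp
    simp only [e1, e2] at hdiv
    have c1 : Continuous fun r => r * deriv k r + n * k r := by fun_prop
    have c2 : Continuous fun r => r * k r := by fun_prop
    rw [integral_ball_mul_radial hn (w := fun r => r * deriv k r + n * k r)
        (integrable_mul_radial hui c1),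
      integral_ball_mul_radial hn (w := fun r => r * k r) (integrable_mul_radial hgi c2)] at hdiv
    change ∫ r in Set.Ioo 0 R, r ^ (n - 1) * (U r * (r * deriv k r + n * k r))
      = - ∫ r in Set.Ioo 0 R, r ^ (n - 1) * (p r * (r * k r)) at hdiv
    convert hdiv using 1
    · refine setIntegral_congr_fun measurableSet_Ioo fun r hr => ?_
      have hr0 := hr.1.ne'
      have hd : deriv φ r = n * r ^ (n - 1) * k r + r ^ n * deriv k r := by
        have hd1 : HasDerivAt (fun r => r ^ n * k r) (n * r ^ (n - 1) * k r + r ^ n * deriv k r) r :=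
          (hasDerivAt_pow n r).mul (hks.differentiable (by simp) r).hasDerivAt
        refine (hd1.congr_of_eventuallyEq ?_).deriv
        filter_upwards [Ioi_mem_nhds hr.1] with s hs
        have : s ^ n ≠ 0 := pow_ne_zero _ (ne_of_gt hs)
        simp only [hk]
        field_simp
      rw [hd]
      have : r ^ n = r ^ (n - 1) * r := by rw [← pow_succ]; congr 1; omega
      rw [this]
      ring
    · congr 1
      refine setIntegral_congr_fun measurableSet_Ioo fun r hr => ?_
      have hr0 := hr.1.ne'
      simp only [hk]
      have : r ^ n = r ^ (n - 1) * r := by rw [← pow_succ]; congr 1; omega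
      rw [this]
      field_simp
  have hU2 : IntegrableOn (fun r => r ^ (n - 2) * U r) (Set.Ioo 0 R) :=
    integrableOn_pow_mul_of_weak_deriv hR (locallyIntegrableOn_of_pow_mul hUi) (hn1 ▸ hpi) hw
  have hud := integrable_div_norm_of_radial hn hui.1 hrad hU2
  -- The weak equation for the flux is the original one tested with h(‖x‖), where h is constant near
  -- 0 and vanishes near R.
  obtain ⟨c, hc⟩ := exists_ae_eq_regSol hn κ E hR hUi hpi hw (fun h h1 a b ha hab hbR h2 h3 => by
    have hψ := contDiff_comp_norm (n := n) h1 ha h2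
    have e := hs _ hψ (hasCompactSupport_comp_norm h3)
      ((tsupport_comp_norm_subset h3).trans (Metric.closedBall_subset_ball hbR))
    unfold schroForm at e
    have e1 : ∀ x : Eucl n, inner ℝ (G x) (gradient (fun x : Eucl n => h ‖x‖) x)
        = g x * deriv h ‖x‖ := by
      intro x
      rw [gradient_comp_norm h1 ha h2]
      simp only [hg, radGrad, inner_smul_right]
      ring
    have e2 : ∀ x : Eucl n, u x * h ‖x‖ / ‖x‖ = u x / ‖x‖ * h ‖x‖ := fun x => by ring
    have e3 : ∀ x : Eucl n, u x / ‖x‖ * h ‖x‖ = u x * (fun r => h r / r) ‖x‖ := fun x => by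
      simp only; ring
    have hhd := continuous_deriv_of_contDiff h1
    have i2 := integrable_mul_radial hud h1.continuous
    simp only [e3] at i2
    have i3 := integrable_mul_radial hui h1.continuous
    have j2 := integrable_sphere_average hn i2
    have j3 := integrable_sphere_average hn i3
    simp only [e1, e2, e3] at e
    rw [integral_ball_mul_radial hn (integrable_mul_radial hgi hhd),
      integral_ball_mul_radial hn (w := fun r => h r / r) i2, integral_ball_mul_radial hn i3] at e
    have k2 : IntegrableOn (fun r => r ^ (n - 1) * (U r * (h r / r))) (Set.Ioo 0 R) := by
      refine Integrable.congr j2 ?_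
      filter_upwards [ae_restrict_mem measurableSet_Ioo] with r hr
      simp only [norm_smul_sphere hr.1.le]
      rw [integral_mul_const]
    have k3 : IntegrableOn (fun r => r ^ (n - 1) * (U r * h r)) (Set.Ioo 0 R) := by
      refine Integrable.congr j3 ?_
      filter_upwards [ae_restrict_mem measurableSet_Ioo] with r hr
      simp only [norm_smul_sphere hr.1.le]
      rw [integral_mul_const]
    rw [sub_sub, sub_eq_zero, ← integral_const_mul, ← integral_const_mul,
      ← integral_add (k2.const_mul κ) (k3.const_mul E)] at e
    calc _ = ∫ r in Set.Ioo 0 R, r ^ (n - 1) * (p r * deriv h r) := by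
          simp only [hp, mul_assoc]
      _ = _ := e
      _ = _ := by
        refine setIntegral_congr_fun measurableSet_Ioo fun r hr => ?_
        have hr0 := hr.1.ne'
        change κ * (r ^ (n - 1) * (U r * (h r / r))) + E * (r ^ (n - 1) * (U r * h r))
          = (κ * r ^ (n - 2) + E * r ^ (n - 1)) * U r * h r
        rw [hn1, pow_succ]
        field_simp)
  refine ⟨c / (sphMeas n).real Set.univ, ?_⟩
  have hc' : ∀ᵐ r ∂(volume.restrict (Set.Ioo 0 R)), U r = c * regSol n κ E r := by
    filter_upwards [ae_restrict_mem measurableSet_Ioo, ae_restrict_of_ae hc] with r hr hr'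
      using hr' hr
  filter_upwards [ae_eq_sphere_average hn hrad, ae_ball_of_ae_radial hn hc'] with x hx hx'
  rw [hx]
  change U ‖x‖ / _ = _
  rw [hx']
  ring

theorem deriv_const_mul_regSol {n : ℕ} (hn : 2 ≤ n) (κ E c r : ℝ) :
    deriv (fun r => c * regSol n κ E r) r = c * regSol' n κ E r :=
  ((hasDerivAt_regSol hn κ E r).const_mul c).deriv

theorem not_ae_zero_regSol {n : ℕ} (hn : 2 ≤ n) (κ E : ℝ) {c R : ℝ} (hc : c ≠ 0) (hR : 0 < R) :
    ¬ (fun x : Eucl n => c * regSol n κ E ‖x‖) =ᵐ[volume.restrict (B n R)] 0 := by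
  intro h
  have hcont := continuous_regSol hn κ E
  have h0 := Measure.eqOn_open_of_ae_eq h Metric.isOpen_ball
    (Continuous.continuousOn (by fun_prop)) continuousOn_const (Metric.mem_ball_self hR)
  simp only [norm_zero, regSol_zero, mul_one, Pi.zero_apply] at h0
  exact hc h0

theorem ae_surf_eq_zero_of_tsupport {n : ℕ} {R : ℝ} (hR : 0 ≤ R) {ψ : Eucl n → ℝ}
    (h : tsupport ψ ⊆ B n R) : ψ =ᵐ[surf n R] 0 := by
  filter_upwards [ae_surf_norm_eq hR] with x hx
  refine image_eq_zero_of_notMem_tsupport fun hx' => ?_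
  have := mem_ball_zero_iff.1 (h hx')
  exact absurd this (by rw [hx]; exact lt_irrefl _)

/-! ### Gradient and average trace of a multiple of the regular solution. -/

section Identify

variable {n : ℕ} (hn : 2 ≤ n) {κ E R c : ℝ} (hR : 0 < R) {u : Eucl n → ℝ} {G : Eucl n → Eucl n}
  {g : Eucl n → ℝ} (h : IsH1Ball R u G g)
  (hu : ∀ᵐ x ∂(volume.restrict (B n R)), u x = c * regSol n κ E ‖x‖)
include hn h hu

theorem IsH1Ball.gradient_eq_radGrad (hR : 0 ≤ R) :
    G =ᵐ[volume.restrict (B n R)] radGrad fun r => c * regSol n κ E r := by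
  have h2 := isH1Ball_radial (n := n) (isProfile_regSol hn κ E c).contDiff hR
  refine IsWeakGradient.unique Metric.isOpen_ball
    (h.1.2.2.congr hu (EventuallyEq.refl _ _)) h2.1.2.2
    (locallyIntegrableOn_of_memLp h.1.2.1) (locallyIntegrableOn_of_memLp h2.1.2.1)

include hR in
theorem IsH1Ball.integral_trace_eq :
    ∫ x, g x ∂(surf n R) = (surf n R).real Set.univ * (c * regSol n κ E R) := by
  have hG := h.gradient_eq_radGrad hn hu hR.le
  have h2 := isH1Ball_radial (n := n) (isProfile_regSol hn κ E c).contDiff hR.le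
  rw [trace_average_unique hn hR (h.congr hu hG) h2, integral_const, smul_eq_mul]

end Identify

/-! ### Radial weak eigenfunctions and the boundary condition. -/

section BallEigenfunctions

variable {n : ℕ} (hn : 2 ≤ n) {κ R : ℝ} {γ : WithTop ℝ} (hR : 0 < R) {E : ℝ} {u : Eucl n → ℝ}
include hn hR

/-- Test functions supported inside the ball already give u = c f(‖x‖). For finite γ, the test
function 1 and Green's formula then give |∂B(R)| c (f'(R) + γ f(R)) = 0. For γ = ∞ the average
trace, c f(R), vanishes. -/
theorem IsEigenfunctionBall.exists_eq_regSol (h : IsEigenfunctionBall κ γ R E u)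
    (hr : IsRadialOn (B n R) u) : BdryCond n κ γ R E ∧
      ∃ c : ℝ, c ≠ 0 ∧ ∀ᵐ x ∂(volume.restrict (B n R)), u x = c * regSol n κ E ‖x‖ := by
  obtain ⟨hu0, G, g, hH, hw⟩ := h
  have key : ∃ c : ℝ, ∀ᵐ x ∂(volume.restrict (B n R)), u x = c * regSol n κ E ‖x‖ := by
    refine exists_eq_regSol_of_weak hn κ E hR hH.1.1 hH.1.2.1 hH.1.2.2 hr fun ψ h1 h2 h3 => ?_
    have hψ0 := ae_surf_eq_zero_of_tsupport hR.le h3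
    have hψ := isH1Ball_of_contDiff h1 hR.le
    induction γ using WithTop.recTopCoe with
    | top => exact hw.2 ψ _ _ hψ hψ0
    | coe a =>
      have := hw ψ _ _ hψ
      rwa [integral_eq_zero_of_ae, mul_zero, add_zero] at this
      filter_upwards [hψ0] with x hx
      simp [hx]
  obtain ⟨c, hc⟩ := key
  have hc0 : c ≠ 0 := by
    rintro rfl
    refine hu0 ?_
    filter_upwards [hc] with x hx
    simp [hx]
  refine ⟨?_, c, hc0, hc⟩
  have hS := surf_real_univ_pos hn hR
  have hG := hH.gradient_eq_radGrad hn hc hR.le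
  have ht := hH.integral_trace_eq hn hR hc
  induction γ using WithTop.recTopCoe with
  | top =>
    rw [integral_eq_zero_of_ae hw.1] at ht
    have h0 : c * regSol n κ E R = 0 := (mul_eq_zero.1 ht.symm).resolve_left hS.ne'
    exact (mul_eq_zero.1 h0).resolve_left hc0
  | coe a =>
    have h1 := isH1Ball_of_contDiff (n := n) (f := fun _ => (1 : ℝ)) contDiff_const hR.le
    have e := hw _ _ _ h1
    rw [schroForm_congr hc hG, schroForm_profile hn (isProfile_regSol hn κ E c) hR.le h1] at e
    simp only [mul_one, integral_const, smul_eq_mul] at e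
    rw [ht, deriv_const_mul_regSol hn] at e
    have e2 : (surf n R).real Set.univ * c * (regSol' n κ E R + a * regSol n κ E R) = 0 := by
      rw [← e]; ring
    exact (mul_eq_zero.1 e2).resolve_left (mul_ne_zero hS.ne' hc0)

/-- Green's formula gives c f'(R) ∫ h for every H¹ function with trace h. This cancels the Robin
term, or vanishes when h = 0. -/
theorem isEigenfunctionBall_of_eq_regSol (hb : BdryCond n κ γ R E) {c : ℝ} (hc0 : c ≠ 0)
    (hc : ∀ᵐ x ∂(volume.restrict (B n R)), u x = c * regSol n κ E ‖x‖) :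
    IsEigenfunctionBall κ γ R E u ∧ IsRadialOn (B n R) u := by
  have hP := isProfile_regSol hn κ E c
  have hc' : (fun x : Eucl n => c * regSol n κ E ‖x‖) =ᵐ[volume.restrict (B n R)] u := by
    filter_upwards [hc] with x hx using hx.symm
  have hH := (isH1Ball_radial (n := n) hP.contDiff hR.le).congr hc' (EventuallyEq.refl _ _)
  refine ⟨⟨fun h0 => not_ae_zero_regSol hn κ E hc0 hR (hc'.trans h0), _, _, hH, ?_⟩, fun r => c * regSol n κ E r, hc⟩
  have hform := fun (ψ : Eucl n → ℝ) (H : Eucl n → Eucl n) (h : Eucl n → ℝ) (hψ : IsH1Ball R ψ H h) =>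
    (schroForm_congr (κ := κ) (E := E) hc (EventuallyEq.refl _ (radGrad fun r => c * regSol n κ E r))
      ψ H).trans (schroForm_profile hn hP hR.le hψ)
  induction γ using WithTop.recTopCoe with
  | top =>
    have hb' : regSol n κ E R = 0 := hb
    refine ⟨Eventually.of_forall fun x => by simp [hb'], fun ψ H h hψ h0 => ?_⟩
    rw [hform ψ H h hψ, integral_eq_zero_of_ae h0, mul_zero]
  | coe a =>
    have hb' : regSol' n κ E R + a * regSol n κ E R = 0 := hb
    intro ψ H h hψ
    rw [hform ψ H h hψ, deriv_const_mul_regSol hn, integral_const_mul]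
    linear_combination (c * ∫ x, h x ∂(surf n R)) * hb'

end BallEigenfunctions

/-! ### Energies, the parameter z, and the two choices of σ. -/

section Parameters

theorem sqrt_abs_of_neg {κ z E : ℝ} (hκ : 0 < κ) (hz : 0 < z) (hE : E = -κ ^ 2 / (4 * z ^ 2)) :
    √|E| = κ / (2 * z) := by
  have : |E| = (κ / (2 * z)) ^ 2 := by
    rw [hE, neg_div, abs_neg, abs_of_nonneg (by positivity)]
    ring
  rw [this, Real.sqrt_sq (by positivity)]

theorem two_mul_sqrt_mul_of_neg {κ z E : ℝ} (hκ : 0 < κ) (hz : 0 < z)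
    (hE : E = -κ ^ 2 / (4 * z ^ 2)) : 2 * √|E| * z = κ ∧ √|E| ^ 2 = -E := by
  rw [sqrt_abs_of_neg hκ hz hE, hE]
  constructor <;> field_simp
  ring

theorem two_mul_sqrt_mul_of_pos {κ z E : ℝ} (hκ : 0 < κ) (hz : 0 < z)
    (hE : E = κ ^ 2 / (4 * z ^ 2)) : 2 * √|E| * z = κ ∧ √|E| ^ 2 = E := by
  have : √|E| = κ / (2 * z) := by
    rw [← abs_neg, sqrt_abs_of_neg hκ hz]
    rw [hE]; ring
  rw [this, hE]
  constructor <;> field_simp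
  ring

theorem exists_parameter {κ e : ℝ} (hκ : 0 < κ) (he : 0 < e) :
    ∃ z, 0 < z ∧ e = κ ^ 2 / (4 * z ^ 2) := by
  have hs := Real.sqrt_pos.2 he
  refine ⟨κ / (2 * √e), by positivity, ?_⟩
  have := Real.sq_sqrt he.le
  field_simp
  nlinarith

variable {n : ℕ} (hn : 2 ≤ n) {κ z E : ℝ}

theorem kummerM_mul_exp_real (hn : 2 ≤ n) (hz : 2 * √|E| * z = κ) (hE : √|E| ^ 2 = -E) {r : ℝ}
    (hr : 0 ≤ r) : kummerM (a₀ n z) (b₀ ℝ n) (2 * √|E| * r) * Real.exp (-(√|E| * r))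
      = regSol n κ E r := by
  have := (kummerM_mul_exp_eq_regSol hn κ E (𝕂 := ℝ) (ex := Real.exp) Real.hasDerivAt_exp
    Real.exp_zero (z := z) (σ := √|E|) (by simpa using hz) (by simpa using hE) hr).1
  simpa using this

theorem transEq_real_iff (hn : 2 ≤ n) (hκ : κ ≠ 0) (γ : WithTop ℝ) (hz : 2 * √|E| * z = κ)
    (hE : √|E| ^ 2 = -E) {R : ℝ} (hR : 0 ≤ R) : TransEq n κ γ R z ↔ BdryCond n κ γ R E :=
  transEq_iff_bdryCond hn hκ γ E (𝕂 := ℝ) (ex := Real.exp) Real.hasDerivAt_exp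
    Real.exp_zero Real.exp_ne_zero (z := z) (σ := √|E|) (by simpa using hz) (by simpa using hE) hR

/-- With σ = i√|E| and parameter -iz the factors i cancel: 2σ(-iz) = 2√|E| z = κ, while σ² = -E. -/
theorem kummerM_mul_exp_complex (hn : 2 ≤ n) (hz : 2 * √|E| * z = κ) (hE : √|E| ^ 2 = E) {r : ℝ}
    (hr : 0 ≤ r) : kummerM (a₀ n (-Complex.I * (z : ℂ))) (b₀ ℂ n)
        (2 * (Complex.I * (√|E| : ℝ)) * (r : ℝ)) * Complex.exp (-(Complex.I * (√|E| : ℝ) * (r : ℝ)))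
      = (regSol n κ E r : ℂ) := by
  refine (kummerM_mul_exp_eq_regSol hn κ E (𝕂 := ℂ) (ex := Complex.exp) Complex.hasDerivAt_exp
    Complex.exp_zero (z := -Complex.I * (z : ℂ)) (σ := Complex.I * (√|E| : ℝ)) ?_ ?_ hr).1
  · have : ((2 * √|E| * z : ℝ) : ℂ) = κ := by rw [hz]
    push_cast at this
    linear_combination this - (2 * √|E| * z : ℂ) * Complex.I_mul_I
  · have : ((√|E| ^ 2 : ℝ) : ℂ) = E := by rw [hE]
    push_cast at this
    linear_combination -this + (√|E| : ℂ) ^ 2 * Complex.I_mul_I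

theorem transEq_complex_iff (hn : 2 ≤ n) (hκ : κ ≠ 0) (γ : WithTop ℝ) (hz : 2 * √|E| * z = κ)
    (hE : √|E| ^ 2 = E) {R : ℝ} (hR : 0 ≤ R) :
    TransEq n κ γ R (-Complex.I * (z : ℂ)) ↔ BdryCond n κ γ R E := by
  refine transEq_iff_bdryCond hn hκ γ E (𝕂 := ℂ) (ex := Complex.exp) Complex.hasDerivAt_exp
    Complex.exp_zero Complex.exp_ne_zero (σ := Complex.I * (√|E| : ℝ)) ?_ ?_ hR
  · have : ((2 * √|E| * z : ℝ) : ℂ) = κ := by rw [hz]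
    push_cast at this
    linear_combination this - (2 * √|E| * z : ℂ) * Complex.I_mul_I
  · have : ((√|E| ^ 2 : ℝ) : ℂ) = E := by rw [hE]
    push_cast at this
    linear_combination -this + (√|E| : ℂ) ^ 2 * Complex.I_mul_I

end Parameters

/-! ### Characterisation of the radial eigenfunctions on balls. -/

theorem radial_eigenfunction_neg_iff {n : ℕ} (hn : 2 ≤ n) {κ : ℝ} (hκ : 0 < κ) (γ : WithTop ℝ)
    {R : ℝ} (hR : 0 < R) {E : ℝ} (hE : E < 0) (u : Eucl n → ℝ) :
    (IsEigenfunctionBall κ γ R E u ∧ IsRadialOn (B n R) u) ↔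
        ∃ z : ℝ, 0 < z ∧ E = -κ ^ 2 / (4 * z ^ 2) ∧ TransEq n κ γ R z ∧
          ∃ c : ℝ, c ≠ 0 ∧ ∀ᵐ x ∂(volume.restrict (B n R)),
            u x = c * (kummerM (a₀ n z) (b₀ ℝ n) (2 * √|E| * ‖x‖) * Real.exp (-(√|E| * ‖x‖))) := by
  constructor
  · rintro ⟨h1, h2⟩
    obtain ⟨hb, c, hc0, hc⟩ := h1.exists_eq_regSol hn hR h2
    obtain ⟨z, hz, hzE⟩ := exists_parameter hκ (neg_pos.2 hE)
    have hzE' : E = -κ ^ 2 / (4 * z ^ 2) := by rw [neg_div, ← hzE, neg_neg]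
    obtain ⟨e1, e2⟩ := two_mul_sqrt_mul_of_neg hκ hz hzE'
    refine ⟨z, hz, hzE', (transEq_real_iff hn hκ.ne' γ e1 e2 hR.le).2 hb, c, hc0, ?_⟩
    filter_upwards [hc] with x hx
    rw [kummerM_mul_exp_real hn e1 e2 (norm_nonneg _), hx]
  · rintro ⟨z, hz, hzE, ht, c, hc0, hc⟩
    obtain ⟨e1, e2⟩ := two_mul_sqrt_mul_of_neg hκ hz hzE
    refine isEigenfunctionBall_of_eq_regSol hn hR ((transEq_real_iff hn hκ.ne' γ e1 e2 hR.le).1 ht)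
      hc0 ?_
    filter_upwards [hc] with x hx
    rw [hx, kummerM_mul_exp_real hn e1 e2 (norm_nonneg _)]

theorem radial_eigenfunction_pos_iff {n : ℕ} (hn : 2 ≤ n) {κ : ℝ} (hκ : 0 < κ) (γ : WithTop ℝ)
    {R : ℝ} (hR : 0 < R) {E : ℝ} (hE : 0 < E) (u : Eucl n → ℝ) :
    (IsEigenfunctionBall κ γ R E u ∧ IsRadialOn (B n R) u) ↔
        ∃ z : ℝ, 0 < z ∧ E = κ ^ 2 / (4 * z ^ 2) ∧ TransEq n κ γ R (-Complex.I * (z : ℂ)) ∧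
          ∃ c : ℝ, c ≠ 0 ∧ ∀ᵐ x ∂(volume.restrict (B n R)),
            (u x : ℂ) = (c : ℂ) *
              (kummerM (a₀ n (-Complex.I * (z : ℂ))) (b₀ ℂ n)
                  (2 * (Complex.I * (√|E| : ℝ)) * (‖x‖ : ℝ)) *
                Complex.exp (-(Complex.I * (√|E| : ℝ) * (‖x‖ : ℝ)))) := by
  constructor
  · rintro ⟨h1, h2⟩
    obtain ⟨hb, c, hc0, hc⟩ := h1.exists_eq_regSol hn hR h2
    obtain ⟨z, hz, hzE⟩ := exists_parameter hκ hE
    obtain ⟨e1, e2⟩ := two_mul_sqrt_mul_of_pos hκ hz hzE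
    refine ⟨z, hz, hzE, (transEq_complex_iff hn hκ.ne' γ e1 e2 hR.le).2 hb, c, hc0, ?_⟩
    filter_upwards [hc] with x hx
    rw [kummerM_mul_exp_complex hn e1 e2 (norm_nonneg _), hx]
    push_cast
    rfl
  · rintro ⟨z, hz, hzE, ht, c, hc0, hc⟩
    obtain ⟨e1, e2⟩ := two_mul_sqrt_mul_of_pos hκ hz hzE
    refine isEigenfunctionBall_of_eq_regSol hn hR
      ((transEq_complex_iff hn hκ.ne' γ e1 e2 hR.le).1 ht) hc0 ?_
    filter_upwards [hc] with x hx
    rw [kummerM_mul_exp_complex hn e1 e2 (norm_nonneg _)] at hx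
    exact_mod_cast hx

/-! ### Polynomial and exponentially growing Kummer functions. -/

section KummerAsymptotics

theorem kummerCoeff_eq_zero {a b : ℝ} {j : ℕ} (ha : a + j = 0) {k : ℕ} (hk : j < k) :
    kummerCoeff a b k = 0 := by
  induction k, hk using Nat.le_induction with
  | base => rw [Nat.succ_eq_add_one, kummerCoeff_succ, ha, zero_div, mul_zero]
  | succ k _ ih => rw [kummerCoeff_succ, ih, zero_mul]

theorem kummerCoeff_ne_zero {a b : ℝ} (hb : 1 ≤ b) {k : ℕ} (ha : ∀ i < k, a + i ≠ 0) :
    kummerCoeff a b k ≠ 0 := by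
  induction k with
  | zero => rw [kummerCoeff_zero]; exact one_ne_zero
  | succ k ih =>
    rw [kummerCoeff_succ]
    have : b + k ≠ 0 := by positivity
    exact mul_ne_zero (ih fun i hi => ha i (by omega)) (div_ne_zero (ha k (by omega)) this)

/-- For `a = -j` the Kummer function is a polynomial of degree `j`. -/
theorem exists_polynomial_kummerM {a b : ℝ} (hb : 1 ≤ b) {j : ℕ} (ha : a + j = 0) {s : ℝ}
    (hs : s ≠ 0) : ∃ p : Polynomial ℝ, p.degree = (j : WithBot ℕ) ∧
      ∀ r, kummerM a b (s * r) = p.eval r := by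
  set d : ℕ → ℝ := fun k => kummerCoeff a b k * (s ^ k / k.factorial) with hd
  refine ⟨∑ k ∈ Finset.range (j + 1), Polynomial.C (d k) * Polynomial.X ^ k, ?_, fun r => ?_⟩
  · refine Polynomial.degree_eq_of_le_of_coeff_ne_zero ?_ ?_
    · refine (Polynomial.degree_sum_le _ _).trans (Finset.sup_le fun k hk => ?_)
      refine (Polynomial.degree_C_mul_X_pow_le _ _).trans ?_
      exact_mod_cast Nat.lt_succ_iff.1 (Finset.mem_range.1 hk)
    · rw [Polynomial.finsetSum_coeff]
      simp only [Polynomial.coeff_C_mul_X_pow]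
      rw [Finset.sum_ite_eq]
      rw [if_pos (by simp)]
      refine mul_ne_zero (kummerCoeff_ne_zero hb fun i hi h => ?_) (by positivity)
      have : (i : ℝ) = j := by linarith
      exact hi.ne (by exact_mod_cast this)
  · rw [kummerM_eq_egf]
    unfold egf
    rw [tsum_eq_sum (s := Finset.range (j + 1)) fun k hk => ?_]
    · rw [Polynomial.eval_finsetSum]
      refine Finset.sum_congr rfl fun k _ => ?_
      simp only [Polynomial.eval_mul, Polynomial.eval_C, Polynomial.eval_pow, Polynomial.eval_X, hd]
      rw [mul_pow]
      ring
    · rw [kummerCoeff_eq_zero ha (by simpa using hk), zero_mul]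

theorem tendsto_eval_mul_exp (p : Polynomial ℝ) {s : ℝ} (hs : 0 < s) :
    Tendsto (fun r => p.eval r * Real.exp (-(s * r))) atTop (𝓝 0) := by
  have h := (Polynomial.tendsto_div_exp_atTop (p.comp (Polynomial.C s⁻¹ * Polynomial.X))).comp
    (tendsto_id.const_mul_atTop hs)
  refine h.congr fun r => ?_
  simp only [Function.comp_apply, Polynomial.eval_comp, Polynomial.eval_mul, Polynomial.eval_C,
    Polynomial.eval_X, id_eq, Real.exp_neg, div_eq_mul_inv]
  rw [inv_mul_cancel_left₀ hs.ne']

/-- Half of the decay rate is spent on absorbing the polynomial. -/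
theorem exists_abs_eval_mul_exp_le (p : Polynomial ℝ) {s : ℝ} (hs : 0 < s) :
    ∃ C, ∀ r, 0 ≤ r → |p.eval r * Real.exp (-(s * r))| ≤ C * Real.exp (-(s / 2 * r)) := by
  have h := (tendsto_eval_mul_exp p (half_pos hs)).abs
  rw [abs_zero] at h
  obtain ⟨r₀, hr₀⟩ := eventually_atTop.1 (h.eventually_le_const (zero_lt_one))
  obtain ⟨C, hC⟩ := (isCompact_Icc (a := (0 : ℝ)) (b := r₀)).exists_bound_of_continuousOn
    (f := fun r => p.eval r * Real.exp (-(s / 2 * r))) (Continuous.continuousOn (by fun_prop))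
  refine ⟨max C 1, fun r hr => ?_⟩
  have e : p.eval r * Real.exp (-(s * r))
      = (p.eval r * Real.exp (-(s / 2 * r))) * Real.exp (-(s / 2 * r)) := by
    rw [mul_assoc, ← Real.exp_add]
    ring_nf
  rw [e, abs_mul, Real.abs_exp]
  refine mul_le_mul_of_nonneg_right ?_ (Real.exp_nonneg _)
  rcases le_total r r₀ with h1 | h1
  · exact (hC r ⟨hr, h1⟩).trans (le_max_left _ _)
  · exact (hr₀ r h1).trans (le_max_right _ _)

/-- If `a` is not a nonpositive integer, then `|M(a, b; x)|` grows at least like `e^{3x/4}`. -/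
theorem tendsto_abs_kummerM_mul_exp {a b : ℝ} (hb : 1 ≤ b) (ha : ∀ i : ℕ, a + i ≠ 0) :
    Tendsto (fun x => |kummerM a b x * Real.exp (-(x / 2))|) atTop atTop := by
  -- From this K on, the ratios (a + k)/(b + k) are at least 3/4, so the coefficients have a fixed
  -- sign s and dominate δ (3/4)^k. Only 3/4 > 1/2 matters, since M is compared with e^{x/2}.
  obtain ⟨K, hK⟩ := exists_nat_gt (4 * |a| + 3 * b)
  have hc0 : kummerCoeff a b K ≠ 0 := kummerCoeff_ne_zero hb fun i _ => ha i
  obtain ⟨s, hs1, hsK⟩ : ∃ s : ℝ, |s| = 1 ∧ s * kummerCoeff a b K = |kummerCoeff a b K| := by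
    rcases lt_or_gt_of_ne hc0 with h | h
    · exact ⟨-1, by simp, by rw [abs_of_neg h]; ring⟩
    · exact ⟨1, by simp, by rw [abs_of_pos h]; ring⟩
  set δ : ℝ := |kummerCoeff a b K| * (3 / 4) ^ (-(K : ℤ)) with hδ
  have hδ0 : 0 < δ := by have := abs_pos.2 hc0; positivity
  have hd : ∀ k, K ≤ k → δ * (3 / 4) ^ k ≤ s * kummerCoeff a b k := by
    intro k hk
    induction k, hk using Nat.le_induction with
    | base =>
      rw [hsK, hδ, mul_assoc, zpow_neg, zpow_natCast, inv_mul_cancel₀ (by positivity), mul_one]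
    | succ k hk ih =>
      have hk' : (K : ℝ) ≤ k := by exact_mod_cast hk
      have hr : 3 / 4 ≤ (a + k) / (b + k) := by
        rw [div_le_div_iff₀ (by norm_num) (by positivity)]
        have := neg_abs_le a
        linarith
      rw [kummerCoeff_succ, pow_succ]
      have hpos : 0 ≤ s * kummerCoeff a b k := le_trans (by positivity) ih
      calc δ * ((3 / 4) ^ k * (3 / 4)) = δ * (3 / 4) ^ k * (3 / 4) := by ring
        _ ≤ s * kummerCoeff a b k * ((a + k) / (b + k)) := mul_le_mul ih hr (by norm_num) hpos
        _ = _ := by ring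
  -- The first K terms, whose signs are not controlled, only contribute a polynomial correction.
  set P : Polynomial ℝ := ∑ k ∈ Finset.range K,
    Polynomial.C ((s * kummerCoeff a b k - δ * (3 / 4) ^ k) / k.factorial) * Polynomial.X ^ k with hP
  have hlow : ∀ x, 0 ≤ x → δ * Real.exp (3 / 4 * x) + P.eval x ≤ s * kummerM a b x := by
    intro x hx
    have h1 : HasSum (fun k : ℕ => s * (kummerCoeff a b k * (x ^ k / (k.factorial : ℝ))))
        (s * kummerM a b x) := ((expBounded_kummerCoeff a hb).hasSum x).mul_left s
    have h2 := (NormedSpace.expSeries_div_hasSum_exp (3 / 4 * x)).mul_left δ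
    rw [← Real.exp_eq_exp_ℝ] at h2
    have h3 := h1.sub h2
    have h4 := sum_le_hasSum (Finset.range K) (fun k hk => ?_) h3
    · have h5 : P.eval x = ∑ k ∈ Finset.range K, (s * (kummerCoeff a b k * (x ^ k / (k.factorial : ℝ)))
          - δ * ((3 / 4 * x) ^ k / k.factorial)) := by
        rw [hP, Polynomial.eval_finsetSum]
        refine Finset.sum_congr rfl fun k _ => ?_
        simp only [Polynomial.eval_mul, Polynomial.eval_C, Polynomial.eval_pow, Polynomial.eval_X]
        rw [mul_pow]
        ring
      rw [h5]
      linarith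
    · have hk' : K ≤ k := by simpa using hk
      have e : s * (kummerCoeff a b k * (x ^ k / (k.factorial : ℝ)))
          - δ * ((3 / 4 * x) ^ k / k.factorial)
          = (s * kummerCoeff a b k - δ * (3 / 4) ^ k) * (x ^ k / k.factorial) := by
        rw [mul_pow]; ring
      have := hd k hk'
      have h0 : 0 ≤ (s * kummerCoeff a b k - δ * (3 / 4) ^ k) := by linarith
      exact le_of_le_of_eq (by positivity) e.symm
  have hexp : Tendsto (fun x => δ * Real.exp (1 / 4 * x) + P.eval x * Real.exp (-(1 / 2 * x)))
      atTop atTop :=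
    tendsto_atTop_add_right_of_le' (C := -1) _ ((Real.tendsto_exp_atTop.comp
      (tendsto_id.const_mul_atTop (by norm_num : (0 : ℝ) < 1 / 4))).const_mul_atTop hδ0)
      ((tendsto_eval_mul_exp P (by norm_num : (0 : ℝ) < 1 / 2)).eventually_const_le (by norm_num))
  refine tendsto_atTop_mono' _ ?_ hexp
  filter_upwards [eventually_ge_atTop 0] with x hx
  have h1 := mul_le_mul_of_nonneg_right (hlow x hx) (Real.exp_nonneg (-(1 / 2 * x)))
  have h2 : |kummerM a b x * Real.exp (-(x / 2))| = |s * kummerM a b x * Real.exp (-(1 / 2 * x))| := by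
    rw [mul_assoc, abs_mul s, hs1, one_mul]
    ring_nf
  rw [h2]
  refine le_trans (le_of_eq ?_) (h1.trans (le_abs_self _))
  rw [add_mul, mul_assoc δ, ← Real.exp_add]
  ring_nf

end KummerAsymptotics

/-! ### Square integrability of radial functions on the whole space. -/

section Integrability

variable {n : ℕ} (hn : 2 ≤ n) {f : ℝ → ℝ}
include hn

theorem integrable_radial_iff :
    Integrable (fun x : Eucl n => f ‖x‖) ↔ IntegrableOn (fun r => r ^ (n - 1) * f r) (Set.Ioi 0) := by
  have : Nontrivial (Eucl n) := by
    have : Nontrivial (Fin n) := Fin.nontrivial_iff_two_le.2 hn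
    infer_instance
  have := integrable_fun_norm_addHaar (volume : Measure (Eucl n)) (f := f)
  simpa [finrank_euclideanSpace] using this

theorem memLp_radial_iff (hf : Continuous f) : MemLp (fun x : Eucl n => f ‖x‖) 2 ↔
    IntegrableOn (fun r => r ^ (n - 1) * f r ^ 2) (Set.Ioi 0) := by
  rw [memLp_two_iff_integrable_sq (f := fun x : Eucl n => f ‖x‖)
    (hf.comp continuous_norm).aestronglyMeasurable]
  exact integrable_radial_iff hn (f := fun r => f r ^ 2)

theorem memLp_radial_of_exp_bound (hf : Continuous f) {C s : ℝ} (hs : 0 < s)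
    (hb : ∀ r > 0, |f r| ≤ C * Real.exp (-(s * r))) : MemLp (fun x : Eucl n => f ‖x‖) 2 := by
  rw [memLp_radial_iff hn hf]
  have h1 := (integrableOn_rpow_mul_exp_neg_mul_rpow (p := 1) (s := ((n - 1 : ℕ) : ℝ)) (b := 2 * s)
    (by have : (0 : ℝ) ≤ ((n - 1 : ℕ) : ℝ) := Nat.cast_nonneg _
        linarith) one_pos (by positivity)).const_mul (C ^ 2)
  refine Integrable.mono' h1 (Continuous.aestronglyMeasurable (by fun_prop)) ?_
  filter_upwards [ae_restrict_mem measurableSet_Ioi] with r hr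
  have hr0 : (0 : ℝ) < r := hr
  rw [Real.norm_eq_abs, abs_mul, abs_of_pos (pow_pos hr0 _), abs_of_nonneg (sq_nonneg _),
    Real.rpow_natCast, Real.rpow_one, ← sq_abs]
  have h2 : |f r| ^ 2 ≤ (C * Real.exp (-(s * r))) ^ 2 := pow_le_pow_left₀ (abs_nonneg _) (hb r hr0) 2
  calc r ^ (n - 1) * |f r| ^ 2 ≤ r ^ (n - 1) * (C * Real.exp (-(s * r))) ^ 2 :=
        mul_le_mul_of_nonneg_left h2 (pow_pos hr0 _).le
    _ = _ := by
      rw [mul_pow, ← Real.exp_nat_mul]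
      push_cast
      ring_nf

end Integrability

/-! ### The virial identity and the exclusion of nonnegative energies. -/

section Virial

variable {n : ℕ} (hn : 2 ≤ n) {κ E : ℝ}
include hn

/-- The radial equation in divergence form is multiplied by 2r f' + (n-1) f. The coefficient n - 1
makes the term κ r^{n-2} f² cancel, so the derivative that remains is nonnegative for E ≥ 0. -/
theorem hasDerivAt_virial (κ E r : ℝ) :
    HasDerivAt (fun r => r ^ n * regSol' n κ E r ^ 2
        + (E * r ^ n + κ * r ^ (n - 1)) * regSol n κ E r ^ 2
        + (n - 1) * (r ^ (n - 1) * regSol' n κ E r) * regSol n κ E r)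
      (r ^ (n - 1) * (regSol' n κ E r ^ 2 + E * regSol n κ E r ^ 2)) r := by
  obtain ⟨d, hd, hode⟩ := exists_hasDerivAt_regSol' hn κ E r
  have hf := hasDerivAt_regSol hn κ E r
  have hq := hasDerivAt_pow_mul_regSol' hn κ E r
  have h1 := (hasDerivAt_pow n r).mul (hd.pow 2)
  have h2 := (((hasDerivAt_pow n r).const_mul E).add ((hasDerivAt_pow (n - 1) r).const_mul κ)).mul
    (hf.pow 2)
  have h3 := (hq.const_mul ((n : ℝ) - 1)).mul hf
  refine ((h1.add h2).add h3).congr_deriv ?_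
  obtain ⟨m, rfl⟩ := Nat.exists_eq_add_of_le hn
  rw [show 2 + m - 1 = m + 1 by omega, show 2 + m - 2 = m by omega]
  push_cast at hode ⊢
  simp only [Pi.pow_apply, Pi.add_apply]
  linear_combination (2 * r ^ (m + 1) * regSol' (2 + m) κ E r) * hode

theorem regSol'_zero (hκ : κ ≠ 0) (E : ℝ) : regSol' n κ E 0 ≠ 0 := by
  obtain ⟨d, -, hode⟩ := exists_hasDerivAt_regSol' hn κ E 0
  intro h
  rw [h, regSol_zero] at hode
  simp at hode
  exact hκ hode

/-- For `E ≥ 0` the regular solution has infinite `H¹` norm. -/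
theorem not_integrableOn_regSol (hκ : 0 < κ) (hE : 0 ≤ E) :
    ¬ (IntegrableOn (fun r => r ^ (n - 1) * regSol n κ E r ^ 2) (Set.Ioi 0) ∧
      IntegrableOn (fun r => r ^ (n - 1) * regSol' n κ E r ^ 2) (Set.Ioi 0)) := by
  rintro ⟨i1, i2⟩
  set f := regSol n κ E with hf
  set f' := regSol' n κ E with hf'
  -- Φ vanishes at 0, is nondecreasing, and increases strictly at first because f'(0) ≠ 0; hence it
  -- stays above a positive constant. Since Φ is at most A r times the integrable density r^{n-1}
  -- (f² + f'²), integrability of 1/r at infinity would follow.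
  set Φ : ℝ → ℝ := fun r => r ^ n * f' r ^ 2 + (E * r ^ n + κ * r ^ (n - 1)) * f r ^ 2
    + (n - 1) * (r ^ (n - 1) * f' r) * f r with hΦ
  have hΦd : ∀ r, HasDerivAt Φ (r ^ (n - 1) * (f' r ^ 2 + E * f r ^ 2)) r :=
    hasDerivAt_virial hn κ E
  have hΦc : Continuous Φ := continuous_iff_continuousAt.2 fun r => (hΦd r).continuousAt
  have hΦ0 : Φ 0 = 0 := by
    simp [hΦ, show n ≠ 0 by omega, show n - 1 ≠ 0 by omega]
  have hmono : MonotoneOn Φ (Set.Ici 0) := by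
    refine monotoneOn_of_deriv_nonneg (convex_Ici 0) hΦc.continuousOn
      (fun r _ => (hΦd r).differentiableAt.differentiableWithinAt) fun r hr => ?_
    rw [interior_Ici] at hr
    have hr0 : (0 : ℝ) < r := hr
    rw [(hΦd r).deriv]
    positivity
  have hne : ∀ᶠ r in 𝓝 0, f' r ≠ 0 :=
    (continuous_regSol' hn κ E).continuousAt.eventually_ne (regSol'_zero hn hκ.ne' E)
  obtain ⟨δ, hδ, hδ2⟩ := Metric.eventually_nhds_iff.1 hne
  have hstrict : StrictMonoOn Φ (Set.Icc 0 (δ / 2)) := by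
    refine strictMonoOn_of_deriv_pos (convex_Icc _ _) hΦc.continuousOn fun r hr => ?_
    rw [interior_Icc] at hr
    have hr0 : (0 : ℝ) < r := hr.1
    rw [(hΦd r).deriv]
    have : f' r ≠ 0 := hδ2 (by rw [Real.dist_eq, sub_zero, abs_of_pos hr0]; linarith [hr.2])
    positivity
  have hpos : 0 < Φ (δ / 2) := by
    rw [← hΦ0]
    exact hstrict ⟨le_rfl, by linarith⟩ ⟨by linarith, le_rfl⟩ (by linarith)
  -- For r ≥ 1 the terms with κ f² and (n-1) f f', one power of r short, are absorbed into the bound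
  -- with the factor r.
  set r₀ := max 1 (δ / 2) with hr₀
  have hr₀1 : 1 ≤ r₀ := le_max_left _ _
  set A : ℝ := E + κ + n with hA
  have hn0 : (2 : ℝ) ≤ n := by exact_mod_cast hn
  have hbound : ∀ r, r₀ ≤ r → Φ (δ / 2) * r⁻¹ ≤ A * (r ^ (n - 1) * f r ^ 2 + r ^ (n - 1) * f' r ^ 2) := by
    intro r hr
    have hr1 : 1 ≤ r := hr₀1.trans hr
    have h1 : Φ (δ / 2) ≤ Φ r := hmono (Set.mem_Ici.2 (by linarith)) (Set.mem_Ici.2 (by linarith))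
      ((le_max_right _ _).trans hr)
    have hx : r ^ n = r * r ^ (n - 1) := by rw [← pow_succ']; congr 1; omega
    have h2 : Φ r ≤ r * (A * (r ^ (n - 1) * f r ^ 2 + r ^ (n - 1) * f' r ^ 2)) := by
      have hX : 0 ≤ r ^ (n - 1) := by positivity
      have h3 : f' r * f r ≤ (f r ^ 2 + f' r ^ 2) / 2 := by nlinarith [sq_nonneg (f r - f' r)]
      have h4 : f' r ^ 2 * r + (E * r + κ) * f r ^ 2 + (n - 1) * (f' r * f r)
          ≤ r * (A * (f r ^ 2 + f' r ^ 2)) := by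
        have e1 : (n - 1) * (f' r * f r) ≤ (n - 1) * ((f r ^ 2 + f' r ^ 2) / 2) :=
          mul_le_mul_of_nonneg_left h3 (by linarith)
        have e2 : κ * f r ^ 2 ≤ r * (κ * f r ^ 2) := le_mul_of_one_le_left (by positivity) hr1
        have e3 : (n - 1) * ((f r ^ 2 + f' r ^ 2) / 2) ≤ r * ((n - 1) * ((f r ^ 2 + f' r ^ 2) / 2)) :=
          le_mul_of_one_le_left (mul_nonneg (by linarith) (by positivity)) hr1
        have e4 : 0 ≤ r * ((n - 1) / 2 * f r ^ 2) :=
          mul_nonneg (by linarith) (mul_nonneg (by linarith) (by positivity))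
        have e5 : 0 ≤ r * ((E + κ + ((n : ℝ) - 2) / 2) * f' r ^ 2) :=
          mul_nonneg (by linarith) (mul_nonneg (by linarith) (by positivity))
        have e6 : 0 ≤ r * (f r ^ 2 + f' r ^ 2) := by positivity
        rw [hA]
        nlinarith
      calc Φ r = r ^ (n - 1) * (f' r ^ 2 * r + (E * r + κ) * f r ^ 2 + (n - 1) * (f' r * f r)) := by
            simp only [hΦ, hx]; ring
        _ ≤ r ^ (n - 1) * (r * (A * (f r ^ 2 + f' r ^ 2))) := mul_le_mul_of_nonneg_left h4 hX
        _ = _ := by ring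
    rw [← div_eq_mul_inv, div_le_iff₀' (by linarith)]
    exact h1.trans h2
  have hbad : IntegrableOn (fun r : ℝ => Φ (δ / 2) * r⁻¹) (Set.Ioi r₀) := by
    have hI : IntegrableOn (fun r => A * (r ^ (n - 1) * f r ^ 2 + r ^ (n - 1) * f' r ^ 2))
        (Set.Ioi r₀) :=
      (Integrable.const_mul (i1.add i2) A).mono_measure
        (Measure.restrict_mono (Set.Ioi_subset_Ioi (by linarith)) le_rfl)
    refine Integrable.mono' hI (by fun_prop) ?_
    filter_upwards [ae_restrict_mem measurableSet_Ioi] with r hr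
    have hr' : r₀ < r := hr
    rw [Real.norm_eq_abs, abs_of_nonneg]
    · exact hbound r hr'.le
    · have : 0 < r := by linarith
      positivity
  refine not_integrableOn_Ioi_inv (a := r₀) ?_
  have := hbad.const_mul (Φ (δ / 2))⁻¹
  refine this.congr (Eventually.of_forall fun r => ?_)
  simp only
  field_simp

end Virial

/-! ### Bound states on the whole space. -/

section Space

variable {n : ℕ} {κ E : ℝ} {u : Eucl n → ℝ} {G : Eucl n → Eucl n}

theorem schroForm_univ_eq_ball {R : ℝ} {ψ : Eucl n → ℝ} (h : tsupport ψ ⊆ B n R) :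
    schroForm Set.univ κ E u G ψ (gradient ψ) = schroForm (B n R) κ E u G ψ (gradient ψ) := by
  have h0 : ∀ x, x ∉ B n R → ψ x = 0 := fun x hx => image_eq_zero_of_notMem_tsupport fun h' => hx (h h')
  have h1 : ∀ x, x ∉ B n R → gradient ψ x = 0 := fun x hx =>
    gradient_eq_zero_of_notMem_tsupport fun h' => hx (h h')
  unfold schroForm
  simp only [Measure.restrict_univ]
  congr 1
  · congr 1
    · exact (setIntegral_eq_integral_of_forall_compl_eq_zero fun x hx => by simp [h1 x hx]).symm
    · congr 1
      exact (setIntegral_eq_integral_of_forall_compl_eq_zero fun x hx => by simp [h0 x hx]).symm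
  · congr 1
    exact (setIntegral_eq_integral_of_forall_compl_eq_zero fun x hx => by simp [h0 x hx]).symm

theorem exists_tsupport_subset_ball {ψ : Eucl n → ℝ} (h : HasCompactSupport ψ) :
    ∃ R, 0 < R ∧ tsupport ψ ⊆ B n R := by
  obtain ⟨R, hR⟩ := h.isCompact.isBounded.subset_ball 0
  exact ⟨max R 1, by positivity, hR.trans (Metric.ball_subset_ball (le_max_left _ _))⟩

theorem ae_of_ae_balls {P : Eucl n → Prop}
    (h : ∀ k : ℕ, ∀ᵐ x ∂(volume.restrict (B n ((k : ℝ) + 1))), P x) : ∀ᵐ x, P x := by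
  have h' := ae_all_iff.2 fun k => (ae_restrict_iff' (measurableSet_ball)).1 (h k)
  filter_upwards [h'] with x hx
  obtain ⟨k, hk⟩ := exists_nat_gt ‖x‖
  exact hx k (mem_ball_zero_iff.2 (by linarith))

variable (hn : 2 ≤ n)
include hn

/-- Each ball of an exhaustion yields its own constant. All constants agree because they can be
compared on the unit ball, where the regular solution is not almost everywhere zero. -/
theorem IsH1Loc.exists_eq_regSol (hH : IsH1Loc u G) (hw : IsWeakSolution κ E u G)
    (hr : IsRadialOn Set.univ u) : ∃ c : ℝ, ∀ᵐ x, u x = c * regSol n κ E ‖x‖ := by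
  obtain ⟨f, hf⟩ := hr
  rw [Measure.restrict_univ] at hf
  have key : ∀ k : ℕ, ∃ c : ℝ, ∀ᵐ x ∂(volume.restrict (B n ((k : ℝ) + 1))),
      u x = c * regSol n κ E ‖x‖ := fun k =>
    exists_eq_regSol_of_weak hn κ E (by positivity) (hH.1 _).1 (hH.1 _).2
      (hH.2.mono (Set.subset_univ _)) ⟨f, ae_restrict_of_ae hf⟩ fun ψ h1 h2 h3 => by
        rw [← schroForm_univ_eq_ball h3]; exact hw ψ h1 h2
  choose c hc using key
  have hcc : ∀ k, c k = c 0 := by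
    intro k
    by_contra hne
    refine not_ae_zero_regSol hn κ E (sub_ne_zero.2 hne) one_pos ?_
    have h1 : ∀ᵐ x ∂(volume.restrict (B n 1)), u x = c k * regSol n κ E ‖x‖ :=
      ae_restrict_of_ae_restrict_of_subset (Metric.ball_subset_ball (by
        have : (0 : ℝ) ≤ k := k.cast_nonneg
        linarith)) (hc k)
    have h2 : ∀ᵐ x ∂(volume.restrict (B n 1)), u x = c 0 * regSol n κ E ‖x‖ := by
      simpa using hc 0
    filter_upwards [h1, h2] with x hx1 hx2
    rw [Pi.zero_apply, sub_mul, ← hx1, ← hx2, sub_self]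
  refine ⟨c 0, ae_of_ae_balls fun k => ?_⟩
  rw [← hcc k]
  exact hc k

theorem isWeakSolution_regSol (κ E c : ℝ) : IsWeakSolution (n := n) κ E
    (fun x => c * regSol n κ E ‖x‖) (radGrad fun r => c * regSol n κ E r) := by
  intro ψ h1 h2
  obtain ⟨R, hR, hs⟩ := exists_tsupport_subset_ball h2
  have h := schroForm_profile hn (isProfile_regSol hn κ E c) hR.le (isH1Ball_of_contDiff h1 hR.le)
  rw [schroForm_univ_eq_ball hs]
  refine h.trans ?_
  rw [integral_eq_zero_of_ae (ae_surf_eq_zero_of_tsupport hR.le hs), mul_zero]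

theorem isH1Loc_regSol (κ E c : ℝ) : IsH1Loc (n := n)
    (fun x => c * regSol n κ E ‖x‖) (radGrad fun r => c * regSol n κ E r) := by
  have hP := isProfile_regSol hn κ E c
  refine ⟨fun R => ?_, isWeakGradient_radial_univ hP.contDiff⟩
  have h := (isH1Ball_radial (n := n) hP.contDiff (abs_nonneg R)).1
  have hs : B n R ⊆ B n |R| := Metric.ball_subset_ball (le_abs_self R)
  exact ⟨h.1.mono_measure (Measure.restrict_mono hs le_rfl),
    h.2.1.mono_measure (Measure.restrict_mono hs le_rfl)⟩

omit hn in
theorem IsH1.isH1Loc (h : IsH1 Set.univ u G) : IsH1Loc u G :=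
  ⟨fun _ => ⟨(Measure.restrict_univ (μ := (volume : Measure (Eucl n))) ▸ h.1).restrict _,
    (Measure.restrict_univ (μ := (volume : Measure (Eucl n))) ▸ h.2.1).restrict _⟩, h.2.2⟩

theorem IsH1Loc.gradient_ae_eq (hH : IsH1Loc u G) {c : ℝ}
    (hc : ∀ᵐ x, u x = c * regSol n κ E ‖x‖) :
    ∀ᵐ x, G x = radGrad (fun r => c * regSol n κ E r) x := by
  refine ae_of_ae_balls fun k => ?_
  have h2 := (isH1Loc_regSol hn κ E c)
  exact IsWeakGradient.unique Metric.isOpen_ball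
    ((hH.2.mono (Set.subset_univ _)).congr (ae_restrict_of_ae hc) (EventuallyEq.refl _ _))
    (h2.2.mono (Set.subset_univ _))
    (locallyIntegrableOn_of_memLp (hH.1 _).2) (locallyIntegrableOn_of_memLp (h2.1 _).2)

omit hn in
theorem weakSolution_congr {u' : Eucl n → ℝ} (h : IsWeakSolution κ E u G) (hu : u =ᵐ[volume] u') :
    IsWeakSolution κ E u' G := fun ψ h1 h2 => by
  rw [← h ψ h1 h2]
  exact schroForm_congr (ae_restrict_of_ae hu.symm) (EventuallyEq.refl _ _) _ _

theorem not_ae_zero_space {c : ℝ} (hc0 : c ≠ 0) (hc : ∀ᵐ x, u x = c * regSol n κ E ‖x‖) :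
    ¬ (u =ᵐ[volume] 0) := fun h =>
  not_ae_zero_regSol hn κ E hc0 one_pos (ae_restrict_of_ae (by
    filter_upwards [h, hc] with x h1 h2
    rw [← h2, h1]))

/-- An eigenfunction on the whole space has `E < 0`. -/
theorem neg_of_isH1_regSol (hκ : 0 < κ) {c : ℝ} (hc0 : c ≠ 0) (hH : IsH1 Set.univ u G)
    (hc : ∀ᵐ x, u x = c * regSol n κ E ‖x‖) : E < 0 := by
  by_contra hE
  have hG := hH.isH1Loc.gradient_ae_eq hn hc
  have hu : MemLp u 2 := by simpa only [Measure.restrict_univ] using hH.1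
  have hG2 : MemLp G 2 := by simpa only [Measure.restrict_univ] using hH.2.1
  have hcf := continuous_regSol hn κ E
  have hcf' := continuous_regSol' hn κ E
  refine not_integrableOn_regSol hn hκ (not_lt.1 hE) ⟨?_, ?_⟩
  · rw [← memLp_radial_iff hn hcf]
    have := (hu.ae_eq hc).const_mul c⁻¹
    refine this.ae_eq (Eventually.of_forall fun x => ?_)
    simp only
    rw [inv_mul_cancel_left₀ hc0]
  · rw [← memLp_radial_iff hn hcf']
    have := (hG2.ae_eq hG).const_smul c⁻¹
    refine this.norm.of_le (Continuous.aestronglyMeasurable (by fun_prop)) ?_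
    have hne : ∀ᵐ x : Eucl n, x ≠ 0 := by
      have : Nontrivial (Eucl n) := by
        have : Nonempty (Fin n) := ⟨⟨0, by omega⟩⟩
        infer_instance
      exact measure_eq_zero_iff_ae_notMem.1 (measure_singleton (0 : Eucl n))
    filter_upwards [hne] with x hx
    have hx' : ‖x‖ ≠ 0 := norm_ne_zero_iff.2 hx
    simp only [norm_norm, Pi.smul_apply, radGrad, deriv_const_mul_regSol hn, norm_smul, norm_mul,
      norm_inv]
    have : ‖c‖ ≠ 0 := norm_ne_zero_iff.2 hc0
    field_simp
    rfl

/-- The regular solution at `E = -κ² / (4z²)` grows unless `z - (n - 3) / 2` is a positive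
integer. -/
theorem tendsto_abs_regSol {z : ℝ} (hκ : 0 < κ) (hz : 0 < z) (hE : E = -κ ^ 2 / (4 * z ^ 2))
    (h : ∀ j : ℕ, 1 ≤ j → z ≠ j + ((n : ℝ) - 3) / 2) :
    Tendsto (fun r => |regSol n κ E r|) atTop atTop := by
  obtain ⟨e1, e2⟩ := two_mul_sqrt_mul_of_neg hκ hz hE
  have hσ : 0 < √|E| := by rw [sqrt_abs_of_neg hκ hz hE]; positivity
  have hn' : (2 : ℝ) ≤ n := by exact_mod_cast hn
  have ht := (tendsto_abs_kummerM_mul_exp (a := a₀ n z) (b := (n : ℝ) - 1) (by linarith) fun i hi => by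
    refine h (i + 1) (by omega) ?_
    unfold a₀ at hi
    push_cast
    linarith [hi]).comp (tendsto_id.const_mul_atTop (by positivity : (0 : ℝ) < 2 * √|E|))
  refine ht.congr' ?_
  filter_upwards [eventually_ge_atTop 0] with r hr
  rw [← kummerM_mul_exp_real hn e1 e2 hr]
  have hb : b₀ ℝ n = (n : ℝ) - 1 := by simpa using b₀_eq (𝕂 := ℝ) n
  simp only [Function.comp_apply, id_eq, hb]
  congr 3
  ring_nf

theorem volume_compl_ball_eq_top (R : ℝ) : (volume : Measure (Eucl n)) {x | R < ‖x‖} = ⊤ := by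
  have : Nontrivial (Eucl n) := by
    have : Nonempty (Fin n) := ⟨⟨0, by omega⟩⟩
    infer_instance
  by_contra h
  have h1 : (volume : Measure (Eucl n)) Set.univ ≤ volume (Metric.closedBall (0 : Eucl n) R)
      + volume {x : Eucl n | R < ‖x‖} := by
    refine (measure_mono fun x _ => ?_).trans (measure_union_le _ _)
    rcases le_or_gt ‖x‖ R with hx | hx
    · exact Or.inl (mem_closedBall_zero_iff.2 hx)
    · exact Or.inr hx
  have h2 : (volume : Measure (Eucl n)) Set.univ = ⊤ := measure_univ_of_isAddLeftInvariant _
  rw [h2, top_le_iff, ENNReal.add_eq_top] at h1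
  rcases h1 with h1 | h1
  · exact measure_closedBall_lt_top.ne h1
  · exact h h1

/-- Growth would make |f| ≥ 1 outside a ball, a set of infinite measure. -/
theorem not_tendsto_of_memLp {f : ℝ → ℝ} (hf : Tendsto (fun r => |f r|) atTop atTop) :
    ¬ MemLp (fun x : Eucl n => f ‖x‖) 2 := by
  intro h
  obtain ⟨r₀, hr₀⟩ := eventually_atTop.1 (hf.eventually_ge_atTop 1)
  have h1 := h.meas_ge_lt_top (p := 2) (by norm_num) (by norm_num) (ε := 1) one_ne_zero
  refine (measure_mono_top ?_ (volume_compl_ball_eq_top hn r₀) ▸ h1).ne rfl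
  intro x hx
  have := hr₀ ‖x‖ (le_of_lt hx)
  simp only [Set.mem_ofPred_eq]
  rw [← NNReal.coe_le_coe]
  simpa using this

/-- The bound states: the regular solution and its derivative decay exponentially. -/
theorem exists_exp_bound_regSol {j : ℕ} (hj : 1 ≤ j) (hκ : 0 < κ)
    (hE : E = -κ ^ 2 / (4 * ((j : ℝ) + ((n : ℝ) - 3) / 2) ^ 2)) :
    ∃ C s, 0 < s ∧ ∀ r > 0, |regSol n κ E r| ≤ C * Real.exp (-(s * r)) ∧
      |regSol' n κ E r| ≤ C * Real.exp (-(s * r)) := by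
  have hn' : (2 : ℝ) ≤ n := by exact_mod_cast hn
  have hj' : (1 : ℝ) ≤ j := by exact_mod_cast hj
  set z : ℝ := (j : ℝ) + ((n : ℝ) - 3) / 2 with hzdef
  have hz : 0 < z := by rw [hzdef]; linarith
  obtain ⟨e1, e2⟩ := two_mul_sqrt_mul_of_neg hκ hz hE
  have hσ : 0 < √|E| := by rw [sqrt_abs_of_neg hκ hz hE]; positivity
  set σ := √|E| with hσdef
  have hb : b₀ ℝ n = (n : ℝ) - 1 := by simpa using b₀_eq (𝕂 := ℝ) n
  have ha : a₀ n z + ((j - 1 : ℕ) : ℝ) = 0 := by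
    unfold a₀
    rw [Nat.cast_sub hj, hzdef]
    push_cast
    ring
  obtain ⟨p, -, hp⟩ := exists_polynomial_kummerM (b := (n : ℝ) - 1) (by linarith) ha
    (s := 2 * σ) (by positivity)
  have hF : ∀ r ≥ 0, regSol n κ E r = p.eval r * Real.exp (-(σ * r)) := fun r hr => by
    rw [← kummerM_mul_exp_real hn e1 e2 hr, hb, hp]
  set q : Polynomial ℝ := p.derivative - Polynomial.C σ * p with hq
  have hF' : ∀ r > 0, regSol' n κ E r = q.eval r * Real.exp (-(σ * r)) := fun r hr => by
    have h1 : HasDerivAt (fun r => p.eval r * Real.exp (-(σ * r)))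
        (p.derivative.eval r * Real.exp (-(σ * r))
          + p.eval r * (Real.exp (-(σ * r)) * -(σ * 1))) r :=
      (p.hasDerivAt r).mul ((((hasDerivAt_id r).const_mul σ).neg).exp)
    have h2 := (hasDerivAt_regSol hn κ E r).congr_of_eventuallyEq
      (f₁ := fun r => p.eval r * Real.exp (-(σ * r))) (by
        filter_upwards [Ioi_mem_nhds hr] with s hs
        exact (hF s (le_of_lt hs)).symm)
    rw [h2.unique h1, hq]
    simp only [Polynomial.eval_sub, Polynomial.eval_mul, Polynomial.eval_C]
    ring
  obtain ⟨C1, hC1⟩ := exists_abs_eval_mul_exp_le p hσ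
  obtain ⟨C2, hC2⟩ := exists_abs_eval_mul_exp_le q hσ
  refine ⟨max C1 C2, σ / 2, half_pos hσ, fun r hr => ⟨?_, ?_⟩⟩
  · rw [hF r hr.le]
    exact (hC1 r hr.le).trans (mul_le_mul_of_nonneg_right (le_max_left _ _) (Real.exp_nonneg _))
  · rw [hF' r hr]
    exact (hC2 r hr.le).trans (mul_le_mul_of_nonneg_right (le_max_right _ _) (Real.exp_nonneg _))

theorem isH1_regSol {j : ℕ} (hj : 1 ≤ j) (hκ : 0 < κ)
    (hE : E = -κ ^ 2 / (4 * ((j : ℝ) + ((n : ℝ) - 3) / 2) ^ 2)) (c : ℝ) :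
    IsH1 (n := n) Set.univ (fun x => c * regSol n κ E ‖x‖) (radGrad fun r => c * regSol n κ E r) := by
  obtain ⟨C, s, hs, hb⟩ := exists_exp_bound_regSol hn hj hκ hE
  unfold IsH1
  rw [Measure.restrict_univ]
  refine ⟨(memLp_radial_of_exp_bound hn (continuous_regSol hn κ E) hs fun r hr => (hb r hr).1).const_mul c,
    ?_, (isH1Loc_regSol hn κ E c).2⟩
  have h2 := (memLp_radial_of_exp_bound hn (continuous_regSol' hn κ E) hs
    fun r hr => (hb r hr).2).const_mul c
  refine h2.of_le (aestronglyMeasurable_radGrad _ _) (Eventually.of_forall fun x => ?_)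
  refine (norm_radGrad_le x).trans ?_
  rw [deriv_const_mul_regSol hn, Real.norm_eq_abs]

theorem space_profile_eq (hκ : 0 < κ) {j : ℕ} (hj : 1 ≤ j)
    (hE : E = -κ ^ 2 / (4 * ((j : ℝ) + ((n : ℝ) - 3) / 2) ^ 2)) {r : ℝ} (hr : 0 ≤ r) :
    kummerM (a₀ n ((j : ℝ) + ((n : ℝ) - 3) / 2)) (b₀ ℝ n) (2 * √|E| * r) * Real.exp (-(√|E| * r))
      = regSol n κ E r := by
  have hn' : (2 : ℝ) ≤ n := by exact_mod_cast hn
  have hj' : (1 : ℝ) ≤ j := by exact_mod_cast hj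
  obtain ⟨e1, e2⟩ := two_mul_sqrt_mul_of_neg hκ (by linarith) hE
  exact kummerM_mul_exp_real hn e1 e2 hr

omit hn in
theorem exists_level_of_not_growing (hn : 2 ≤ n) (hκ : 0 < κ) (hE : E < 0)
    (h : ¬ Tendsto (fun r => |regSol n κ E r|) atTop atTop) :
    ∃ j : ℕ, 1 ≤ j ∧ E = -κ ^ 2 / (4 * ((j : ℝ) + ((n : ℝ) - 3) / 2) ^ 2) := by
  obtain ⟨z, hz, hzE⟩ := exists_parameter hκ (neg_pos.2 hE)
  have hzE' : E = -κ ^ 2 / (4 * z ^ 2) := by rw [neg_div, ← hzE, neg_neg]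
  by_contra hcon
  push Not at hcon
  refine h (tendsto_abs_regSol hn hκ hz hzE' fun j hj hzj => hcon j hj ?_)
  rw [← hzj, hzE']

/-- Square integrability is used twice: with the virial identity to force E < 0, and then against
the growth of |f| at all energies off the list. -/
theorem radial_eigenfunction_space_iff (hκ : 0 < κ) (E : ℝ) (u : Eucl n → ℝ) :
    (IsEigenfunctionSpace κ E u ∧ IsRadialOn Set.univ u) ↔
        ∃ j : ℕ, 1 ≤ j ∧ E = -κ ^ 2 / (4 * ((j : ℝ) + ((n : ℝ) - 3) / 2) ^ 2) ∧
          ∃ c : ℝ, c ≠ 0 ∧ ∀ᵐ x ∂(volume : Measure (Eucl n)),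
            u x = c * (kummerM (a₀ n ((j : ℝ) + ((n : ℝ) - 3) / 2)) (b₀ ℝ n) (2 * √|E| * ‖x‖) *
              Real.exp (-(√|E| * ‖x‖))) := by
  constructor
  · rintro ⟨⟨hu0, G, hH, hw⟩, hr⟩
    obtain ⟨c, hc⟩ := hH.isH1Loc.exists_eq_regSol hn hw hr
    have hc0 : c ≠ 0 := by
      rintro rfl
      exact hu0 (by filter_upwards [hc] with x hx; simp [hx])
    have hE := neg_of_isH1_regSol hn hκ hc0 hH hc
    obtain ⟨j, hj, hjE⟩ := exists_level_of_not_growing hn hκ hE fun ht => by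
      refine not_tendsto_of_memLp hn ht ?_
      have hu : MemLp u 2 := by simpa only [Measure.restrict_univ] using hH.1
      refine ((hu.ae_eq hc).const_mul c⁻¹).ae_eq (Eventually.of_forall fun x => ?_)
      simp only
      rw [inv_mul_cancel_left₀ hc0]
    refine ⟨j, hj, hjE, c, hc0, ?_⟩
    filter_upwards [hc] with x hx
    rw [space_profile_eq hn hκ hj hjE (norm_nonneg _), hx]
  · rintro ⟨j, hj, hjE, c, hc0, hc⟩
    have hc' : ∀ᵐ x, u x = c * regSol n κ E ‖x‖ := by
      filter_upwards [hc] with x hx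
      rw [hx, space_profile_eq hn hκ hj hjE (norm_nonneg _)]
    have hs : (fun x : Eucl n => c * regSol n κ E ‖x‖) =ᵐ[volume] u := by
      filter_upwards [hc'] with x hx using hx.symm
    exact ⟨⟨not_ae_zero_space hn hc0 hc', _,
      (isH1_regSol hn hj hκ hjE c).congr (ae_restrict_of_ae hs) (EventuallyEq.refl _ _),
      weakSolution_congr (isWeakSolution_regSol hn κ E c) hs⟩,
      fun r => c * regSol n κ E r, ae_restrict_of_ae hc'⟩

theorem radial_decayingSolution_iff (hκ : 0 < κ) (hE : E < 0) (u : Eucl n → ℝ) :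
    (IsDecayingSolution κ E u ∧ IsRadialOn Set.univ u) ↔
        ∃ j : ℕ, 1 ≤ j ∧ E = -κ ^ 2 / (4 * ((j : ℝ) + ((n : ℝ) - 3) / 2) ^ 2) ∧
          ∃ c : ℝ, c ≠ 0 ∧ ∀ᵐ x ∂(volume : Measure (Eucl n)),
            u x = c * (kummerM (a₀ n ((j : ℝ) + ((n : ℝ) - 3) / 2)) (b₀ ℝ n) (2 * √|E| * ‖x‖) *
              Real.exp (-(√|E| * ‖x‖))) := by
  constructor
  · rintro ⟨⟨hu0, ⟨G, hH, hw⟩, hdec⟩, hr⟩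
    obtain ⟨c, hc⟩ := hH.exists_eq_regSol hn hw hr
    have hc0 : c ≠ 0 := by
      rintro rfl
      exact hu0 (by filter_upwards [hc] with x hx; simp [hx])
    -- If |f| grew, |u| = |c f| would be at least 1 outside a ball, contradicting decay. The sign of
    -- E is given here, since the virial argument would need square integrability.
    obtain ⟨j, hj, hjE⟩ := exists_level_of_not_growing hn hκ hE fun ht => by
      obtain ⟨ρ, hρ⟩ := hdec 1 one_pos
      obtain ⟨r₀, hr₀⟩ := eventually_atTop.1 (ht.eventually_ge_atTop |c|⁻¹)
      have hcpos := abs_pos.2 hc0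
      have h0 : ∀ᵐ x : Eucl n, x ∉ {x : Eucl n | max ρ r₀ < ‖x‖} := by
        filter_upwards [hρ, hc] with x h1 h2 h3
        have h3' : max ρ r₀ < ‖x‖ := h3
        have h4 := h1 ((le_max_left _ _).trans_lt h3')
        rw [h2, abs_mul] at h4
        have h5 := mul_le_mul_of_nonneg_left (hr₀ ‖x‖ ((le_max_right _ _).trans h3'.le)) hcpos.le
        rw [mul_inv_cancel₀ hcpos.ne'] at h5
        linarith
      have := measure_eq_zero_iff_ae_notMem.2 h0
      rw [volume_compl_ball_eq_top hn] at this
      exact ENNReal.top_ne_zero this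
    refine ⟨j, hj, hjE, c, hc0, ?_⟩
    filter_upwards [hc] with x hx
    rw [space_profile_eq hn hκ hj hjE (norm_nonneg _), hx]
  · rintro ⟨j, hj, hjE, c, hc0, hc⟩
    have hc' : ∀ᵐ x, u x = c * regSol n κ E ‖x‖ := by
      filter_upwards [hc] with x hx
      rw [hx, space_profile_eq hn hκ hj hjE (norm_nonneg _)]
    have hs : (fun x : Eucl n => c * regSol n κ E ‖x‖) =ᵐ[volume] u := by
      filter_upwards [hc'] with x hx using hx.symm
    have hloc := isH1Loc_regSol hn κ E c
    have hloc' : IsH1Loc u (radGrad fun r => c * regSol n κ E r) :=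
      ⟨fun R => ⟨(hloc.1 R).1.ae_eq (ae_restrict_of_ae hs), (hloc.1 R).2⟩,
        hloc.2.congr (ae_restrict_of_ae hs) (EventuallyEq.refl _ _)⟩
    refine ⟨⟨not_ae_zero_space hn hc0 hc', ⟨_, hloc',
      weakSolution_congr (isWeakSolution_regSol hn κ E c) hs⟩, fun ε hε => ?_⟩,
      fun r => c * regSol n κ E r, ae_restrict_of_ae hc'⟩
    obtain ⟨C, s, hs0, hb⟩ := exists_exp_bound_regSol hn hj hκ hjE
    have ht : Tendsto (fun r => |c| * (C * Real.exp (-(s * r)))) atTop (𝓝 (|c| * (C * 0))) :=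
      ((Real.tendsto_exp_neg_atTop_nhds_zero.comp (tendsto_id.const_mul_atTop hs0)).const_mul C).const_mul |c|
    rw [mul_zero, mul_zero] at ht
    obtain ⟨r₀, hr₀⟩ := eventually_atTop.1 (ht.eventually_lt_const hε)
    refine ⟨max r₀ 0, ?_⟩
    filter_upwards [hc'] with x hx hxr
    rw [hx, abs_mul]
    refine lt_of_le_of_lt ?_ (hr₀ ‖x‖ ((le_max_left _ _).trans hxr.le))
    exact mul_le_mul_of_nonneg_left (hb _ ((le_max_right _ _).trans_lt hxr)).1 (abs_nonneg _)

theorem exists_polynomial_level (hκ : 0 < κ) {j : ℕ} (hj : 1 ≤ j)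
    (hE : E = -κ ^ 2 / (4 * ((j : ℝ) + ((n : ℝ) - 3) / 2) ^ 2)) :
    ∃ p : Polynomial ℝ, p.degree = ((j - 1 : ℕ) : WithBot ℕ) ∧ ∀ r : ℝ,
        kummerM (a₀ n ((j : ℝ) + ((n : ℝ) - 3) / 2)) (b₀ ℝ n) (2 * √|E| * r) = p.eval r := by
  have hn' : (2 : ℝ) ≤ n := by exact_mod_cast hn
  have hj' : (1 : ℝ) ≤ j := by exact_mod_cast hj
  have hz : 0 < (j : ℝ) + ((n : ℝ) - 3) / 2 := by linarith
  have hσ : 0 < √|E| := by rw [sqrt_abs_of_neg hκ hz hE]; positivity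
  have hb : b₀ ℝ n = (n : ℝ) - 1 := by simpa using b₀_eq (𝕂 := ℝ) n
  rw [hb]
  refine exists_polynomial_kummerM (by linarith) ?_ (by positivity)
  unfold a₀
  rw [Nat.cast_sub hj]
  push_cast
  ring

end Space

/-! ### Uniform exponential lower bounds for Kummer series. -/

section KummerLower

theorem kummerCoeff_nonneg {a b : ℝ} (ha : 0 ≤ a) (hb : 1 ≤ b) (k : ℕ) : 0 ≤ kummerCoeff a b k := by
  induction k with
  | zero => rw [kummerCoeff_zero]; exact zero_le_one
  | succ k ih => rw [kummerCoeff_succ]; positivity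

theorem kummerCoeff_mono {a a' b : ℝ} (ha : 0 ≤ a) (h : a ≤ a') (hb : 1 ≤ b) (k : ℕ) :
    kummerCoeff a b k ≤ kummerCoeff a' b k := by
  induction k with
  | zero => rw [kummerCoeff_zero, kummerCoeff_zero]
  | succ k ih =>
    rw [kummerCoeff_succ, kummerCoeff_succ]
    refine mul_le_mul ih (by gcongr) (by positivity) (kummerCoeff_nonneg (ha.trans h) hb k)

theorem kummerCoeff_le_one {a b : ℝ} (ha : 0 ≤ a) (h : a ≤ b) (hb : 1 ≤ b) (k : ℕ) :
    kummerCoeff a b k ≤ 1 := by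
  induction k with
  | zero => rw [kummerCoeff_zero]
  | succ k ih =>
    rw [kummerCoeff_succ]
    refine mul_le_one₀ ih (by positivity) (div_le_one_of_le₀ (by linarith) (by positivity))

/-- The ratios (a + k)/(b + k) tend to 1 and exceed q once k > b/(1 - q). The finitely many earlier
coefficients are positive and fix d as a minimum. -/
theorem exists_pow_le_kummerCoeff {a b q : ℝ} (ha : 0 < a) (hb : 1 ≤ b) (hq0 : 0 < q) (hq1 : q < 1) :
    ∃ d > 0, ∀ k, d * q ^ k ≤ kummerCoeff a b k := by
  have hpos : ∀ k, 0 < kummerCoeff a b k := fun k =>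
    (kummerCoeff_nonneg ha.le hb k).lt_of_ne' (kummerCoeff_ne_zero hb fun i _ => by positivity)
  obtain ⟨K, hK⟩ := exists_nat_gt (b / (1 - q))
  obtain ⟨i, -, hi⟩ := Finset.exists_min_image (Finset.range (K + 1))
    (fun k => kummerCoeff a b k / q ^ k) ⟨0, by simp⟩
  refine ⟨kummerCoeff a b i / q ^ i, div_pos (hpos i) (by positivity), fun k => ?_⟩
  rcases le_total k K with hk | hk
  · have := hi k (Finset.mem_range.2 (by omega))
    rwa [← le_div_iff₀ (by positivity)]
  · induction k, hk using Nat.le_induction with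
    | base =>
      have := hi K (Finset.mem_range.2 (by omega))
      rwa [← le_div_iff₀ (by positivity)]
    | succ k hk ih =>
      have hk' : (K : ℝ) ≤ k := by exact_mod_cast hk
      have hr : q ≤ (a + k) / (b + k) := by
        rw [le_div_iff₀ (by positivity)]
        rw [div_lt_iff₀ (by linarith)] at hK
        nlinarith
      rw [kummerCoeff_succ, pow_succ, ← mul_assoc]
      exact mul_le_mul ih hr hq0.le (hpos k).le

theorem hasSum_exp_succ (x : ℝ) :
    HasSum (fun j : ℕ => x ^ (j + 1) / ((j + 1).factorial : ℝ)) (Real.exp x - 1) := by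
  have h := NormedSpace.expSeries_div_hasSum_exp x
  rw [← Real.exp_eq_exp_ℝ] at h
  have := (hasSum_nat_add_iff' 1).2 h
  simpa using this

/-- A uniform exponential lower bound for weighted Kummer series. -/
theorem exists_exp_le_of_hasSum {b : ℝ} (hb : 1 ≤ b) {η : ℝ} (hη : 0 < η) (W : ℝ) (K : ℕ) {q : ℝ}
    (hq0 : 0 < q) (hq1 : q < 1) : ∃ ρ₀ > 0, ∀ ρ ≥ ρ₀, ∀ a ∈ Set.Icc (-1 / 2) b, ∀ w : ℕ → ℝ,
      (∀ k ≥ K, η ≤ w k) → (∀ k, -W ≤ w k) → ∀ S : ℝ,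
      HasSum (fun j : ℕ => kummerCoeff (a + 1) (b + 1) j * w (j + 1) *
        (ρ ^ (j + 1) / ((j + 1).factorial : ℝ))) S → Real.exp (q * ρ) ≤ S := by
  -- The tail is compared with e^{q'ρ} for a rate q' between q and 1. The gap q' - q pays for
  -- constants and for the polynomial of the first K terms.
  set q' := (1 + q) / 2 with hq'
  have hq'0 : 0 < q' := by rw [hq']; linarith
  have hq'1 : q' < 1 := by rw [hq']; linarith
  have hqq : 0 < q' - q := by rw [hq']; linarith
  -- The parameter 1/2 is the smallest value of a + 1 for a ≥ -1/2. Monotonicity of the coefficients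
  -- in the parameter makes d independent of a.
  obtain ⟨d, hd, hdk⟩ := exists_pow_le_kummerCoeff (a := 1 / 2) (b := b + 1) (q := q') (by norm_num)
    (by linarith) hq'0 hq'1
  set W' := |W| with hW'
  -- In the first K terms the weights may be negative. Since the coefficients lie in [0, 1] when a +
  -- 1 ≤ b + 1, each term together with its comparison term loses at most W' + dη.
  set P : Polynomial ℝ := ∑ j ∈ Finset.range K,
    Polynomial.C ((W' + d * η) / ((j + 1).factorial : ℝ)) * Polynomial.X ^ (j + 1) with hP
  have hlim : Tendsto (fun ρ => d * η / q' * (1 - Real.exp (-(q' * ρ)))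
      - P.eval ρ * Real.exp (-(q' * ρ)) - Real.exp (-((q' - q) * ρ))) atTop
      (𝓝 (d * η / q' * (1 - 0) - 0 - 0)) :=
    (((tendsto_const_nhds.sub (Real.tendsto_exp_neg_atTop_nhds_zero.comp
      (tendsto_id.const_mul_atTop hq'0))).const_mul _).sub (tendsto_eval_mul_exp P hq'0)).sub
      (Real.tendsto_exp_neg_atTop_nhds_zero.comp (tendsto_id.const_mul_atTop hqq))
  have hpos : 0 < d * η / q' * (1 - 0) - 0 - 0 := by
    rw [sub_zero, sub_zero, sub_zero, mul_one]; positivity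
  obtain ⟨ρ₁, hρ₁⟩ := eventually_atTop.1 (hlim.eventually_const_lt hpos)
  refine ⟨max ρ₁ 1, by positivity, fun ρ hρ a ha w hw1 hw2 S hS => ?_⟩
  have hρ0 : 0 < ρ := by linarith [(le_max_right ρ₁ 1).trans hρ]
  have key := hρ₁ ρ ((le_max_left _ _).trans hρ)
  have hs := (hasSum_exp_succ (q' * ρ)).mul_left (d * η / q')
  have hdiff := hS.sub hs
  have hlow := sum_le_hasSum (Finset.range K) (fun j hj => ?_) hdiff
  · have hsum : -P.eval ρ ≤ ∑ j ∈ Finset.range K, (kummerCoeff (a + 1) (b + 1) j * w (j + 1) *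
        (ρ ^ (j + 1) / ((j + 1).factorial : ℝ))
        - d * η / q' * ((q' * ρ) ^ (j + 1) / ((j + 1).factorial : ℝ))) := by
      rw [hP, Polynomial.eval_finsetSum, ← Finset.sum_neg_distrib]
      refine Finset.sum_le_sum fun j _ => ?_
      simp only [Polynomial.eval_mul, Polynomial.eval_C, Polynomial.eval_pow, Polynomial.eval_X]
      have hX : 0 < ρ ^ (j + 1) / ((j + 1).factorial : ℝ) := by positivity
      have e : d * η / q' * ((q' * ρ) ^ (j + 1) / ((j + 1).factorial : ℝ))
          = d * η * q' ^ j * (ρ ^ (j + 1) / ((j + 1).factorial : ℝ)) := by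
        rw [mul_pow, pow_succ q']
        field_simp
      have e2 : (W' + d * η) / ((j + 1).factorial : ℝ) * ρ ^ (j + 1)
          = (W' + d * η) * (ρ ^ (j + 1) / ((j + 1).factorial : ℝ)) := by ring
      rw [e, e2, ← sub_mul, ← neg_mul]
      refine mul_le_mul_of_nonneg_right ?_ hX.le
      have p0 : 0 ≤ kummerCoeff (a + 1) (b + 1) j :=
        kummerCoeff_nonneg (by linarith [ha.1]) (by linarith) j
      have p1 : kummerCoeff (a + 1) (b + 1) j ≤ 1 :=
        kummerCoeff_le_one (by linarith [ha.1]) (by linarith [ha.2]) (by linarith) j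
      have h1 : -W' ≤ kummerCoeff (a + 1) (b + 1) j * w (j + 1) := by
        have h2 : -W' ≤ w (j + 1) := (neg_le_neg (le_abs_self W)).trans (hw2 _)
        have h3 : 0 ≤ W' := abs_nonneg W
        nlinarith
      have h4 : d * η * q' ^ j ≤ d * η :=
        mul_le_of_le_one_right (by positivity) (pow_le_one₀ hq'0.le hq'1.le)
      linarith
    have hE := hsum.trans hlow
    have hmul := mul_pos key (Real.exp_pos (q' * ρ))
    have x1 : Real.exp (-(q' * ρ)) * Real.exp (q' * ρ) = 1 := by
      rw [← Real.exp_add]; simp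
    have x2 : Real.exp (-((q' - q) * ρ)) * Real.exp (q' * ρ) = Real.exp (q * ρ) := by
      rw [← Real.exp_add]; ring_nf
    have e3 : (d * η / q' * (1 - Real.exp (-(q' * ρ)))
      - P.eval ρ * Real.exp (-(q' * ρ)) - Real.exp (-((q' - q) * ρ))) * Real.exp (q' * ρ)
      = d * η / q' * (Real.exp (q' * ρ) - 1) - P.eval ρ - Real.exp (q * ρ) := by
      linear_combination (-(d * η / q') - P.eval ρ) * x1 - x2
    rw [e3] at hmul
    linarith
  · have hj' : K ≤ j := by simpa using hj
    have hX : 0 < ρ ^ (j + 1) / ((j + 1).factorial : ℝ) := by positivity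
    have e : d * η / q' * ((q' * ρ) ^ (j + 1) / ((j + 1).factorial : ℝ))
        = d * q' ^ j * η * (ρ ^ (j + 1) / ((j + 1).factorial : ℝ)) := by
      rw [mul_pow, pow_succ q']
      field_simp
    rw [e, ← sub_mul]
    refine mul_nonneg ?_ hX.le
    have h1 : d * q' ^ j ≤ kummerCoeff (a + 1) (b + 1) j :=
      (hdk j).trans (kummerCoeff_mono (by norm_num) (by linarith [ha.1]) (by linarith) j)
    have h2 := hw1 (j + 1) (by omega)
    have h3 : d * q' ^ j * η ≤ kummerCoeff (a + 1) (b + 1) j * w (j + 1) :=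
      mul_le_mul h1 h2 hη.le ((by positivity : (0 : ℝ) ≤ d * q' ^ j).trans h1)
    linarith

end KummerLower

/-! ### The smallest positive solution of the transcendental equation. -/

section TransFun

/-- The difference of the two sides of the transcendental equation. -/
noncomputable def transFun (n : ℕ) (κ : ℝ) (γ : WithTop ℝ) (R z : ℝ) : ℝ :=
  match γ with
  | ⊤ => kummerM (a₀ n z) (b₀ ℝ n) (κ * R / z)
  | (c : ℝ) => 2 * (a₀ n z / b₀ ℝ n) * kummerM (a₀ n z + 1) (b₀ ℝ n + 1) (κ * R / z)
      - (1 - 2 * c * z / κ) * kummerM (a₀ n z) (b₀ ℝ n) (κ * R / z)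

theorem transEq_iff_transFun {n : ℕ} {κ : ℝ} {γ : WithTop ℝ} {R z : ℝ} :
    TransEq n κ γ R z ↔ transFun n κ γ R z = 0 := by
  induction γ using WithTop.recTopCoe with
  | top => exact Iff.rfl
  | coe c => exact sub_eq_zero.symm

/-- The weights of the Kummer coefficients in the expansion of `transFun`. -/
noncomputable def transWeight (n : ℕ) (κ : ℝ) (γ : WithTop ℝ) (z : ℝ) (k : ℕ) : ℝ :=
  match γ with
  | ⊤ => 1
  | (c : ℝ) => 2 * ((a₀ n z + k) / ((n : ℝ) - 1 + k)) - (1 - 2 * c * z / κ)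

theorem b₀_real (n : ℕ) : b₀ ℝ n = (n : ℝ) - 1 := by simpa using b₀_eq (𝕂 := ℝ) n

theorem a₀_real (n : ℕ) (z : ℝ) : a₀ n z = ((n : ℝ) - 1) / 2 - z := by unfold a₀; ring

variable {n : ℕ} (hn : 2 ≤ n) {κ : ℝ} {γ : WithTop ℝ} {R z : ℝ}
include hn

theorem one_le_natCast_sub_one : (1 : ℝ) ≤ (n : ℝ) - 1 := by
  have : (2 : ℝ) ≤ n := by exact_mod_cast hn
  linarith

/-- The shifted coefficient is (a₀ + k)/(b + k) times the unshifted one, so both sides of the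
equation merge into one weighted Kummer series. -/
theorem hasSum_transFun : HasSum (fun k : ℕ => kummerCoeff (a₀ n z) ((n : ℝ) - 1) k *
    transWeight n κ γ z k * ((κ * R / z) ^ k / (k.factorial : ℝ))) (transFun n κ γ R z) := by
  have hb := one_le_natCast_sub_one hn
  have hM : HasSum (fun k : ℕ => kummerCoeff (a₀ n z) ((n : ℝ) - 1) k *
      ((κ * R / z) ^ k / (k.factorial : ℝ))) (kummerM (a₀ n z) ((n : ℝ) - 1) (κ * R / z)) :=
    (expBounded_kummerCoeff (𝕂 := ℝ) (a₀ n z) hb).hasSum (κ * R / z)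
  have hM1 : HasSum (fun k : ℕ => kummerCoeff (a₀ n z) ((n : ℝ) - 1) (k + 1) *
      ((κ * R / z) ^ k / (k.factorial : ℝ)))
      (a₀ n z / ((n : ℝ) - 1) * kummerM (a₀ n z + 1) ((n : ℝ) - 1 + 1) (κ * R / z)) := by
    rw [← egf_kummerCoeff_shift]
    exact (expBounded_kummerCoeff (𝕂 := ℝ) (a₀ n z) hb).shift.hasSum (κ * R / z)
  induction γ using WithTop.recTopCoe with
  | top =>
    simp only [transFun, transWeight, b₀_real, mul_one]
    exact hM
  | coe c =>
    simp only [transFun, transWeight, b₀_real]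
    have h := (hM1.mul_left 2).sub (hM.mul_left (1 - 2 * c * z / κ))
    rw [← mul_assoc] at h
    have e : (fun k : ℕ => kummerCoeff (a₀ n z) ((n : ℝ) - 1) k *
        (2 * ((a₀ n z + k) / ((n : ℝ) - 1 + k)) - (1 - 2 * c * z / κ)) *
        ((κ * R / z) ^ k / (k.factorial : ℝ)))
        = fun k => 2 * (kummerCoeff (a₀ n z) ((n : ℝ) - 1) (k + 1) *
          ((κ * R / z) ^ k / (k.factorial : ℝ))) - (1 - 2 * c * z / κ) *
          (kummerCoeff (a₀ n z) ((n : ℝ) - 1) k * ((κ * R / z) ^ k / (k.factorial : ℝ))) := by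
      funext k
      rw [kummerCoeff_succ]
      ring
    rw [e]
    exact h

/-- Every coefficient of positive index contains the factor a₀/b. Dividing by it leaves a series
that does not degenerate as z approaches (n-1)/2. -/
theorem hasSum_transFun_succ (hz : a₀ n z ≠ 0) :
    HasSum (fun j : ℕ => kummerCoeff (a₀ n z + 1) ((n : ℝ) - 1 + 1) j *
      transWeight n κ γ z (j + 1) * ((κ * R / z) ^ (j + 1) / ((j + 1).factorial : ℝ)))
      ((transFun n κ γ R z - transWeight n κ γ z 0) * (((n : ℝ) - 1) / a₀ n z)) := by
  have hb := one_le_natCast_sub_one hn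
  have h := ((hasSum_nat_add_iff' 1).2 (hasSum_transFun hn (κ := κ) (γ := γ) (R := R) (z := z))).mul_right
    (((n : ℝ) - 1) / a₀ n z)
  simp only [Finset.sum_range_one, kummerCoeff_zero, pow_zero, Nat.factorial_zero, Nat.cast_one,
    div_one, one_mul, mul_one] at h
  have e : (fun j : ℕ => kummerCoeff (a₀ n z + 1) ((n : ℝ) - 1 + 1) j *
      transWeight n κ γ z (j + 1) * ((κ * R / z) ^ (j + 1) / ((j + 1).factorial : ℝ)))
      = fun j => kummerCoeff (a₀ n z) ((n : ℝ) - 1) (j + 1) * transWeight n κ γ z (j + 1) *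
        ((κ * R / z) ^ (j + 1) / ((j + 1).factorial : ℝ)) * (((n : ℝ) - 1) / a₀ n z) := by
    funext j
    rw [kummerCoeff_succ']
    have : (n : ℝ) - 1 ≠ 0 := by linarith
    field_simp
  rw [e]
  exact h

/-- For finite γ the weights tend to 1 + 2γz/κ as k grows. This limit is bounded below by a positive
constant: if γ < 0, because z ≤ (n-1)/2 and γ > -κ/(n-1), and otherwise trivially. This is where the
lower bound on γ enters. -/
theorem exists_transWeight_bounds (hκ : 0 < κ) (hγ : ((-κ / ((n : ℝ) - 1) : ℝ) : WithTop ℝ) < γ) :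
    ∃ η W : ℝ, ∃ K : ℕ, 0 < η ∧ 0 < W ∧ ∀ z, 0 < z → z ≤ ((n : ℝ) - 1) / 2 + 1 / 2 →
      (z ≤ ((n : ℝ) - 1) / 2 ∨ ((0 : ℝ) : WithTop ℝ) ≤ γ) →
      (∀ k ≥ K, η ≤ transWeight n κ γ z k) ∧ (∀ k, -W ≤ transWeight n κ γ z k) ∧
        transWeight n κ γ z 0 ≤ W := by
  have hb := one_le_natCast_sub_one hn
  set b := (n : ℝ) - 1 with hbdef
  induction γ using WithTop.recTopCoe with
  | top =>
    refine ⟨1, 1, 0, one_pos, one_pos, fun z _ _ _ => ⟨fun k _ => le_rfl, fun k => ?_, le_rfl⟩⟩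
    simp only [transWeight]; norm_num
  | coe c =>
    have hc : -κ / b < c := by exact_mod_cast hγ
    have hc1 : 0 < 1 + c * b / κ := by
      rw [div_lt_iff₀ (by linarith)] at hc
      have : (0 : ℝ) < (κ + c * b) / κ := div_pos (by linarith) hκ
      rwa [add_div, div_self hκ.ne'] at this
    -- Half of the lower bound for the limit weight, so that a deviation of at most η for k ≥ K
    -- still leaves η.
    set η := min 1 (1 + c * b / κ) / 2 with hη
    have hη0 : 0 < η := half_pos (lt_min one_pos hc1)
    obtain ⟨K, hK⟩ := exists_nat_gt (2 * (b + 1 / 2) / η)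
    have hWn : 0 ≤ |c| * (b + 1) / κ := by positivity
    refine ⟨η, 3 + |c| * (b + 1) / κ, K, hη0, by positivity, fun z hz0 hz hcase => ?_⟩
    have ha : a₀ n z = b / 2 - z := a₀_real n z
    have hcz : |2 * c * z / κ| ≤ |c| * (b + 1) / κ := by
      rw [abs_div, abs_mul, abs_mul, abs_of_pos hκ, abs_of_pos hz0, abs_two]
      gcongr ?_ / κ
      nlinarith [abs_nonneg c]
    have hcz' := abs_le.1 hcz
    have hup : ∀ k : ℕ, (a₀ n z + k) / (b + k) ≤ 1 := fun k =>
      div_le_one_of_le₀ (by rw [ha]; linarith) (by positivity)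
    refine ⟨fun k hk => ?_, fun k => ?_, ?_⟩
    · have hk' : (K : ℝ) ≤ k := by exact_mod_cast hk
      have h1 : 2 * ((a₀ n z + k) / (b + k)) = 2 - 2 * (b / 2 + z) / (b + k) := by
        have : b + k ≠ 0 := by positivity
        rw [ha]
        field_simp
        ring
      have h2 : 2 * (b / 2 + z) / (b + k) ≤ η := by
        rw [div_le_iff₀ (by positivity)]
        rw [div_lt_iff₀ hη0] at hK
        nlinarith
      have h3 : 2 * η ≤ 1 + 2 * c * z / κ := by
        have e : 2 * η = min 1 (1 + c * b / κ) := by rw [hη]; ring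
        rw [e]
        rcases le_or_gt 0 c with h | h
        · refine (min_le_left _ _).trans ?_
          have : 0 ≤ 2 * c * z / κ := by positivity
          linarith
        · have hzb : z ≤ b / 2 := by
            rcases hcase with h' | h'
            · exact h'
            · have h'' : (0 : ℝ) ≤ c := by exact_mod_cast h'
              linarith
          refine (min_le_right _ _).trans ?_
          have : c * b / κ ≤ 2 * c * z / κ := by
            gcongr ?_ / κ
            nlinarith
          linarith
      simp only [transWeight]
      rw [← hbdef, h1]
      linarith
    · have h1 : -1 / 2 ≤ (a₀ n z + k) / (b + k) := by
        rw [le_div_iff₀ (by positivity), ha]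
        have : (0 : ℝ) ≤ k := k.cast_nonneg
        nlinarith
      simp only [transWeight]
      rw [← hbdef]
      linarith [hcz'.1]
    · have := hup 0
      simp only [transWeight]
      rw [← hbdef]
      linarith [hcz'.2]

omit hn in
theorem kummerM_zero_left (b x : ℝ) : kummerM 0 b x = 1 := by
  rw [kummerM_eq_egf]
  unfold egf
  rw [tsum_eq_single 0 fun k hk => ?_]
  · simp [kummerCoeff_zero]
  · rw [kummerCoeff_eq_zero (j := 0) (by simp) (Nat.pos_of_ne_zero hk), zero_mul]

/-- At z = (n-1)/2 one has a₀ = 0 and M = 1, so for finite γ the difference of the two sides is -(1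
- γ(n-1)/κ). The threshold κ/(n-1) decides whether this point already has the required sign. -/
theorem transFun_half (hκ : 0 < κ) (γ : WithTop ℝ) (R : ℝ) :
    transFun n κ γ R (((n : ℝ) - 1) / 2) ≤ 0 ∨ ((κ / ((n : ℝ) - 1) : ℝ) : WithTop ℝ) ≤ γ := by
  have hb := one_le_natCast_sub_one hn
  induction γ using WithTop.recTopCoe with
  | top => exact Or.inr le_top
  | coe c =>
    rcases le_or_gt (κ / ((n : ℝ) - 1)) c with h | h
    · exact Or.inr (by exact_mod_cast h)
    · left
      simp only [transFun]
      have ha : a₀ n (((n : ℝ) - 1) / 2) = 0 := by rw [a₀_real, sub_self]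
      rw [ha, kummerM_zero_left, zero_div, mul_zero, zero_mul, zero_sub, mul_one, neg_nonpos,
        sub_nonneg, div_le_one hκ]
      rw [lt_div_iff₀ (by linarith)] at h
      linarith

theorem continuousOn_transFun (κ : ℝ) (γ : WithTop ℝ) (R : ℝ) :
    ContinuousOn (transFun n κ γ R) (Set.Ioi 0) := by
  have hb := one_le_natCast_sub_one hn
  have hz : ∀ z ∈ Set.Ioi (0 : ℝ), z ≠ 0 := fun z hz => ne_of_gt hz
  have hρ : ContinuousOn (fun z => κ * R / z) (Set.Ioi 0) := continuousOn_const.div continuousOn_id hz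
  have ha : Continuous fun z : ℝ => a₀ n z := by unfold a₀; fun_prop
  have hM : ContinuousOn (fun z => kummerM (a₀ n z) ((n : ℝ) - 1) (κ * R / z)) (Set.Ioi 0) :=
    (continuous_kummerM (𝕂 := ℝ) hb).comp_continuousOn (ha.continuousOn.prodMk hρ)
  have hM1 : ContinuousOn (fun z => kummerM (a₀ n z + 1) ((n : ℝ) - 1 + 1) (κ * R / z)) (Set.Ioi 0) :=
    (continuous_kummerM (𝕂 := ℝ) (b := (n : ℝ) - 1 + 1) (by linarith)).comp_continuousOn
      ((ha.add continuous_const).continuousOn.prodMk hρ)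
  unfold transFun
  rw [b₀_real]
  induction γ using WithTop.recTopCoe with
  | top => exact hM
  | coe c =>
    have h1 : ContinuousOn (fun z => 2 * (a₀ n z / ((n : ℝ) - 1))) (Set.Ioi 0) :=
      Continuous.continuousOn (by fun_prop)
    have h2 : ContinuousOn (fun z => 1 - 2 * c * z / κ) (Set.Ioi 0) :=
      Continuous.continuousOn (by fun_prop)
    exact (h1.mul hM1).sub (h2.mul hM)

omit hn in
/-- The first zero of a continuous function which is positive near `0`. -/
theorem exists_isLeast_zero {T : ℝ → ℝ} (hT : ContinuousOn T (Set.Ioi 0)) {z₀ y : ℝ} (hz₀ : 0 < z₀)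
    (hpos : ∀ z, 0 < z → z ≤ z₀ → 0 < T z) (hy : z₀ < y) (hTy : T y ≤ 0) :
    ∃ z, z₀ < z ∧ z ≤ y ∧ IsLeast {ζ | 0 < ζ ∧ T ζ = 0} z := by
  have hsub : Set.Icc z₀ y ⊆ Set.Ioi 0 := fun z hz => hz₀.trans_le hz.1
  have hc := hT.mono hsub
  obtain ⟨z', hz', hTz'⟩ := intermediate_value_Icc' hy.le hc ⟨hTy, (hpos z₀ hz₀ le_rfl).le⟩
  have hcl : IsClosed (Set.Icc z₀ y ∩ T ⁻¹' {0}) := hc.preimage_isClosed_of_isClosed isClosed_Icc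
    isClosed_singleton
  obtain ⟨z, hz, hmin⟩ := (isCompact_Icc.of_isClosed_subset hcl Set.inter_subset_left).exists_isLeast
    ⟨z', hz', hTz'⟩
  have h0 : T z = 0 := hz.2
  have hlt : z₀ < z := by
    refine lt_of_le_of_ne hz.1.1 fun h => ?_
    have := hpos z₀ hz₀ le_rfl
    rw [h, h0] at this
    exact lt_irrefl _ this
  refine ⟨z, hlt, hz.1.2, ⟨hz₀.trans hlt, h0⟩, fun ζ hζ => ?_⟩
  rcases le_or_gt ζ z₀ with h | h
  · exact absurd hζ.2 (hpos ζ hζ.1 h).ne'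
  · rcases le_or_gt ζ y with h' | h'
    · exact hmin ⟨⟨h.le, h'⟩, hζ.2⟩
    · exact hz.1.2.trans h'.le

/-- The transcendental equation has a smallest positive solution for large `R`, exponentially
close to `(n - 1) / 2`. -/
theorem exists_isLeast_transEq (hκ : 0 < κ) (hγ : ((-κ / ((n : ℝ) - 1) : ℝ) : WithTop ℝ) < γ)
    {q : ℝ} (hq0 : 0 < q) (hq1 : q < 1) : ∀ᶠ R in atTop, ∃ z z₀ : ℝ, 0 < z₀ ∧ z₀ < z ∧
      0 < transFun n κ γ R z₀ ∧ IsLeast {ζ : ℝ | 0 < ζ ∧ TransEq n κ γ R ζ} z ∧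
      |z - ((n : ℝ) - 1) / 2| ≤ Real.exp (-(q * (2 * κ * R / ((n : ℝ) - 1)))) ∧
      z < ((n : ℝ) - 1) / 2 + 1 / 2 ∧
      (z ≤ ((n : ℝ) - 1) / 2 ∨ ((κ / ((n : ℝ) - 1) : ℝ) : WithTop ℝ) ≤ γ) := by
  have hb := one_le_natCast_sub_one hn
  obtain ⟨η, W, K, hη, hW, hw⟩ := exists_transWeight_bounds hn hκ hγ
  set b := (n : ℝ) - 1 with hbdef
  have hb0 : 0 < b := by linarith
  -- The series grows at rate p > q, while the distance from b/2 is δ = e^{-qt}; the product δ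
  -- e^{pt} is still exponentially large.
  set p := (1 + q) / 2 with hp
  have hp1 : p < 1 := by rw [hp]; linarith
  have hqp : q < p := by rw [hp]; linarith
  obtain ⟨ρ₀, hρ₀, hS⟩ := exists_exp_le_of_hasSum (b := b) hb hη W K (q := p) (by linarith) hp1
  -- `t = 2 κ R / (n - 1)` is the value of `ρ` at `z = (n - 1) / 2`
  have hev : ∀ᶠ t : ℝ in atTop, 2 * ρ₀ ≤ t ∧ Real.exp (-(q * t)) < min (1 / 4) (b * (p - q) / 4) ∧
      b * W < Real.exp ((p - q) / 2 * t) := by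
    refine (eventually_ge_atTop _).and (Eventually.and ?_ ?_)
    · refine (Real.tendsto_exp_neg_atTop_nhds_zero.comp
        (tendsto_id.const_mul_atTop hq0)).eventually_lt_const (lt_min (by norm_num) ?_)
      have : 0 < p - q := by linarith
      positivity
    · exact (Real.tendsto_exp_atTop.comp (tendsto_id.const_mul_atTop
        (by linarith : 0 < (p - q) / 2))).eventually_gt_atTop _
  have htend : Tendsto (fun R => 2 * κ * R / b) atTop atTop :=
    (tendsto_id.const_mul_atTop (by positivity : 0 < 2 * κ)).atTop_div_const hb0
  filter_upwards [htend.eventually hev, eventually_gt_atTop 0] with R hR hR0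
  obtain ⟨ht0, hδ, hbW⟩ := hR
  set t := 2 * κ * R / b with ht
  set δ := Real.exp (-(q * t)) with hδdef
  have hδ0 : 0 < δ := Real.exp_pos _
  have hδ1 : δ < 1 / 4 := hδ.trans_le (min_le_left _ _)
  have hδ2 : δ < b * (p - q) / 4 := hδ.trans_le (min_le_right _ _)
  have htpos : 0 < t := by positivity
  have hκR : κ * R = t * (b / 2) := by rw [ht]; field_simp
  -- Here a₀ ≥ δ and ρ ≥ t, so T exceeds its zeroth term by at least δ e^{pt}/b, which is more than
  -- W. Smaller z only increases ρ and a₀, which makes the bound uniform down to 0.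
  have hlower : ∀ z, 0 < z → z ≤ b / 2 - δ → 0 < transFun n κ γ R z := by
    intro z hz0 hz
    have ha : a₀ n z = b / 2 - z := a₀_real n z
    have haδ : δ ≤ a₀ n z := by linarith
    have ha0 : 0 < a₀ n z := hδ0.trans_le haδ
    obtain ⟨w1, w2, w3⟩ := hw z hz0 (by linarith) (Or.inl (by linarith))
    have hρ : t ≤ κ * R / z := by
      rw [le_div_iff₀ hz0, hκR]
      exact mul_le_mul_of_nonneg_left (by linarith) htpos.le
    have h := hS (κ * R / z) (by linarith) (a₀ n z) ⟨by linarith, by rw [ha]; linarith⟩ _ w1 w2 _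
      (hasSum_transFun_succ hn (R := R) ha0.ne')
    have h1 : Real.exp (p * t) ≤ Real.exp (p * (κ * R / z)) :=
      Real.exp_le_exp.2 (mul_le_mul_of_nonneg_left hρ (by linarith))
    rw [← hbdef, ← mul_div_assoc (transFun n κ γ R z - transWeight n κ γ z 0), le_div_iff₀ ha0] at h
    have h2 : Real.exp (p * t) * δ ≤ Real.exp (p * (κ * R / z)) * a₀ n z :=
      mul_le_mul h1 haδ hδ0.le (Real.exp_nonneg _)
    have h3 : Real.exp (p * t) * δ = Real.exp ((p - q) / 2 * t) * Real.exp ((p - q) / 2 * t) := by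
      rw [hδdef, ← Real.exp_add, ← Real.exp_add]; ring_nf
    have h4 : 1 ≤ Real.exp ((p - q) / 2 * t) :=
      Real.one_le_exp (mul_nonneg (by linarith) htpos.le)
    have h5 : b * W < (transFun n κ γ R z - transWeight n κ γ z 0) * b := by nlinarith
    have h6 := w2 0
    have h7 : W < transFun n κ γ R z - transWeight n κ γ z 0 := by
      rw [mul_comm] at h5
      exact lt_of_mul_lt_mul_right h5 hb0.le
    linarith
  have hupper : ∃ y, b / 2 ≤ y ∧ y ≤ b / 2 + δ ∧ transFun n κ γ R y ≤ 0 ∧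
      (y ≤ b / 2 ∨ ((κ / b : ℝ) : WithTop ℝ) ≤ γ) := by
    rcases transFun_half hn hκ γ R with h | h
    · exact ⟨b / 2, le_rfl, by linarith, h, Or.inl le_rfl⟩
    · refine ⟨b / 2 + δ, by linarith, le_rfl, ?_, Or.inr h⟩
      set z := b / 2 + δ with hz
      have hz0 : 0 < z := by positivity
      have ha : a₀ n z = -δ := by rw [a₀_real n z, hz]; ring
      have hγ0 : ((0 : ℝ) : WithTop ℝ) ≤ γ := le_trans (by
        have : (0 : ℝ) ≤ κ / b := by positivity
        exact WithTop.coe_le_coe.2 this) h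
      obtain ⟨w1, w2, w3⟩ := hw z hz0 (by linarith) (Or.inr hγ0)
      -- To the right of b/2 the argument ρ is slightly smaller than t. The loss lowers the exponent
      -- pt at most to (p + q)t/2.
      have hρ : (1 - 2 * δ / b) * t ≤ κ * R / z := by
        rw [le_div_iff₀ hz0, hκR, hz]
        have : (1 - 2 * δ / b) * t * (b / 2 + δ) = t * (b / 2) - 2 * δ ^ 2 / b * t := by
          field_simp
          ring
        rw [this]
        have : 0 ≤ 2 * δ ^ 2 / b * t := by positivity
        linarith
      have hδb : 2 * δ / b < (p - q) / 2 := by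
        rw [div_lt_iff₀ hb0]; linarith
      have hρ2 : ρ₀ ≤ κ * R / z := by
        refine le_trans ?_ hρ
        nlinarith
      have hs := hS (κ * R / z) hρ2 (a₀ n z) ⟨by rw [ha]; linarith, by rw [ha]; linarith⟩ _ w1 w2 _
        (hasSum_transFun_succ hn (R := R) (by rw [ha]; linarith))
      have h1 : Real.exp ((p + q) / 2 * t) ≤ Real.exp (p * (κ * R / z)) := by
        refine Real.exp_le_exp.2 ?_
        have h8 : p * ((1 - 2 * δ / b) * t) ≤ p * (κ * R / z) :=
          mul_le_mul_of_nonneg_left hρ (by linarith)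
        refine le_trans ?_ h8
        rw [← mul_assoc]
        refine mul_le_mul_of_nonneg_right ?_ htpos.le
        nlinarith [div_pos (mul_pos two_pos hδ0) hb0]
      rw [← hbdef, ha] at hs
      have h3 : Real.exp ((p + q) / 2 * t) * δ = Real.exp ((p - q) / 2 * t) := by
        rw [hδdef, ← Real.exp_add]; ring_nf
      have h4 : (transFun n κ γ R z - transWeight n κ γ z 0) * (b / -δ) * δ
          = -((transFun n κ γ R z - transWeight n κ γ z 0) * b) := by
        field_simp
      have h5 := mul_le_mul_of_nonneg_right (h1.trans hs) hδ0.le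
      rw [h3, h4] at h5
      have h7 : (transFun n κ γ R z - transWeight n κ γ z 0) * b < -W * b := by linarith
      have h8 := lt_of_mul_lt_mul_right h7 hb0.le
      linarith
  obtain ⟨y, hy1, hy2, hTy, hcase⟩ := hupper
  obtain ⟨z, hz1, hz2, hz3⟩ := exists_isLeast_zero (continuousOn_transFun hn κ γ R)
    (z₀ := b / 2 - δ) (by linarith) hlower (by linarith) hTy
  refine ⟨z, b / 2 - δ, by linarith, hz1, hlower _ (by linarith) le_rfl, ?_, ?_, by linarith, ?_⟩
  · simpa only [transEq_iff_transFun] using hz3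
  · rw [abs_le]
    constructor <;> linarith
  · exact hcase.imp_left fun h => hz2.trans h

end TransFun

/-! ### Jacobi's inequality and lower bounds for all eigenvalues. -/

section Jacobi

variable {n : ℕ} (hn : 2 ≤ n) {κ E R : ℝ} (hR : 0 ≤ R)
  (hf : ∀ r ∈ Set.Icc 0 R, 0 < regSol n κ E r)
include hn hR hf

/-- Jacobi's inequality: a positive solution bounds the quadratic form from below. -/
theorem schroForm_self_ge_of_contDiff {ψ : Eucl n → ℝ} (hψ : ContDiff ℝ ∞ ψ) :
    regSol' n κ E R / regSol n κ E R * ∫ x, ψ x * ψ x ∂(surf n R)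
      ≤ schroForm (B n R) κ E ψ (gradient ψ) ψ (gradient ψ) := by
  have hcf := continuous_regSol hn κ E
  have hcf' := continuous_regSol' hn κ E
  have hg := continuous_gradient hψ
  have hψc := hψ.continuous
  -- The logarithmic derivative f'/f, with its argument clamped to [0, R] so that it is continuous
  -- on all of ℝ.
  set w : ℝ → ℝ := fun r => regSol' n κ E (max 0 (min r R)) / regSol n κ E (max 0 (min r R)) with hw
  have hwc : Continuous w := Continuous.div (by fun_prop) (by fun_prop) fun r =>
    (hf _ ⟨le_max_left _ _, max_le hR (min_le_right _ _)⟩).ne'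
  have hwr : ∀ r ∈ Set.Icc 0 R, w r = regSol' n κ E r / regSol n κ E r := fun r hr => by
    simp only [hw, min_eq_left hr.2, max_eq_right hr.1]
  have i0 : Integrable (fun x => inner ℝ (gradient ψ x) (gradient ψ x)) (volume.restrict (B n R)) :=
    integrable_ball_of_continuous (by fun_prop) R
  have i1 : Integrable (fun x => 2 * w ‖x‖ * ψ x * inner ℝ (gradient ψ x) x / ‖x‖
      - (w ‖x‖ * ψ x) ^ 2) (volume.restrict (B n R)) :=
    (integrable_div_norm hn (by fun_prop) R).sub (integrable_ball_of_continuous (by fun_prop) R)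
  have i2 : Integrable (fun x => ψ x * ψ x / ‖x‖) (volume.restrict (B n R)) :=
    integrable_div_norm hn (by fun_prop) R
  have i3 : Integrable (fun x => ψ x * ψ x) (volume.restrict (B n R)) :=
    integrable_ball_of_continuous (by fun_prop) R
  -- The divergence theorem for ψ² w x/‖x‖. The Riccati equation w' + (n-1)w/r = -w² - κ/r - E
  -- supplies the terms of the form.
  have key : ∫ x in B n R, (2 * w ‖x‖ * ψ x * inner ℝ (gradient ψ x) x / ‖x‖ - (w ‖x‖ * ψ x) ^ 2
      - κ * (ψ x * ψ x / ‖x‖) - E * (ψ x * ψ x))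
      = ∫ x, regSol' n κ E R / regSol n κ E R * (ψ x * ψ x) ∂(surf n R) := by
    refine integral_ball_of_radial_deriv hn hR
      (K := fun θ r => r ^ (n - 1) * regSol' n κ E r / regSol n κ E r * ψ (r • (θ : Eucl n)) ^ 2)
      (K' := fun θ r => (-(κ * r ^ (n - 2) + E * r ^ (n - 1)) * regSol n κ E r * regSol n κ E r
          - r ^ (n - 1) * regSol' n κ E r * regSol' n κ E r) / regSol n κ E r ^ 2
          * ψ (r • (θ : Eucl n)) ^ 2
        + r ^ (n - 1) * regSol' n κ E r / regSol n κ E r *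
          (2 * ψ (r • (θ : Eucl n)) * inner ℝ (gradient ψ (r • (θ : Eucl n))) (θ : Eucl n)))
      ((i1.sub (i2.const_mul κ)).sub (i3.const_mul E)) (by fun_prop) ?_ ?_ ?_ ?_ ?_
    · intro θ r hr
      have h1 := (hasDerivAt_pow_mul_regSol' hn κ E r).div (hasDerivAt_regSol hn κ E r) (hf r hr).ne'
      have h2 := (hasDerivAt_along_ray hψ (θ : Eucl n) r).pow 2
      refine (h1.mul h2).congr_deriv ?_
      simp only [Pi.pow_apply, Pi.div_apply]
      push_cast
      ring
    · intro θ
      have h1 := continuous_ray hψ θ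
      have h2 := continuous_ray_deriv hψ θ
      refine ContinuousOn.add (ContinuousOn.mul (ContinuousOn.div (by fun_prop) (by fun_prop) ?_)
        (by fun_prop)) (ContinuousOn.mul (ContinuousOn.div (by fun_prop) (by fun_prop) ?_)
        (by fun_prop))
      · intro r hr; exact pow_ne_zero _ (hf r hr).ne'
      · intro r hr; exact (hf r hr).ne'
    · intro θ
      simp [show n - 1 ≠ 0 by omega]
    · intro θ
      ring
    · intro θ r hr
      have hr' : ‖r • (θ : Eucl n)‖ = r := norm_smul_sphere hr.1.le θ
      have hr0 := hr.1.ne'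
      have hf0 := (hf r ⟨hr.1.le, hr.2.le⟩).ne'
      rw [hr', hwr r ⟨hr.1.le, hr.2.le⟩, inner_smul_right]
      obtain ⟨m, rfl⟩ := Nat.exists_eq_add_of_le hn
      rw [show 2 + m - 1 = m + 1 by omega, show 2 + m - 2 = m by omega]
      field_simp
      ring
  have i02 : Integrable (fun x => inner ℝ (gradient ψ x) (gradient ψ x) - κ * (ψ x * ψ x / ‖x‖))
      (volume.restrict (B n R)) := i0.sub (i2.const_mul κ)
  rw [← integral_const_mul, ← key]
  unfold schroForm
  rw [← integral_const_mul, ← integral_const_mul, ← integral_sub i0 (i2.const_mul κ),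
    ← integral_sub i02 (i3.const_mul E)]
  refine integral_mono ((i1.sub (i2.const_mul κ)).sub (i3.const_mul E))
    (i02.sub (i3.const_mul E)) fun x => ?_
  have h1 : |inner ℝ (gradient ψ x) x / ‖x‖| ≤ ‖gradient ψ x‖ := by
    rw [abs_div, abs_norm]
    exact div_le_of_le_mul₀ (norm_nonneg _) (norm_nonneg _) (abs_real_inner_le_norm _ _)
  have h2 : (inner ℝ (gradient ψ x) x / ‖x‖) ^ 2 ≤ ‖gradient ψ x‖ ^ 2 := by
    rw [← sq_abs]
    exact pow_le_pow_left₀ (abs_nonneg _) h1 2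
  have h3 : 2 * w ‖x‖ * ψ x * inner ℝ (gradient ψ x) x / ‖x‖
      = 2 * (w ‖x‖ * ψ x) * (inner ℝ (gradient ψ x) x / ‖x‖) := by ring
  simp only [real_inner_self_eq_norm_sq]
  rw [h3]
  -- Pointwise |∇ψ|² ≥ (∂ᵣψ)² ≥ 2wψ ∂ᵣψ - w²ψ².
  nlinarith [sq_nonneg (inner ℝ (gradient ψ x) x / ‖x‖ - w ‖x‖ * ψ x)]

theorem schroForm_self_ge {u : Eucl n → ℝ} {G : Eucl n → Eucl n} {g : Eucl n → ℝ}
    (h : IsH1Ball R u G g) :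
    regSol' n κ E R / regSol n κ E R * ∫ x, g x * g x ∂(surf n R)
      ≤ schroForm (B n R) κ E u G u G := by
  obtain ⟨hui, f, hfs, t1, t2, t3, t4⟩ := h.exists_approx hn hR
  have m1 := fun k => memLp_ball_of_continuous (hfs k).continuous R 2
  have m2 := fun k => memLp_invMeas_of_continuous hn (hfs k).continuous R 2
  have m3 := fun k => memLp_ball_of_continuous (continuous_gradient (hfs k)) R 2
  have T := tendsto_schroForm κ E h.1.1 hui h.1.2.1 h.1.1 hui h.1.2.1 m1 m2 m3 m1 m2 m3
    t1 t4 t2 t1 t4 t2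
  have m4 := fun k => memLp_surf_of_continuous (hfs k).continuous hR 2
  have T3 := (tendsto_integral_mul_of_eLpNorm h.2.1 h.2.1 m4 m4 t3 t3).const_mul
    (regSol' n κ E R / regSol n κ E R)
  exact le_of_tendsto_of_tendsto' T3 T fun k => schroForm_self_ge_of_contDiff hn hR hf (hfs k)

/-- For finite γ, testing the eigenvalue equation with u itself in Jacobi's inequality gives (e - E)
∫u² ≥ (f'(R)/f(R) + γ) ∫g² ≥ 0. In the Dirichlet case the boundary integrals vanish. Radiality of u
plays no role. -/
theorem le_of_isEigenvalueBall {γ : WithTop ℝ}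
    (hγ : ∀ c : ℝ, γ = c → 0 ≤ regSol' n κ E R + c * regSol n κ E R) {e : ℝ}
    (he : IsEigenvalueBall n κ γ R e) : E ≤ e := by
  obtain ⟨u, hu0, G, g, hH, hw⟩ := he
  have hJ := schroForm_self_ge hn hR hf hH
  have hfR := hf R ⟨hR, le_rfl⟩
  have hgg : 0 ≤ ∫ x, g x * g x ∂(surf n R) := integral_nonneg fun x => mul_self_nonneg _
  have hshift : schroForm (B n R) κ E u G u G
      = schroForm (B n R) κ e u G u G + (e - E) * ∫ x in B n R, u x * u x := by
    unfold schroForm; ring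
  have huu : 0 < ∫ x in B n R, u x * u x := by
    refine (integral_nonneg fun x => mul_self_nonneg _).lt_of_ne fun h0 => hu0 ?_
    have := (integral_eq_zero_iff_of_nonneg (fun x => mul_self_nonneg (u x))
      (hH.1.1.integrable_mul_of_two hH.1.1)).1 h0.symm
    filter_upwards [this] with x hx
    exact mul_self_eq_zero.1 hx
  have hkey : 0 ≤ (e - E) * ∫ x in B n R, u x * u x := by
    induction γ using WithTop.recTopCoe with
    | top =>
      have h1 := hw.2 u G g hH hw.1
      have h2 : ∫ x, g x * g x ∂(surf n R) = 0 := integral_eq_zero_of_ae (by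
        filter_upwards [hw.1] with x hx
        simp [hx])
      rw [h2, mul_zero, hshift, h1, zero_add] at hJ
      exact hJ
    | coe c =>
      have h1 := hw u G g hH
      have h2 : 0 ≤ (regSol' n κ E R / regSol n κ E R + c) * ∫ x, g x * g x ∂(surf n R) := by
        refine mul_nonneg ?_ hgg
        have := div_nonneg (hγ c rfl) hfR.le
        rwa [add_div, mul_div_assoc, div_self hfR.ne', mul_one] at this
      rw [add_mul] at h2
      linarith
  by_contra hlt
  have := mul_neg_of_neg_of_pos (sub_neg.2 (not_le.1 hlt)) huu
  linarith

end Jacobi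

/-! ### The first zero gives the smallest eigenvalue. -/

section Least

theorem one_le_kummerM {a b x : ℝ} (ha : 0 ≤ a) (hb : 1 ≤ b) (hx : 0 ≤ x) : 1 ≤ kummerM a b x := by
  have h : HasSum (fun k : ℕ => kummerCoeff a b k * (x ^ k / (k.factorial : ℝ))) (kummerM a b x) :=
    (expBounded_kummerCoeff (𝕂 := ℝ) a hb).hasSum x
  have := le_hasSum h 0 fun k _ => mul_nonneg (kummerCoeff_nonneg ha hb k) (by positivity)
  simpa [kummerCoeff_zero] using this

/-- The derivative is (a/b) M(a+1, b+1; x), and the second factor is at least 1 because a + 1 ≥ 0.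
-/
theorem antitoneOn_kummerM {a b : ℝ} (ha : -1 ≤ a) (ha0 : a ≤ 0) (hb : 1 ≤ b) :
    AntitoneOn (kummerM a b) (Set.Ici 0) := by
  have hd : ∀ x, HasDerivAt (kummerM a b) (a / b * kummerM (a + 1) (b + 1) x) x :=
    fun x => hasDerivAt_kummerM (𝕂 := ℝ) a hb x
  refine antitoneOn_of_deriv_nonpos (convex_Ici 0)
    (fun x _ => (hd x).continuousAt.continuousWithinAt)
    (fun x _ => (hd x).differentiableAt.differentiableWithinAt) fun x hx => ?_
  rw [interior_Ici] at hx
  rw [(hd x).deriv]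
  exact mul_nonpos_of_nonpos_of_nonneg (div_nonpos_of_nonpos_of_nonneg ha0 (by linarith))
    (zero_le_one.trans (one_le_kummerM (by linarith) (by linarith) (le_of_lt hx)))

variable {n : ℕ} (hn : 2 ≤ n) {κ : ℝ} (hκ : 0 < κ) {γ : WithTop ℝ} {R z E : ℝ}
include hn hκ

/-- Unlike the equivalence `transEq_iff_bdryCond`, this keeps the sign: the prefactor is positive.
-/
theorem regSol'_add_eq_transFun (hz : 0 < z) (hE : E = -κ ^ 2 / (4 * z ^ 2)) (hR : 0 ≤ R) (c : ℝ) :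
    regSol' n κ E R + c * regSol n κ E R
      = √|E| * Real.exp (-(√|E| * R)) * transFun n κ c R z := by
  obtain ⟨e1, e2⟩ := two_mul_sqrt_mul_of_neg hκ hz hE
  obtain ⟨h1, h2⟩ := kummerM_mul_exp_eq_regSol hn κ E (𝕂 := ℝ) (ex := Real.exp) Real.hasDerivAt_exp
    Real.exp_zero (z := z) (σ := √|E|) (by simpa using e1) (by simpa using e2) hR
  simp only [RCLike.ofReal_real_eq_id, id_eq] at h1 h2
  have hρ : κ * R / z = 2 * √|E| * R := by rw [← e1]; field_simp
  rw [← h1, ← h2]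
  simp only [transFun]
  rw [hρ]
  have hc : 2 * c * z / κ * √|E| = c := by
    have : 2 * c * z * √|E| = c * κ := by rw [← e1]; ring
    field_simp
    linarith
  linear_combination (-(kummerM (a₀ n z) (b₀ ℝ n) (2 * √|E| * R) * Real.exp (-(√|E| * R)))) * hc

/-- If a₀ ≥ 0, all Kummer coefficients are nonnegative. If -1 ≤ a₀ < 0, then M is decreasing and
only its value at R matters. For γ = ∞ that value is T. For finite γ ≥ κ/(n-1), the derivative term
of T is nonpositive and 2γz/κ - 1 ≥ 0, so T > 0 forces M > 0. -/
theorem regSol_pos_of_transFun_pos (hz : 0 < z) (hE : E = -κ ^ 2 / (4 * z ^ 2))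
    (hT : 0 < transFun n κ γ R z) (hz1 : z < ((n : ℝ) - 1) / 2 + 1 / 2)
    (hcase : z ≤ ((n : ℝ) - 1) / 2 ∨ ((κ / ((n : ℝ) - 1) : ℝ) : WithTop ℝ) ≤ γ) :
    ∀ r ∈ Set.Icc 0 R, 0 < regSol n κ E r := by
  intro r hr
  have hb := one_le_natCast_sub_one hn
  obtain ⟨e1, e2⟩ := two_mul_sqrt_mul_of_neg hκ hz hE
  rw [← kummerM_mul_exp_real hn e1 e2 hr.1, b₀_real]
  refine mul_pos ?_ (Real.exp_pos _)
  have hσ := Real.sqrt_nonneg |E|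
  have hx : 0 ≤ 2 * √|E| * r := mul_nonneg (by linarith) hr.1
  have ha := a₀_real n z
  rcases le_or_gt z (((n : ℝ) - 1) / 2) with h | h
  · linarith [one_le_kummerM (a := a₀ n z) (by rw [ha]; linarith) hb hx]
  · have hγ := hcase.resolve_left (not_le.2 h)
    have hρ : κ * R / z = 2 * √|E| * R := by rw [← e1]; field_simp
    have hX : 2 * √|E| * r ≤ 2 * √|E| * R := mul_le_mul_of_nonneg_left hr.2 (by linarith)
    have ha0 : a₀ n z ≤ 0 := by rw [ha]; linarith
    have ha1 : -1 ≤ a₀ n z := by rw [ha]; linarith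
    refine lt_of_lt_of_le ?_ (antitoneOn_kummerM ha1 ha0 hb hx (hx.trans hX) hX)
    induction γ using WithTop.recTopCoe with
    | top =>
      simp only [transFun, hρ, b₀_real] at hT
      exact hT
    | coe c =>
      have hc : κ / ((n : ℝ) - 1) ≤ c := WithTop.coe_le_coe.1 hγ
      simp only [transFun, hρ, b₀_real] at hT
      have hM1 : 1 ≤ kummerM (a₀ n z + 1) ((n : ℝ) - 1 + 1) (2 * √|E| * R) :=
        one_le_kummerM (by linarith) (by linarith) (hx.trans hX)
      have h1 : a₀ n z / ((n : ℝ) - 1) * kummerM (a₀ n z + 1) ((n : ℝ) - 1 + 1) (2 * √|E| * R) ≤ 0 :=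
        mul_nonpos_of_nonpos_of_nonneg (div_nonpos_of_nonpos_of_nonneg ha0 (by linarith))
          (by linarith)
      have h2 : 0 ≤ 2 * c * z / κ - 1 := by
        rw [div_le_iff₀ (by linarith)] at hc
        rw [sub_nonneg, one_le_div hκ]
        have hc0 : 0 ≤ c := by
          by_contra hneg
          nlinarith
        nlinarith
      by_contra hM
      have := mul_nonpos_of_nonneg_of_nonpos h2 (not_lt.1 hM)
      nlinarith

/-- T cannot change sign before its first zero, so every z' < z satisfies the positivity conditions
and -κ²/(4z'²) bounds all eigenvalues below. The passage z' → z is needed because at z itself the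
solution may vanish at R. -/
theorem isLeast_eigenvalue (hR : 0 < R) {z₀ : ℝ} (hz₀ : 0 < z₀) (hz₀z : z₀ < z)
    (hT : 0 < transFun n κ γ R z₀) (hz : IsLeast {ζ : ℝ | 0 < ζ ∧ TransEq n κ γ R ζ} z)
    (hz1 : z < ((n : ℝ) - 1) / 2 + 1 / 2)
    (hcase : z ≤ ((n : ℝ) - 1) / 2 ∨ ((κ / ((n : ℝ) - 1) : ℝ) : WithTop ℝ) ≤ γ) :
    IsLeast {e : ℝ | IsEigenvalueBall n κ γ R e} (-κ ^ 2 / (4 * z ^ 2)) := by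
  have hz0 : 0 < z := hz.1.1
  constructor
  · obtain ⟨e1, e2⟩ := two_mul_sqrt_mul_of_neg hκ hz0 rfl
    have hb := (transEq_real_iff hn hκ.ne' γ e1 e2 hR.le).1 hz.1.2
    exact ⟨_, (isEigenfunctionBall_of_eq_regSol hn hR hb one_ne_zero
      (Eventually.of_forall fun x => rfl)).1⟩
  · intro e he
    have hpos : ∀ z', 0 < z' → z' < z → 0 < transFun n κ γ R z' := by
      intro z' h0 h1
      by_contra hneg
      have hsub : Set.uIcc z₀ z' ⊆ Set.Ioo 0 z := Set.ordConnected_Ioo.uIcc_subset ⟨hz₀, hz₀z⟩ ⟨h0, h1⟩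
      obtain ⟨ζ, hζ, hζ0⟩ := intermediate_value_uIcc
        ((continuousOn_transFun hn κ γ R).mono fun x hx => (hsub hx).1)
        (Set.mem_uIcc.2 (Or.inr ⟨not_lt.1 hneg, hT.le⟩))
      exact absurd (hz.2 ⟨(hsub hζ).1, transEq_iff_transFun.2 hζ0⟩) (not_le.2 (hsub hζ).2)
    have hle : ∀ z', 0 < z' → z' < z → -κ ^ 2 / (4 * z' ^ 2) ≤ e := by
      intro z' h0 h1
      have hcase' := hcase.imp_left fun h => h1.le.trans h
      refine le_of_isEigenvalueBall hn hR.le (regSol_pos_of_transFun_pos hn hκ h0 rfl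
        (hpos z' h0 h1) (h1.trans hz1) hcase') (fun c hc => ?_) he
      rw [regSol'_add_eq_transFun hn hκ h0 rfl hR.le c, ← hc]
      have := hpos z' h0 h1
      positivity
    have hcont : Tendsto (fun z' : ℝ => -κ ^ 2 / (4 * z' ^ 2)) (𝓝[<] z) (𝓝 (-κ ^ 2 / (4 * z ^ 2))) := by
      refine (ContinuousAt.div (by fun_prop) (by fun_prop) (by positivity)).tendsto.mono_left
        nhdsWithin_le_nhds
    refine le_of_tendsto hcont ?_
    filter_upwards [Ioo_mem_nhdsLT hz0] with z' hz' using hle z' hz'.1 hz'.2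

end Least

/-! ### Exponential asymptotics of the first zero and the smallest eigenvalue. -/

theorem exists_least_asymptotics {n : ℕ} (hn : 2 ≤ n) {κ : ℝ} (hκ : 0 < κ) {γ : WithTop ℝ}
    (hγ : ((-κ / ((n : ℝ) - 1) : ℝ) : WithTop ℝ) < γ) :
    ∃ z E : ℝ → ℝ,
        (∀ᶠ R in atTop, IsLeast {ζ : ℝ | 0 < ζ ∧ TransEq n κ γ R ζ} (z R)) ∧
        (∀ᶠ R in atTop, IsLeast {e : ℝ | IsEigenvalueBall n κ γ R e} (E R)) ∧
        ∀ ε : ℝ, 0 < ε →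
          ((fun R => z R - ((n : ℝ) - 1) / 2) =O[atTop]
            fun R => Real.exp (-(2 * (1 - ε) * κ * R / ((n : ℝ) - 1)))) ∧
          ((fun R => E R - (-κ ^ 2 / ((n : ℝ) - 1) ^ 2)) =O[atTop]
            fun R => Real.exp (-((1 - ε) * (2 * κ / ((n : ℝ) - 1)) * R))) := by
  have hb := one_le_natCast_sub_one hn
  have hev := fun (q : ℝ) (hq0 : 0 < q) (hq1 : q < 1) => exists_isLeast_transEq hn hκ hγ hq0 hq1
  have hhalf := hev (1 / 2) (by norm_num) (by norm_num)
  -- The infimum fixes one function z(R) for all rates q; only the threshold for R depends on q.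
  set z : ℝ → ℝ := fun R => sInf {ζ : ℝ | 0 < ζ ∧ TransEq n κ γ R ζ} with hz
  have hzb : ∀ q : ℝ, 0 < q → q < 1 → ∀ᶠ R in atTop,
      |z R - ((n : ℝ) - 1) / 2| ≤ Real.exp (-(q * (2 * κ * R / ((n : ℝ) - 1)))) := by
    intro q hq0 hq1
    filter_upwards [hev q hq0 hq1] with R hR
    obtain ⟨ζ, z₀, -, -, -, h1, h2, -⟩ := hR
    have hζ : z R = ζ := h1.csInf_eq
    rwa [hζ]
  have hzO : ∀ ε : ℝ, 0 < ε → (fun R => z R - ((n : ℝ) - 1) / 2) =O[atTop]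
      fun R => Real.exp (-(2 * (1 - ε) * κ * R / ((n : ℝ) - 1))) := by
    intro ε hε
    refine IsBigO.of_bound 1 ?_
    -- The maximum with 1/2 keeps the rate in (0, 1) even for ε ≥ 1; a larger rate only strengthens
    -- the bound.
    filter_upwards [hzb (max (1 - ε) (1 / 2)) (lt_of_lt_of_le (by norm_num) (le_max_right _ _))
      (max_lt (by linarith) (by norm_num)), eventually_ge_atTop 0] with R hR hR0
    rw [Real.norm_eq_abs, Real.norm_eq_abs, Real.abs_exp, one_mul]
    refine hR.trans (Real.exp_le_exp.2 (neg_le_neg ?_))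
    have h1 : 0 ≤ 2 * κ * R / ((n : ℝ) - 1) := by positivity
    have h2 := mul_le_mul_of_nonneg_right (le_max_left (1 - ε) (1 / 2)) h1
    refine le_trans (le_of_eq ?_) h2
    ring
  have hzt : Tendsto z atTop (𝓝 (((n : ℝ) - 1) / 2)) := by
    have h1 : Tendsto (fun R => 2 * κ * R / ((n : ℝ) - 1)) atTop atTop :=
      (tendsto_id.const_mul_atTop (by positivity : 0 < 2 * κ)).atTop_div_const (by linarith)
    have h2 : Tendsto (fun R => Real.exp (-(1 / 2 * (2 * κ * R / ((n : ℝ) - 1))))) atTop (𝓝 0) :=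
      Real.tendsto_exp_neg_atTop_nhds_zero.comp (h1.const_mul_atTop (by norm_num))
    rw [tendsto_iff_dist_tendsto_zero]
    exact squeeze_zero' (Eventually.of_forall fun _ => dist_nonneg)
      (hzb (1 / 2) (by norm_num) (by norm_num)) h2
  refine ⟨z, fun R => -κ ^ 2 / (4 * z R ^ 2), ?_, ?_, fun ε hε => ⟨hzO ε hε, ?_⟩⟩
  · filter_upwards [hhalf] with R hR
    obtain ⟨ζ, z₀, -, -, -, h1, -⟩ := hR
    have hζ : z R = ζ := h1.csInf_eq
    rwa [hζ]
  · filter_upwards [hhalf, eventually_gt_atTop 0] with R hR hR0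
    obtain ⟨ζ, z₀, h1, h2, h3, h4, -, h5, h6⟩ := hR
    have hζ : z R = ζ := h4.csInf_eq
    rw [hζ]
    exact isLeast_eigenvalue hn hκ hR0 h1 h2 h3 h4 h5 h6
  · have hz1 : (((n : ℝ) - 1) / 2) ≠ 0 := by
      have : 0 < ((n : ℝ) - 1) / 2 := by linarith
      exact this.ne'
    -- The energy is a differentiable function of z at (n-1)/2, so the error of z(R) carries over
    -- with the same order.
    have hd : DifferentiableAt ℝ (fun z : ℝ => -κ ^ 2 / (4 * z ^ 2)) (((n : ℝ) - 1) / 2) :=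
      DifferentiableAt.div (by fun_prop) (by fun_prop) (by positivity)
    have h1 := hd.hasDerivAt.isBigO_sub.comp_tendsto hzt
    have e1 : -κ ^ 2 / (4 * (((n : ℝ) - 1) / 2) ^ 2) = -κ ^ 2 / ((n : ℝ) - 1) ^ 2 := by ring
    have h2 := h1.trans (hzO ε hε)
    simp only [Function.comp_def, e1] at h2
    refine h2.congr_right fun R => ?_
    congr 1
    ring

theorem lemma4p1 (n : ℕ) (hn : 2 ≤ n) (κ : ℝ) (hκ : 0 < κ) (γ : WithTop ℝ) :
    -- (i), balls, negative eigenvalues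
    (∀ R : ℝ, 0 < R → ∀ E : ℝ, E < 0 → ∀ u : Eucl n → ℝ,
      (IsEigenfunctionBall κ γ R E u ∧ IsRadialOn (B n R) u) ↔
        ∃ z : ℝ, 0 < z ∧ E = -κ ^ 2 / (4 * z ^ 2) ∧ TransEq n κ γ R z ∧
          ∃ c : ℝ, c ≠ 0 ∧ ∀ᵐ x ∂(volume.restrict (B n R)),
            u x = c * (kummerM (a₀ n z) (b₀ ℝ n) (2 * √|E| * ‖x‖) * Real.exp (-(√|E| * ‖x‖)))) ∧
    -- (i), balls, positive eigenvalues: `√|E|` and `z` become `√(-E) = i √|E|` and `-i z`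
    (∀ R : ℝ, 0 < R → ∀ E : ℝ, 0 < E → ∀ u : Eucl n → ℝ,
      (IsEigenfunctionBall κ γ R E u ∧ IsRadialOn (B n R) u) ↔
        ∃ z : ℝ, 0 < z ∧ E = κ ^ 2 / (4 * z ^ 2) ∧ TransEq n κ γ R (-Complex.I * (z : ℂ)) ∧
          ∃ c : ℝ, c ≠ 0 ∧ ∀ᵐ x ∂(volume.restrict (B n R)),
            (u x : ℂ) = (c : ℂ) *
              (kummerM (a₀ n (-Complex.I * (z : ℂ))) (b₀ ℂ n)
                  (2 * (Complex.I * (√|E| : ℝ)) * (‖x‖ : ℝ)) *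
                Complex.exp (-(Complex.I * (√|E| : ℝ) * (‖x‖ : ℝ))))) ∧
    -- (i), whole space, eigenfunctions in `H¹(ℝⁿ)`
    (∀ (E : ℝ) (u : Eucl n → ℝ),
      (IsEigenfunctionSpace κ E u ∧ IsRadialOn Set.univ u) ↔
        ∃ j : ℕ, 1 ≤ j ∧ E = -κ ^ 2 / (4 * ((j : ℝ) + ((n : ℝ) - 3) / 2) ^ 2) ∧
          ∃ c : ℝ, c ≠ 0 ∧ ∀ᵐ x ∂(volume : Measure (Eucl n)),
            u x = c * (kummerM (a₀ n ((j : ℝ) + ((n : ℝ) - 3) / 2)) (b₀ ℝ n) (2 * √|E| * ‖x‖) *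
              Real.exp (-(√|E| * ‖x‖)))) ∧
    -- (i), whole space, negative `E` and solutions that decay at infinity
    (∀ (E : ℝ), E < 0 → ∀ (u : Eucl n → ℝ),
      (IsDecayingSolution κ E u ∧ IsRadialOn Set.univ u) ↔
        ∃ j : ℕ, 1 ≤ j ∧ E = -κ ^ 2 / (4 * ((j : ℝ) + ((n : ℝ) - 3) / 2) ^ 2) ∧
          ∃ c : ℝ, c ≠ 0 ∧ ∀ᵐ x ∂(volume : Measure (Eucl n)),
            u x = c * (kummerM (a₀ n ((j : ℝ) + ((n : ℝ) - 3) / 2)) (b₀ ℝ n) (2 * √|E| * ‖x‖) *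
              Real.exp (-(√|E| * ‖x‖)))) ∧
    -- (i), whole space, the Kummer factor is a polynomial in `r` of degree `j - 1`
    (∀ (j : ℕ), 1 ≤ j → ∀ E : ℝ, E = -κ ^ 2 / (4 * ((j : ℝ) + ((n : ℝ) - 3) / 2) ^ 2) →
      ∃ p : Polynomial ℝ, p.degree = ((j - 1 : ℕ) : WithBot ℕ) ∧ ∀ r : ℝ,
        kummerM (a₀ n ((j : ℝ) + ((n : ℝ) - 3) / 2)) (b₀ ℝ n) (2 * √|E| * r) = p.eval r) ∧
    -- (ii)
    (((-κ / ((n : ℝ) - 1) : ℝ) : WithTop ℝ) < γ →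
      ∃ z E : ℝ → ℝ,
        (∀ᶠ R in atTop, IsLeast {ζ : ℝ | 0 < ζ ∧ TransEq n κ γ R ζ} (z R)) ∧
        (∀ᶠ R in atTop, IsLeast {e : ℝ | IsEigenvalueBall n κ γ R e} (E R)) ∧
        ∀ ε : ℝ, 0 < ε →
          ((fun R => z R - ((n : ℝ) - 1) / 2) =O[atTop]
            fun R => Real.exp (-(2 * (1 - ε) * κ * R / ((n : ℝ) - 1)))) ∧
          ((fun R => E R - (-κ ^ 2 / ((n : ℝ) - 1) ^ 2)) =O[atTop]
            fun R => Real.exp (-((1 - ε) * (2 * κ / ((n : ℝ) - 1)) * R)))) := by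
  exact ⟨fun R hR E hE u => radial_eigenfunction_neg_iff hn hκ γ hR hE u,
    fun R hR E hE u => radial_eigenfunction_pos_iff hn hκ γ hR hE u,
    fun E u => radial_eigenfunction_space_iff hn hκ E u,
    fun E hE u => radial_decayingSolution_iff hn hκ hE u,
    fun j hj E hE => exists_polynomial_level hn hκ hj hE, fun hγ => exists_least_asymptotics hn hκ hγ⟩
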